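/- Let $n\ge 1$ and let $\pi$ be the Schrödinger representation of the Heisenberg group $\mathbb H^n=\mathbb R^n\times\mathbb R^n\times\mathbb R$ on $L^2(\mathbb R^n)$, $\pi(x,u,\tau)\varphi(\xi)=e^{i\tau}e^{i(x\cdot\xi+\frac12 x\cdot u)}\varphi(\xi+u)$. A function $\varphi\in L^2(\mathbb R^n)$ is called an analytic vector for $\pi$ if the map $(x,u,\tau)\mapsto\pi(x,u,\tau)\varphi$ is real analytic from $\mathbb H^n$ into $L^2(\mathbb R^n)$. Let $P_k$ be the orthogonal projection of $L^2(\mathbb R^n)$ onto the eigenspace of the Hermite operator $H=-\Delta+|x|^2$ with eigenvalue $2k+n$, i.e. onto the span of the Hermite functions $\Phi_\alpha$ with $|\alpha|=k$. Let $\varphi_k^{n-1}(z,w)=L_k^{n-1}\big(\tfrac12(z^2+w^2)\big)e^{-\frac14(z^2+w^2)}$, $z,w\in\mathbb C^n$, be the Laguerre functions, where $z^2=\sum_j z_j^2$. For $t>0$ let $V_t^\omega$ be the space of all $\varphi\in L^2(\mathbb R^n)$ such that $$\sum_{k=0}^\infty \|P_k\varphi\|_2^2\,\frac{k!\,(n-1)!}{(k+n-1)!}\,\varphi_k^{n-1}(2iy,2iv)<\infty\quad\text{for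 all } y,v\in\mathbb R^n \text{ with } |y|^2+|v|^2\le t^2 .$$ Put $\Omega_t=\{x+iy\in\mathbb C^n:\ |y|<t\}$, and say that $\varphi$ satisfies $(\ast)_t$ if $\varphi$ agrees almost everywhere on $\mathbb R^n$ with a holomorphic function on $\Omega_t$, again denoted $\varphi$, such that for some constant $C$ $$|\varphi(x+iy)|\le C\,e^{-|x|(t^2-|y|^2)^{1/2}}\qquad\text{for all } x+iy\in\Omega_t .$$ Let $\varphi\in L^2(\mathbb R^n)$. Then: 1. $\varphi$ is an analytic vector for $\pi$ if and only if it satisfies $(\ast)_t$ for some $t>0$. 2. If $t>0$ and $\varphi\in V_t^\omega$, then $\varphi$ extends holomorphically to $\Omega_t$ and this extension satisfies the estimate of $(\ast)_s$ on $\Omega_s$ for every $0<s<t$ (with a constant depending on $s$). 3. Conversely, if $\varphi$ satisfies $(\ast)_t$ for some $t>0$, then $\varphi\in V_s^\omega$ for every $0<s<t$. -/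

import Mathlib

open MeasureTheory

noncomputable section

namespace AnalyticVectors

/-- The real Euclidean space of dimension `n`. -/
abbrev RSpace (n : ℕ) : Type := EuclideanSpace ℝ (Fin n)

/-- The complex Euclidean space of dimension `n`. -/
abbrev CSpace (n : ℕ) : Type := EuclideanSpace ℂ (Fin n)

/-- The Hilbert space of square integrable complex functions (modulo null sets) for Lebesgue
measure. -/
abbrev LTwo (n : ℕ) : Type := Lp ℂ 2 (volume : Measure (RSpace n))

/-! ### The Schrödinger representation and its analytic vectors -/

/-- `ξ ↦ e^{i τ} e^{i (x·ξ + x·u/2)} φ(ξ + u)`. -/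
def schrodingerFun {n : ℕ} (x u : RSpace n) (τ : ℝ) (φ : RSpace n → ℂ) (ξ : RSpace n) : ℂ :=
  Complex.exp (Complex.I * (τ : ℂ)) *
    Complex.exp (Complex.I * ((inner ℝ x ξ + (1 / 2) * inner ℝ x u : ℝ) : ℂ)) * φ (ξ + u)

theorem memLp_schrodingerFun {n : ℕ} (x u : RSpace n) (τ : ℝ) (φ : LTwo n) :
    MemLp (schrodingerFun x u τ φ) 2 (volume : Measure (RSpace n)) := by
  have h1 : MemLp (fun ξ : RSpace n => (φ : RSpace n → ℂ) (ξ + u)) 2 volume :=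
    (Lp.memLp φ).comp_measurePreserving (measurePreserving_add_right volume u)
  refine h1.of_le ?_ (Filter.Eventually.of_forall fun ξ => ?_)
  · refine AEStronglyMeasurable.mul (Continuous.aestronglyMeasurable ?_) h1.1
    fun_prop
  · simp only [schrodingerFun, norm_mul, mul_comm Complex.I, Complex.norm_exp_ofReal_mul_I, one_mul,
      le_refl]

/-- The operator `π(x, u, τ)` of the Schrödinger representation (with parameter `1`) of the
Heisenberg group `ℝⁿ × ℝⁿ × ℝ`. -/
def schrodinger {n : ℕ} (x u : RSpace n) (τ : ℝ) (φ : LTwo n) : LTwo n :=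
  (memLp_schrodingerFun x u τ φ).toLp (schrodingerFun x u τ φ)

/-- `φ` is an analytic vector if its orbit map `(x, u, τ) ↦ π(x, u, τ) φ` is real analytic, as a
map from the Heisenberg group to the Hilbert space. -/
def IsAnalyticVector {n : ℕ} (φ : LTwo n) : Prop :=
  AnalyticOnNhd ℝ (fun g : RSpace n × RSpace n × ℝ => schrodinger g.1 g.2.1 g.2.2 φ) Set.univ

/-! ### Hermite functions and the spectral projections of `H = -Δ + |x|²` -/

/-- The `L²`-normalized Hermite function of one variable,
`h_k(x) = (2^k k! √π)^{-1/2} H_k(x) e^{-x²/2}`, where the physicists' polynomial `H_k` is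
written through Mathlib's (probabilists') polynomials as `H_k(x) = 2^{k/2} He_k(√2 x)`. -/
def hermiteFun (k : ℕ) (x : ℝ) : ℝ :=
  (√((k.factorial : ℝ) * √Real.pi))⁻¹ * Polynomial.aeval (√2 * x) (Polynomial.hermite k) *
    Real.exp (-x ^ 2 / 2)

/-- The Hermite function `Φ_α(x) = ∏ⱼ h_{αⱼ}(xⱼ)`, an eigenfunction of `H` with eigenvalue
`2|α| + n`. -/
def hermiteMulti {n : ℕ} (α : Fin n → ℕ) (x : RSpace n) : ℂ :=
  ∏ j, ((hermiteFun (α j) (x j) : ℝ) : ℂ)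

theorem integrable_polynomial_mul_exp (p : Polynomial ℝ) :
    Integrable (fun x : ℝ => p.eval x * Real.exp (-x ^ 2)) := by
  induction p using Polynomial.induction_on' with
  | add p q hp hq =>
    simp only [Polynomial.eval_add, add_mul]
    exact hp.add hq
  | monomial k a =>
    have h := (integrable_rpow_mul_exp_neg_mul_sq (b := 1) one_pos (s := (k : ℝ))
      (by have : (0 : ℝ) ≤ k := k.cast_nonneg
          linarith)).const_mul a
    refine h.congr (Filter.Eventually.of_forall fun x => ?_)
    simp [Polynomial.eval_monomial, mul_assoc]

theorem continuous_hermiteFun (k : ℕ) : Continuous (hermiteFun k) := by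
  have h : Continuous fun x : ℝ => Polynomial.aeval (√2 * x) (Polynomial.hermite k) :=
    (Polynomial.continuous_aeval _).comp (by fun_prop)
  unfold hermiteFun
  fun_prop

theorem integrable_hermiteFun_sq (k : ℕ) : Integrable (fun x : ℝ => hermiteFun k x ^ 2) := by
  have h := (integrable_polynomial_mul_exp
    ((((Polynomial.hermite k).map (Int.castRingHom ℝ)).comp
      (Polynomial.C (√2) * Polynomial.X)) ^ 2)).const_mul (((√((k.factorial : ℝ) * √Real.pi))⁻¹) ^ 2)
  refine h.congr (Filter.Eventually.of_forall fun x => ?_)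
  have e : Real.exp (-x ^ 2) = Real.exp (-x ^ 2 / 2) ^ 2 := by
    rw [← Real.exp_nat_mul]
    congr 1
    push_cast
    ring
  simp only [hermiteFun, Polynomial.eval_pow, Polynomial.eval_comp, Polynomial.eval_mul,
    Polynomial.eval_C, Polynomial.eval_X, Polynomial.eval_map, Polynomial.aeval_def, e,
    algebraMap_int_eq]
  ring

theorem memLp_hermiteMulti {n : ℕ} (α : Fin n → ℕ) :
    MemLp (hermiteMulti α) 2 (volume : Measure (RSpace n)) := by
  have hc : Continuous (hermiteMulti α) := by
    unfold hermiteMulti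
    refine continuous_finsetProd _ fun j _ => ?_
    exact Complex.continuous_ofReal.comp ((continuous_hermiteFun (α j)).comp (by fun_prop))
  rw [memLp_two_iff_integrable_sq_norm hc.aestronglyMeasurable]
  have h : Integrable (fun x : Fin n → ℝ => ∏ j, hermiteFun (α j) (x j) ^ 2) volume :=
    Integrable.fintype_prod (f := fun j x => hermiteFun (α j) x ^ 2)
      fun j => integrable_hermiteFun_sq (α j)
  have h' := (EuclideanSpace.volume_preserving_symm_measurableEquiv_toLp (Fin n)).integrable_comp_of_integrable h
  refine h'.congr (Filter.Eventually.of_forall fun x => ?_)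
  simp [hermiteMulti, Finset.prod_pow, ← Finset.abs_prod]

/-- `Φ_α` as an element of the Hilbert space. -/
def hermiteVec {n : ℕ} (α : Fin n → ℕ) : LTwo n :=
  (memLp_hermiteMulti α).toLp (hermiteMulti α)

/-- The `k`-th eigenspace of the Hermite operator (eigenvalue `2k + n`), spanned by the `Φ_α`
with `|α| = k`. -/
def hermiteSpace (n k : ℕ) : Submodule ℂ (LTwo n) :=
  Submodule.span ℂ (hermiteVec '' (Finset.piAntidiag (Finset.univ : Finset (Fin n)) k : Set (Fin n → ℕ)))

instance finiteDimensional_hermiteSpace (n k : ℕ) : FiniteDimensional ℂ (hermiteSpace n k) :=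
  FiniteDimensional.span_of_finite ℂ ((Finset.finite_toSet _).image _)

/-- The orthogonal projection `P_k` onto the `k`-th eigenspace of the Hermite operator. -/
def hermiteProj {n : ℕ} (k : ℕ) (φ : LTwo n) : LTwo n :=
  (hermiteSpace n k).starProjection φ

/-! ### Laguerre functions and the spaces `V_t^ω` -/

/-- The Laguerre polynomial `L_k^a(z) = ∑_{j ≤ k} (-1)^j binom(k + a, k - j) z^j / j!`. -/
def laguerre (k a : ℕ) (z : ℂ) : ℂ :=
  ∑ j ∈ Finset.range (k + 1), (-1) ^ j * ((k + a).choose (k - j) : ℂ) * z ^ j / (j.factorial : ℂ)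

/-- The Laguerre function `φ_k^a(z, w) = L_k^a((z² + w²)/2) e^{-(z² + w²)/4}` on `ℂⁿ × ℂⁿ`, where
`z² = ∑ⱼ zⱼ²` (no complex conjugation). -/
def laguerreFun {n : ℕ} (k a : ℕ) (z w : CSpace n) : ℂ :=
  laguerre k a ((1 / 2) * ((∑ j, z j ^ 2) + ∑ j, w j ^ 2)) *
    Complex.exp (-(1 / 4) * ((∑ j, z j ^ 2) + ∑ j, w j ^ 2))

/-- The inclusion of real points into complex ones. -/
def toComplex {n : ℕ} (x : RSpace n) : CSpace n := WithLp.toLp 2 fun j => (x j : ℂ)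

/-- The coordinatewise real part. -/
def rePart {n : ℕ} (z : CSpace n) : RSpace n := WithLp.toLp 2 fun j => (z j).re

/-- The coordinatewise imaginary part. -/
def imPart {n : ℕ} (z : CSpace n) : RSpace n := WithLp.toLp 2 fun j => (z j).im

/-- The space `V_t^ω` of all `φ` for which
`∑_k ‖P_k φ‖² (k! (n-1)! / (k+n-1)!) φ_k^{n-1}(2iy, 2iv)` converges for all `|y|² + |v|² ≤ t²`.
The terms of this series are nonnegative reals. -/
def VOmega (n : ℕ) (t : ℝ) : Set (LTwo n) :=
  {φ | ∀ y v : RSpace n, ‖y‖ ^ 2 + ‖v‖ ^ 2 ≤ t ^ 2 →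
    Summable fun k : ℕ =>
      ((‖hermiteProj k φ‖ ^ 2 * ((k.factorial : ℝ) * ((n - 1).factorial : ℝ) / ((k + n - 1).factorial : ℝ)) : ℝ) : ℂ) *
        laguerreFun k (n - 1) ((2 * Complex.I) • toComplex y) ((2 * Complex.I) • toComplex v)}

/-! ### Holomorphic extension to tubes -/

/-- The tube domain `Ω_t = {x + iy : |y| < t}`. -/
def tube (n : ℕ) (t : ℝ) : Set (CSpace n) := {z | ‖imPart z‖ < t}

/-- `F` is a holomorphic extension of (the class of) `φ` to the tube `Ω_t`. -/
def IsHolomorphicExtension {n : ℕ} (φ : LTwo n) (t : ℝ) (F : CSpace n → ℂ) : Prop :=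
  DifferentiableOn ℂ F (tube n t) ∧
    ∀ᵐ x : RSpace n, (φ : RSpace n → ℂ) x = F (toComplex x)

/-- `|F(x + iy)| ≤ C e^{-|x| (t² - |y|²)^{1/2}}` on `Ω_t`, for some constant `C`. -/
def HasTubeBound {n : ℕ} (t : ℝ) (F : CSpace n → ℂ) : Prop :=
  ∃ C : ℝ, ∀ z ∈ tube n t,
    ‖F z‖ ≤ C * Real.exp (-(‖rePart z‖ * √(t ^ 2 - ‖imPart z‖ ^ 2)))

end AnalyticVectors

end

namespace AnalyticVectors

open Metric Set Filter Topology

/-!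
Everything is compared with one condition, `HasAnnihilationBound`. The operators `π(x, u, 0)` extend
to complex parameters on the Hermite functions; in the complex directions `(X, U) = (-iζ, -ζ)` only
creation operators survive, and `φ` has radius `t` when the matrix coefficients of `φ` against
these vectors, for `|ζ| ≤ t`, are the coefficients of a vector of norm at most `M`. Averaging over
torus rotations of `ζ` turns this into a bound on `∑ ‖P_k φ‖²` weighted by Laguerre polynomials at
negative arguments, which is membership in `V_s^ω`.

* For an analytic vector the condition holds because the power series of the orbit map at the
  identity extends to complex parameters.
* If `φ ∈ V_t^ω`, the Laguerre weights grow like `exp (2t √(2k))` up to powers of `k`, while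
  Mehler's formula bounds the Hermite functions on the tube; the Hermite series of `φ` thus
  converges there with the required decay.
* If `φ` satisfies the tube estimate, a shift of contour moves `ζ` from the Hermite functions to
  `φ`, and the estimate bounds the shifted function in `L²`. The same estimate makes
  `(X, U) ↦ π(X, U) φ` a holomorphic `L²`-valued map near the real points.
-/

/-! ### Separately holomorphic maps and dominated families -/

section Osgood

variable {E V : Type*} [NormedAddCommGroup E] [NormedSpace ℂ E]
  [NormedAddCommGroup V] [NormedSpace ℂ V]

theorem differentiableAt_add_smul_of_lineDifferentiableAt {f : V → E} {z v : V} {a : ℂ}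
    (h : LineDifferentiableAt ℂ f (z + a • v) v) :
    DifferentiableAt ℂ (fun l : ℂ => f (z + l • v)) a := by
  have hshift : DifferentiableAt ℂ (fun l : ℂ => l - a) a := by fun_prop
  have hcomp := DifferentiableAt.comp (g := fun l : ℂ => f (z + a • v + l • v)) a
    (by simpa [LineDifferentiableAt] using h) hshift
  refine hcomp.congr_of_eventuallyEq (Eventually.of_forall fun l => ?_)
  simp only [Function.comp]
  congr 1
  module

theorem torusMap_mem_closedBall {N : ℕ} (c : Fin N → ℂ) {r : ℝ} (hr : 0 ≤ r) (θ : Fin N → ℝ) :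
    torusMap c (fun _ => r) θ ∈ closedBall c r := by
  rw [mem_closedBall, dist_pi_le_iff hr]
  intro i
  simp [torusMap, dist_eq_norm, abs_of_nonneg hr]

theorem torusMap_sub_ne_zero {N : ℕ} {c w : Fin N → ℂ} {r : ℝ} (hw : w ∈ ball c r)
    (θ : Fin N → ℝ) (j : Fin N) : torusMap c (fun _ => r) θ j - w j ≠ 0 := by
  have hr : 0 < r := pos_of_mem_ball hw
  intro h
  have hj : dist (w j) (c j) < r := (dist_pi_lt_iff hr).1 (mem_ball.1 hw) j
  rw [← sub_eq_zero.1 h] at hj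
  simp [torusMap, dist_eq_norm, abs_of_pos hr] at hj

theorem continuous_torusMap {N : ℕ} (c : Fin N → ℂ) (R : Fin N → ℝ) :
    Continuous (torusMap c R) := by
  unfold torusMap
  fun_prop

theorem finCons_mem_closedBall {N : ℕ} {c : Fin (N + 1) → ℂ} {r : ℝ} {x : ℂ} {y : Fin N → ℂ}
    (hx : x ∈ closedBall (c 0) r) (hy : y ∈ closedBall (c ∘ Fin.succ) r) :
    (Fin.cons x y : Fin (N + 1) → ℂ) ∈ closedBall c r := by
  have hr : 0 ≤ r := dist_nonneg.trans (mem_closedBall.1 hx)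
  rw [mem_closedBall, dist_pi_le_iff hr]
  refine Fin.cases ?_ fun i => ?_
  · simpa using hx
  · simpa using (dist_pi_le_iff hr).1 (mem_closedBall.1 hy) i

theorem torusIntegrable_prod_sub_inv_smul {N : ℕ} {f : (Fin N → ℂ) → E} {c w : Fin N → ℂ} {r : ℝ}
    (hc : ContinuousOn f (closedBall c r)) (hw : w ∈ ball c r) :
    TorusIntegrable (fun z => (∏ j, (z j - w j)⁻¹) • f z) c (fun _ => r) := by
  have htorus := continuous_torusMap c fun _ => r
  refine (Continuous.continuousOn (Continuous.smul ?_ ?_)).integrableOn_Icc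
  · refine continuous_finsetProd _ fun j _ => ?_
    exact (((continuous_apply j).comp htorus).sub continuous_const).inv₀
      fun θ => torusMap_sub_ne_zero hw θ j
  · exact hc.comp_continuous htorus (torusMap_mem_closedBall c (pos_of_mem_ball hw).le)

section FirstVariable

variable {N : ℕ} {f : (Fin (N + 1) → ℂ) → E}

theorem lineDifferentiableAt_finCons_right {x : ℂ} {y : Fin N → ℂ} {i : Fin N}
    (h : LineDifferentiableAt ℂ f (Fin.cons x y) (Pi.single i.succ 1)) :
    LineDifferentiableAt ℂ (fun y => f (Fin.cons x y)) y (Pi.single i 1) := by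
  refine DifferentiableAt.congr_of_eventuallyEq h (Eventually.of_forall fun l => ?_)
  dsimp only
  congr 1
  ext j
  refine Fin.cases ?_ (fun j => ?_) j <;> simp [Pi.single_apply]

theorem differentiableAt_finCons_left {x : ℂ} {y : Fin N → ℂ}
    (h : LineDifferentiableAt ℂ f (Fin.cons x y) (Pi.single 0 1)) :
    DifferentiableAt ℂ (fun x => f (Fin.cons x y)) x := by
  have hcons (l : ℂ) :
      (Fin.cons 0 y : Fin (N + 1) → ℂ) + l • Pi.single 0 1 = Fin.cons l y := by
    ext j
    refine Fin.cases ?_ (fun j => ?_) j <;> simp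
  rw [← hcons x] at h
  simpa only [hcons] using differentiableAt_add_smul_of_lineDifferentiableAt h

theorem circleIntegral_sub_inv_smul_finCons [CompleteSpace E] {c w : Fin (N + 1) → ℂ} {r : ℝ}
    (hc : ContinuousOn f (closedBall c r))
    (hd : ∀ z ∈ closedBall c r, LineDifferentiableAt ℂ f z (Pi.single 0 1)) (hw : w ∈ ball c r) :
    (∮ x in C(c 0, r), (x - w 0)⁻¹ • f (Fin.cons x (w ∘ Fin.succ))) =
      (2 * Real.pi * Complex.I : ℂ) • f w := by
  have hr : 0 < r := pos_of_mem_ball hw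
  have hwi := (dist_pi_lt_iff hr).1 (mem_ball.1 hw)
  have htail : w ∘ Fin.succ ∈ closedBall (c ∘ Fin.succ) r :=
    mem_closedBall.2 ((dist_pi_le_iff hr.le).2 fun i => (hwi i.succ).le)
  have hcauchy := Complex.circleIntegral_sub_inv_smul_of_differentiable_on_off_countable
    (f := fun x => f (Fin.cons x (w ∘ Fin.succ))) countable_empty (mem_ball.2 (hwi 0))
    (hc.comp (Continuous.continuousOn (Continuous.finCons (A := fun _ : Fin (N + 1) => ℂ)
      continuous_id continuous_const)) fun x hx => finCons_mem_closedBall hx htail)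
    fun x hx => differentiableAt_finCons_left
      (hd _ (finCons_mem_closedBall (ball_subset_closedBall hx.1) htail))
  rw [hcauchy]
  congr 2
  exact Fin.cons_self_tail w

end FirstVariable

theorem torusIntegral_prod_sub_inv_smul [CompleteSpace E] {N : ℕ} (f : (Fin N → ℂ) → E)
    (c w : Fin N → ℂ) {r : ℝ} (hc : ContinuousOn f (closedBall c r))
    (hd : ∀ z ∈ closedBall c r, ∀ i, LineDifferentiableAt ℂ f z (Pi.single i 1))
    (hw : w ∈ ball c r) :
    (∯ z in T(c, fun _ => r), (∏ j, (z j - w j)⁻¹) • f z) =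
      (2 * Real.pi * Complex.I : ℂ) ^ N • f w := by
  induction N with
  | zero =>
    rw [torusIntegral_dim0]
    simp only [Finset.univ_eq_empty, Finset.prod_empty, one_smul, pow_zero]
    congr 1
    exact Subsingleton.elim _ _
  | succ N ih =>
    have hr : 0 < r := pos_of_mem_ball hw
    have htail : w ∘ Fin.succ ∈ ball (c ∘ Fin.succ) r := by
      rw [mem_ball, dist_pi_lt_iff hr]
      exact fun i => (dist_pi_lt_iff hr).1 (mem_ball.1 hw) i.succ
    have inner : ∀ x ∈ sphere (c 0) r,
        (∯ y in T(c ∘ Fin.succ, fun _ => r),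
          (∏ j, ((Fin.cons x y : Fin (N + 1) → ℂ) j - w j)⁻¹) • f (Fin.cons x y)) =
        (2 * Real.pi * Complex.I : ℂ) ^ N • ((x - w 0)⁻¹ • f (Fin.cons x (w ∘ Fin.succ))) := by
      intro x hx
      have hmem {y : Fin N → ℂ} (hy : y ∈ closedBall (c ∘ Fin.succ) r) :=
        finCons_mem_closedBall (sphere_subset_closedBall hx) hy
      rw [smul_comm, ← ih (fun y => f (Fin.cons x y)) (c ∘ Fin.succ) (w ∘ Fin.succ)
        (hc.comp (Continuous.continuousOn (Continuous.finCons (A := fun _ : Fin (N + 1) => ℂ)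
          continuous_const continuous_id)) fun y hy => hmem hy)
        (fun y hy i => lineDifferentiableAt_finCons_right (hd _ (hmem hy) i.succ)) htail,
        ← torusIntegral_smul]
      simp only [Fin.prod_univ_succ, smul_smul, Fin.cons_zero, Fin.cons_succ, Function.comp_apply]
    rw [torusIntegral_succ (torusIntegrable_prod_sub_inv_smul hc hw)]
    refine (circleIntegral.integral_congr hr.le inner).trans ?_
    rw [circleIntegral.integral_smul,
      circleIntegral_sub_inv_smul_finCons hc (fun z hz => hd z hz 0) hw, smul_smul, ← pow_succ]

theorem exists_continuousLinearMap_eq_integral_smul {X : Type*} [TopologicalSpace X]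
    [CompactSpace X] [MeasurableSpace X] [OpensMeasurableSpace X] {μ : Measure X} {G : X → E}
    (hG : Integrable G μ) : ∃ T : C(X, ℂ) →L[ℂ] E, ∀ u : C(X, ℂ), T u = ∫ x, u x • G x ∂μ := by
  have hintg (u : C(X, ℂ)) : Integrable (fun x => u x • G x) μ :=
    hG.bdd_smul ‖u‖ u.continuous.aestronglyMeasurable (Eventually.of_forall u.norm_coe_le_norm)
  refine ⟨LinearMap.mkContinuous
    { toFun := fun u => ∫ x, u x • G x ∂μ
      map_add' := fun u v => by
        simpa only [ContinuousMap.add_apply, add_smul] using integral_add (hintg u) (hintg v)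
      map_smul' := fun a u => by
        simpa only [ContinuousMap.smul_apply, smul_eq_mul, mul_smul, RingHom.id_apply]
          using integral_smul a fun x => u x • G x }
    (∫ x, ‖G x‖ ∂μ) fun u => ?_, fun u => rfl⟩
  rw [mul_comm, ← integral_const_mul]
  refine norm_integral_le_of_norm_le (hG.norm.const_mul _) (Eventually.of_forall fun x => ?_)
  rw [norm_smul]
  exact mul_le_mul_of_nonneg_right (u.norm_coe_le_norm x) (norm_nonneg _)

/-- The product `∏ⱼ (tⱼ - zⱼ)⁻¹`, as a function of `z` with values in the Banach algebra
`C(X, ℂ)`, is the inverse of a polynomial in `z`. -/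
theorem analyticAt_inverse_prod_sub_algebraMap {X : Type*} [TopologicalSpace X] [CompactSpace X]
    {N : ℕ} (t : Fin N → C(X, ℂ)) {c : Fin N → ℂ} (hc : ∀ j x, t j x - c j ≠ 0) :
    AnalyticAt ℂ (fun z : Fin N → ℂ =>
      Ring.inverse (∏ j, (t j - algebraMap ℂ C(X, ℂ) (z j)))) c := by
  have hprod : AnalyticAt ℂ (fun z : Fin N → ℂ => ∏ j, (t j - algebraMap ℂ C(X, ℂ) (z j))) c := by
    refine Finset.analyticAt_fun_prod _ fun j _ => analyticAt_const.sub ?_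
    exact ((Algebra.linearMap ℂ C(X, ℂ)).toContinuousLinearMap ∘L
      ContinuousLinearMap.proj (R := ℂ) (φ := fun _ : Fin N => ℂ) j).analyticAt c
  have hunit : IsUnit (∏ j, (t j - algebraMap ℂ C(X, ℂ) (c j))) := by
    refine (ContinuousMap.isUnit_iff_forall_ne_zero _).2 fun x => ?_
    simpa [ContinuousMap.coe_prod, Finset.prod_ne_zero_iff] using fun j => hc j x
  have hinv : AnalyticAt ℂ Ring.inverse (∏ j, (t j - algebraMap ℂ C(X, ℂ) (c j))) := by
    obtain ⟨u, hu⟩ := hunit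
    exact hu ▸ analyticAt_inverse u
  exact hinv.comp (f := fun z : Fin N → ℂ => ∏ j, (t j - algebraMap ℂ C(X, ℂ) (z j))) hprod

theorem inverse_prod_sub_algebraMap_apply {X : Type*} [TopologicalSpace X] {N : ℕ}
    (t : Fin N → C(X, ℂ)) {z : Fin N → ℂ} (hz : ∀ j x, t j x - z j ≠ 0) (x : X) :
    Ring.inverse (∏ j, (t j - algebraMap ℂ C(X, ℂ) (z j))) x = ∏ j, (t j x - z j)⁻¹ := by
  have hunit : IsUnit (∏ j, (t j - algebraMap ℂ C(X, ℂ) (z j))) := by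
    refine (ContinuousMap.isUnit_iff_forall_ne_zero _).2 fun x => ?_
    simpa [ContinuousMap.coe_prod, Finset.prod_ne_zero_iff] using fun j => hz j x
  have h := DFunLike.congr_fun (Ring.mul_inverse_cancel _ hunit) x
  rw [Finset.prod_inv_distrib]
  refine eq_inv_of_mul_eq_one_right ?_
  simpa [ContinuousMap.coe_prod] using h

theorem analyticAt_of_continuousOn_of_lineDifferentiableAt_single [CompleteSpace E] {N : ℕ}
    (f : (Fin N → ℂ) → E) (c : Fin N → ℂ) {r : ℝ} (hr : 0 < r)
    (hc : ContinuousOn f (closedBall c r))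
    (hd : ∀ z ∈ closedBall c r, ∀ i, LineDifferentiableAt ℂ f z (Pi.single i 1)) :
    AnalyticAt ℂ f c := by
  let S : Set (Fin N → ℝ) := Icc 0 fun _ => 2 * Real.pi
  let t : Fin N → C(S, ℂ) := fun j => ⟨fun θ => torusMap c (fun _ => r) θ j,
    (continuous_apply j).comp ((continuous_torusMap c fun _ => r).comp continuous_subtype_val)⟩
  let G : (Fin N → ℝ) → E := fun θ =>
    (∏ i, (r : ℂ) * Complex.exp (θ i * Complex.I) * Complex.I) • f (torusMap c (fun _ => r) θ)
  have hG : Continuous G := Continuous.smul (by fun_prop)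
    (hc.comp_continuous (continuous_torusMap c _) (torusMap_mem_closedBall c hr.le))
  have hGi : Integrable (fun θ : S => G θ) (volume.comap Subtype.val) :=
    (integrableOn_iff_comap_subtypeVal measurableSet_Icc).1 hG.continuousOn.integrableOn_Icc
  obtain ⟨T, hT⟩ := exists_continuousLinearMap_eq_integral_smul hGi
  have hne {z : Fin N → ℂ} (hz : z ∈ ball c r) (j : Fin N) (θ : S) : t j θ - z j ≠ 0 :=
    torusMap_sub_ne_zero hz θ j
  have hcauchy : (fun z : Fin N → ℂ => ((2 * Real.pi * Complex.I : ℂ) ^ N)⁻¹ •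
      T (Ring.inverse (∏ j, (t j - algebraMap ℂ C(S, ℂ) (z j))))) =ᶠ[𝓝 c] f := by
    filter_upwards [ball_mem_nhds c hr] with z hz
    rw [inv_smul_eq_iff₀ (by simp [Real.pi_ne_zero]), ← torusIntegral_prod_sub_inv_smul f c z hc
      hd hz, hT, torusIntegral, ← integral_subtype_comap measurableSet_Icc]
    simp only [inverse_prod_sub_algebraMap_apply t (hne hz)]
    exact integral_congr_ae (Eventually.of_forall fun θ => smul_comm _ _ _)
  refine AnalyticAt.congr (AnalyticAt.const_smul ?_) hcauchy
  exact (T.analyticAt _).comp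
    (analyticAt_inverse_prod_sub_algebraMap t (hne (mem_ball_self hr)))

theorem norm_sub_le_of_lineDifferentiableAt_of_norm_le {f : V → E} {z w : V} {δ C : ℝ}
    (hd : ∀ w ∈ ball z δ, ∀ v, LineDifferentiableAt ℂ f w v) (hb : ∀ w ∈ ball z δ, ‖f w‖ ≤ C)
    (hw : w ∈ ball z δ) : ‖f w - f z‖ ≤ 2 * C / δ * ‖w - z‖ := by
  rcases eq_or_ne w z with rfl | hwz
  · simp
  have hwz0 : 0 < ‖w - z‖ := norm_pos_iff.2 (sub_ne_zero.2 hwz)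
  have hline : ∀ l ∈ ball (0 : ℂ) (δ / ‖w - z‖), z + l • (w - z) ∈ ball z δ := by
    intro l hl
    rw [mem_ball_zero_iff, lt_div_iff₀ hwz0] at hl
    simpa [dist_eq_norm, norm_smul] using hl
  have hschwarz := Complex.dist_le_div_mul_dist_of_mapsTo_ball
    (f := fun l : ℂ => f (z + l • (w - z))) (c := 0) (R₁ := δ / ‖w - z‖) (R₂ := 2 * C) (z := 1)
    (fun l hl => (differentiableAt_add_smul_of_lineDifferentiableAt
      (hd _ (hline l hl) _)).differentiableWithinAt)
    (fun l hl => by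
      rw [mem_closedBall, dist_eq_norm, zero_smul, add_zero]
      have hz := hb z (mem_ball_self (pos_of_mem_ball hw))
      linarith [norm_sub_le (f (z + l • (w - z))) (f z), hb _ (hline l hl)])
    (by
      rw [mem_ball, dist_eq_norm, sub_zero, norm_one, lt_div_iff₀ hwz0, one_mul]
      exact mem_ball_iff_norm.1 hw)
  simp only [one_smul, zero_smul, add_zero, add_sub_cancel, dist_eq_norm, sub_zero, norm_one,
    mul_one] at hschwarz
  refine hschwarz.trans (le_of_eq ?_)
  field_simp

variable {f : V → E} {U : Set V}

theorem continuousOn_of_lineDifferentiableAt_of_locally_bounded (hU : IsOpen U)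
    (hd : ∀ z ∈ U, ∀ v, LineDifferentiableAt ℂ f z v)
    (hb : ∀ z ∈ U, ∃ C, ∀ᶠ w in 𝓝 z, ‖f w‖ ≤ C) : ContinuousOn f U := by
  intro z hz
  obtain ⟨C, hC⟩ := hb z hz
  obtain ⟨δ, hδ, hball⟩ := Metric.eventually_nhds_iff_ball.1 (hC.and (hU.mem_nhds hz))
  refine (tendsto_iff_norm_sub_tendsto_zero.2 ?_).mono_left nhdsWithin_le_nhds
  have hlim : Tendsto (fun w => 2 * C / δ * ‖w - z‖) (𝓝 z) (𝓝 0) :=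
    Continuous.tendsto' (by fun_prop) _ _ (by simp)
  refine squeeze_zero' (Eventually.of_forall fun w => norm_nonneg _) ?_ hlim
  filter_upwards [ball_mem_nhds z hδ] with w hw
  exact norm_sub_le_of_lineDifferentiableAt_of_norm_le (fun w hw => hd w (hball w hw).2)
    (fun w hw => (hball w hw).1) hw

theorem analyticOnNhd_of_lineDifferentiableAt_of_locally_bounded [CompleteSpace E]
    [FiniteDimensional ℂ V] (hU : IsOpen U) (hd : ∀ z ∈ U, ∀ v, LineDifferentiableAt ℂ f z v)
    (hb : ∀ z ∈ U, ∃ C, ∀ᶠ w in 𝓝 z, ‖f w‖ ≤ C) : AnalyticOnNhd ℂ f U := by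
  have hcont := continuousOn_of_lineDifferentiableAt_of_locally_bounded hU hd hb
  intro z hz
  let e : V ≃L[ℂ] (Fin (Module.finrank ℂ V) → ℂ) := ContinuousLinearEquiv.ofFinrankEq (by simp)
  obtain ⟨r, hr, hrU⟩ := Metric.nhds_basis_closedBall.mem_iff.1
    ((hU.preimage e.symm.continuous).mem_nhds (show e z ∈ e.symm ⁻¹' U by simpa using hz))
  have hcoord := analyticAt_of_continuousOn_of_lineDifferentiableAt_single (f ∘ e.symm) (e z) hr
    (hcont.comp e.symm.continuous.continuousOn hrU) fun w hw i => by
      simpa [LineDifferentiableAt] using hd (e.symm w) (hrU hw) (e.symm (Pi.single i 1))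
  refine (hcoord.comp (e.toContinuousLinearMap.analyticAt z)).congr
    (Eventually.of_forall fun w => ?_)
  simp

end Osgood

section DominatedFamilies

theorem mapsTo_closedBall_of_norm_le {E Y : Type*} [SeminormedAddCommGroup E] {f : Y → E}
    {s : Set Y} {a : Y} {B : ℝ} (ha : a ∈ s) (hb : ∀ y ∈ s, ‖f y‖ ≤ B) :
    MapsTo f s (closedBall (f a) (2 * B)) := by
  intro y hy
  rw [mem_closedBall, dist_eq_norm]
  linarith [norm_sub_le (f y) (f a), hb y hy, hb a ha]

variable {E : Type*} [NormedAddCommGroup E] [NormedSpace ℂ E]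

theorem norm_deriv_le_of_forall_mem_ball_norm_le {g : ℂ → E} {c : ℂ} {r B : ℝ} (hr : 0 < r)
    (hd : DifferentiableOn ℂ g (ball c r)) (hb : ∀ l ∈ ball c r, ‖g l‖ ≤ B) :
    ‖deriv g c‖ ≤ 2 * B / r :=
  Complex.norm_deriv_le_div_of_mapsTo_ball hd
    (mapsTo_closedBall_of_norm_le (mem_ball_self hr) hb) hr

theorem norm_sub_sub_smul_deriv_le [CompleteSpace E] {g : ℂ → E} {c : ℂ} {r B : ℝ}
    (hd : DifferentiableOn ℂ g (ball c r)) (hb : ∀ l ∈ ball c r, ‖g l‖ ≤ B) {l : ℂ}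
    (hl : l ∈ ball c r) :
    ‖g l - g c - (l - c) • deriv g c‖ ≤ 4 * B / r ^ 2 * ‖l - c‖ ^ 2 := by
  have hc : c ∈ ball c r := mem_ball_self (pos_of_mem_ball hl)
  have hslope : ∀ l ∈ ball c r, ‖dslope g c l‖ ≤ 2 * B / r := fun l hl =>
    Complex.norm_dslope_le_div_of_mapsTo_ball hd (mapsTo_closedBall_of_norm_le hc hb) hl
  have hslope₂ : ‖dslope (dslope g c) c l‖ ≤ 2 * (2 * B / r) / r :=
    Complex.norm_dslope_le_div_of_mapsTo_ball
      ((Complex.differentiableOn_dslope (isOpen_ball.mem_nhds hc)).2 hd)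
      (mapsTo_closedBall_of_norm_le hc hslope) hl
  have hTaylor : g l - g c - (l - c) • deriv g c =
      (l - c) ^ 2 • dslope (dslope g c) c l := by
    rw [← sub_smul_dslope g c l, sq, mul_smul, sub_smul_dslope (dslope g c) c l, dslope_same,
      smul_sub]
  calc ‖g l - g c - (l - c) • deriv g c‖ = ‖l - c‖ ^ 2 * ‖dslope (dslope g c) c l‖ := by
        rw [hTaylor, norm_smul, norm_pow]
    _ ≤ ‖l - c‖ ^ 2 * (2 * (2 * B / r) / r) := by gcongr
    _ = 4 * B / r ^ 2 * ‖l - c‖ ^ 2 := by ring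

variable {X : Type*} [MeasurableSpace X] {μ : Measure X}

theorem aestronglyMeasurable_deriv_of_eventually {g : ℂ → X → E} {c : ℂ}
    (hm : ∀ᶠ l in 𝓝 c, AEStronglyMeasurable (g l) μ)
    (hd : ∀ x, DifferentiableAt ℂ (fun l => g l x) c) :
    AEStronglyMeasurable (fun x => deriv (fun l => g l x) c) μ := by
  obtain ⟨u, hu, hum⟩ := exists_seq_forall_of_frequently
    (hm.filter_mono (nhdsWithin_le_nhds (s := {c}ᶜ))).frequently
  exact aestronglyMeasurable_of_tendsto_ae atTop
    (f := fun k x => (u k - c)⁻¹ • (g (u k) x - g c x))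
    (fun k => ((hum k).sub hm.self_of_nhds).const_smul (u k - c)⁻¹)
    (Eventually.of_forall fun x => (hd x).hasDerivAt.tendsto_slope.comp hu)

variable [CompleteSpace E]

theorem differentiableAt_Lp_of_dominated {p : ENNReal} [Fact (1 ≤ p)] {G : ℂ → Lp E p μ}
    {g : ℂ → X → E} {b : X → ℝ} {c : ℂ} {r : ℝ} (hr : 0 < r)
    (hG : ∀ l ∈ ball c r, G l =ᵐ[μ] g l)
    (hd : ∀ x, DifferentiableOn ℂ (fun l => g l x) (ball c r))
    (hb : ∀ l ∈ ball c r, ∀ x, ‖g l x‖ ≤ b x) (hbm : MemLp b p μ) :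
    DifferentiableAt ℂ G c := by
  have hball : ball c r ∈ 𝓝 c := ball_mem_nhds c hr
  set D : X → E := fun x => deriv (fun l => g l x) c
  have hD : MemLp D p μ := by
    refine (hbm.const_mul (2 / r)).of_le (aestronglyMeasurable_deriv_of_eventually ?_ fun x =>
      (hd x).differentiableAt hball) (Eventually.of_forall fun x => ?_)
    · filter_upwards [hball] with l hl using (Lp.aestronglyMeasurable (G l)).congr (hG l hl)
    · refine (norm_deriv_le_of_forall_mem_ball_norm_le hr (hd x) fun l hl => hb l hl x).trans ?_
      exact (le_of_eq (by ring)).trans (le_abs_self _)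
  have hTaylor : ∀ l ∈ ball c r, ‖G l - G c - (l - c) • hD.toLp D‖ ≤
      4 / r ^ 2 * ‖l - c‖ ^ 2 * ‖hbm.toLp b‖ := by
    intro l hl
    refine Lp.norm_le_mul_norm_of_ae_le_mul ?_
    filter_upwards [Lp.coeFn_sub (G l - G c) ((l - c) • hD.toLp D), Lp.coeFn_sub (G l) (G c),
      Lp.coeFn_smul (l - c) (hD.toLp D), hD.coeFn_toLp, hbm.coeFn_toLp,
      hG c (mem_ball_self hr), hG l hl] with x e1 e2 e3 e4 e5 e6 e7
    rw [e1, Pi.sub_apply, e2, Pi.sub_apply, e3, Pi.smul_apply, e4, e5, e6, e7]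
    calc ‖g l x - g c x - (l - c) • D x‖ ≤ 4 * b x / r ^ 2 * ‖l - c‖ ^ 2 :=
          norm_sub_sub_smul_deriv_le (hd x) (fun l hl => hb l hl x) hl
      _ = 4 / r ^ 2 * ‖l - c‖ ^ 2 * b x := by ring
      _ ≤ 4 / r ^ 2 * ‖l - c‖ ^ 2 * ‖b x‖ := by gcongr; exact le_abs_self _
  refine HasDerivAt.differentiableAt (f' := hD.toLp D) (hasDerivAt_iff_isLittleO.2 ?_)
  refine (Asymptotics.IsBigO.of_bound (4 / r ^ 2 * ‖hbm.toLp b‖) ?_).trans_isLittleO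
    (Asymptotics.isLittleO_pow_sub_sub c one_lt_two)
  filter_upwards [hball] with l hl
  rw [norm_pow, norm_norm]
  linarith [hTaylor l hl]

theorem analyticOnNhd_Lp_of_dominated {p : ENNReal} [Fact (1 ≤ p)]
    {V : Type*} [NormedAddCommGroup V] [NormedSpace ℂ V] [FiniteDimensional ℂ V] {U : Set V}
    (hU : IsOpen U) {G : V → Lp E p μ} {g : V → X → E} (hG : ∀ z ∈ U, G z =ᵐ[μ] g z)
    (hd : ∀ x, DifferentiableOn ℂ (fun z => g z x) U)
    (hb : ∀ z ∈ U, ∃ b : X → ℝ, MemLp b p μ ∧ ∀ᶠ w in 𝓝 z, ∀ x, ‖g w x‖ ≤ b x) :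
    AnalyticOnNhd ℂ G U := by
  refine analyticOnNhd_of_lineDifferentiableAt_of_locally_bounded hU (fun z hz v => ?_)
    fun z hz => ?_
  · obtain ⟨b, hbm, hbz⟩ := hb z hz
    have hline : Tendsto (fun l : ℂ => z + l • v) (𝓝 0) (𝓝 z) :=
      Continuous.tendsto' (by fun_prop) _ _ (by simp)
    obtain ⟨r, hr, hball⟩ := Metric.eventually_nhds_iff_ball.1
      (hline.eventually (hbz.and (hU.mem_nhds hz)))
    exact differentiableAt_Lp_of_dominated (g := fun l => g (z + l • v)) hr
      (fun l hl => hG _ (hball l hl).2)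
      (fun x => (hd x).comp (Differentiable.differentiableOn (by fun_prop))
        fun l hl => (hball l hl).2)
      (fun l hl => (hball l hl).1) hbm
  · obtain ⟨b, hbm, hbz⟩ := hb z hz
    refine ⟨‖hbm.toLp b‖, ?_⟩
    filter_upwards [hbz, hU.mem_nhds hz] with w hw hwU
    refine Lp.norm_le_norm_of_ae_le ?_
    filter_upwards [hG w hwU, hbm.coeFn_toLp] with x hGx hbx
    rw [hGx, hbx]
    exact (hw x).trans (le_abs_self _)

theorem analyticOnNhd_integral_of_dominated {V : Type*} [NormedAddCommGroup V] [NormedSpace ℂ V]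
    [FiniteDimensional ℂ V] {U : Set V} (hU : IsOpen U) {g : V → X → E}
    (hm : ∀ z ∈ U, AEStronglyMeasurable (g z) μ)
    (hd : ∀ x, DifferentiableOn ℂ (fun z => g z x) U)
    (hb : ∀ z ∈ U, ∃ b : X → ℝ, Integrable b μ ∧ ∀ᶠ w in 𝓝 z, ∀ x, ‖g w x‖ ≤ b x) :
    AnalyticOnNhd ℂ (fun z => ∫ x, g z x ∂μ) U := by
  classical
  have hintg : ∀ z ∈ U, Integrable (g z) μ := fun z hz => by
    obtain ⟨b, hbi, hbz⟩ := hb z hz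
    exact hbi.mono' (hm z hz) (Eventually.of_forall hbz.self_of_nhds)
  let G : V → Lp E 1 μ := fun z => if h : Integrable (g z) μ then h.toL1 (g z) else 0
  have hG : ∀ z ∈ U, G z =ᵐ[μ] g z := fun z hz => by
    simpa only [G, dif_pos (hintg z hz)] using (hintg z hz).coeFn_toL1
  have hGan : AnalyticOnNhd ℂ G U := analyticOnNhd_Lp_of_dominated hU hG hd fun z hz => by
    simpa only [memLp_one_iff_integrable] using hb z hz
  refine ((L1.integralCLM' (E := E) (μ := μ) ℂ).comp_analyticOnNhd hGan).congr hU fun z hz => ?_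
  calc (L1.integralCLM' ℂ ∘ G) z = ∫ x, G z x ∂μ := by
        rw [← L1.integral_eq_integral, L1.integral_eq' ℂ, Function.comp_apply]
    _ = ∫ x, g z x ∂μ := integral_congr_ae (hG z hz)

end DominatedFamilies

/-! ### Hermite functions of one variable and the Mehler kernel -/

/-- The Hermite polynomial `He_m` over `ℂ`. -/
noncomputable def hermitePoly (m : ℕ) : Polynomial ℂ :=
  (Polynomial.hermite m).map (Int.castRingHom ℂ)

theorem eval_hermitePoly (m : ℕ) (z : ℂ) :
    (hermitePoly m).eval z = Polynomial.aeval z (Polynomial.hermite m) := by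
  rw [hermitePoly, Polynomial.eval_map, Polynomial.aeval_def, algebraMap_int_eq]

theorem hermitePoly_zero : hermitePoly 0 = 1 := by
  simp only [hermitePoly, Polynomial.hermite_zero, map_one, Polynomial.map_one]

theorem hermitePoly_succ (m : ℕ) :
    hermitePoly (m + 1) = Polynomial.X * hermitePoly m - Polynomial.derivative (hermitePoly m) := by
  simp [hermitePoly, Polynomial.hermite_succ, Polynomial.derivative_map]

theorem derivative_hermitePoly_succ (m : ℕ) :
    Polynomial.derivative (hermitePoly (m + 1)) = ((m : ℂ) + 1) • hermitePoly m := by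
  induction m with
  | zero => simp [hermitePoly_succ, hermitePoly_zero]
  | succ m ih =>
    rw [hermitePoly_succ (m + 1), Polynomial.derivative_sub, Polynomial.derivative_mul, ih,
      Polynomial.derivative_X, Polynomial.derivative_smul, hermitePoly_succ m]
    simp only [Polynomial.smul_eq_C_mul, Polynomial.C_add, Polynomial.C_1, Nat.cast_succ]
    ring

theorem hermitePoly_succ_succ (m : ℕ) :
    hermitePoly (m + 2) =
      Polynomial.X * hermitePoly (m + 1) - ((m : ℂ) + 1) • hermitePoly m := by
  rw [hermitePoly_succ (m + 1), derivative_hermitePoly_succ]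

/-- The `m`-th derivative `(-1)^m He_m(y) e^{-y²/2}` of the entire Gaussian `e^{-y²/2}`. -/
noncomputable def gaussDeriv (m : ℕ) (y : ℂ) : ℂ :=
  (-1) ^ m * (hermitePoly m).eval y * Complex.exp (-y ^ 2 / 2)

theorem hasDerivAt_gaussDeriv (m : ℕ) (y : ℂ) :
    HasDerivAt (gaussDeriv m) (gaussDeriv (m + 1) y) y := by
  have hexponent : HasDerivAt (fun y : ℂ => -y ^ 2 / 2) (-y) y :=
    (((hasDerivAt_pow 2 y).neg).div_const 2).congr_deriv (by push_cast; ring)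
  refine ((((hermitePoly m).hasDerivAt y).const_mul ((-1 : ℂ) ^ m)).mul hexponent.cexp).congr_deriv
    ?_
  rw [gaussDeriv, hermitePoly_succ]
  simp only [Polynomial.eval_sub, Polynomial.eval_mul, Polynomial.eval_X]
  ring

theorem iteratedDeriv_gaussDeriv (m b : ℕ) :
    iteratedDeriv b (gaussDeriv m) = gaussDeriv (m + b) := by
  induction b with
  | zero => rw [iteratedDeriv_zero, add_zero]
  | succ b ih =>
    rw [iteratedDeriv_succ, ih]
    ext y
    exact (hasDerivAt_gaussDeriv (m + b) y).deriv

-- The Taylor expansion of `gaussDeriv m` at `y`, evaluated at `y - w`.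
theorem hasSum_hermitePoly (m : ℕ) (y w : ℂ) :
    HasSum (fun b : ℕ => w ^ b / (b.factorial : ℂ) * (hermitePoly (m + b)).eval y)
      ((hermitePoly m).eval (y - w) * Complex.exp (w * y - w ^ 2 / 2)) := by
  have htaylor := Complex.hasSum_taylorSeries_of_entire
    (fun y => (hasDerivAt_gaussDeriv m y).differentiableAt) y (y - w)
  have hsum : (hermitePoly m).eval (y - w) * Complex.exp (w * y - w ^ 2 / 2) =
      (-1) ^ m * Complex.exp (y ^ 2 / 2) * gaussDeriv m (y - w) := by
    have hexp : Complex.exp (w * y - w ^ 2 / 2) =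
        Complex.exp (y ^ 2 / 2) * Complex.exp (-(y - w) ^ 2 / 2) := by
      rw [← Complex.exp_add]
      ring_nf
    have hsign : ((-1 : ℂ) ^ m * (-1) ^ m) = 1 := by rw [← mul_pow, neg_one_mul, neg_neg, one_pow]
    rw [gaussDeriv, hexp]
    linear_combination (-(hermitePoly m).eval (y - w) * Complex.exp (y ^ 2 / 2) *
      Complex.exp (-(y - w) ^ 2 / 2)) * hsign
  have hterm (b : ℕ) : w ^ b / (b.factorial : ℂ) * (hermitePoly (m + b)).eval y =
      (-1) ^ m * Complex.exp (y ^ 2 / 2) *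
        ((b.factorial : ℂ)⁻¹ • (y - w - y) ^ b • iteratedDeriv b (gaussDeriv m) y) := by
    have hexp : Complex.exp (y ^ 2 / 2) * Complex.exp (-y ^ 2 / 2) = 1 := by
      rw [neg_div, ← Complex.exp_add, add_neg_cancel, Complex.exp_zero]
    have hsign : (-1 : ℂ) ^ m * (-1) ^ (m + b) * (y - w - y) ^ b = w ^ b := by
      rw [sub_sub_cancel_left, neg_pow w, ← mul_assoc, ← pow_add, ← pow_add,
        Even.neg_one_pow ⟨m + b, by ring⟩, one_mul]
    rw [iteratedDeriv_gaussDeriv, gaussDeriv, smul_eq_mul, smul_eq_mul]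
    calc w ^ b / (b.factorial : ℂ) * (hermitePoly (m + b)).eval y
        = ((-1 : ℂ) ^ m * (-1) ^ (m + b) * (y - w - y) ^ b) * (b.factorial : ℂ)⁻¹ *
          (hermitePoly (m + b)).eval y *
          (Complex.exp (y ^ 2 / 2) * Complex.exp (-y ^ 2 / 2)) := by rw [hexp, hsign]; ring
      _ = _ := by ring
  rw [hsum]
  exact (htaylor.mul_left _).congr_fun hterm

/-- The entire extension of the Hermite function `hermiteFun k`. -/
noncomputable def hermiteFunC (k : ℕ) (z : ℂ) : ℂ :=
  ((√((k.factorial : ℝ) * √Real.pi))⁻¹ : ℝ) * (hermitePoly k).eval ((√2 : ℝ) * z) *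
    Complex.exp (-z ^ 2 / 2)

theorem hermiteFunC_ofReal (k : ℕ) (x : ℝ) : hermiteFunC k x = hermiteFun k x := by
  have heval : (((Polynomial.aeval (√2 * x) (Polynomial.hermite k) : ℝ)) : ℂ) =
      (hermitePoly k).eval ((√2 : ℝ) * (x : ℂ)) := by
    rw [eval_hermitePoly, ← Complex.ofReal_mul]
    exact (Polynomial.aeval_algebraMap_apply ℂ (√2 * x) (Polynomial.hermite k)).symm
  rw [hermiteFunC, hermiteFun, ← heval]
  push_cast
  rfl

theorem differentiable_hermiteFunC (k : ℕ) : Differentiable ℂ (hermiteFunC k) := by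
  have : Differentiable ℂ fun z : ℂ => (hermitePoly k).eval ((√2 : ℝ) * z) :=
    (hermitePoly k).differentiable.comp (by fun_prop)
  unfold hermiteFunC
  fun_prop

theorem ofReal_sqrt_two_sq : ((√2 : ℝ) : ℂ) ^ 2 = 2 := by
  rw [← Complex.ofReal_pow, Real.sq_sqrt zero_le_two, Complex.ofReal_ofNat]

theorem inv_sqrt_factorial_mul_sqrt_pi (m b : ℕ) :
    (√((m.factorial : ℝ) * √Real.pi))⁻¹ =
      √(((m + b).factorial : ℝ) / m.factorial) * (√(((m + b).factorial : ℝ) * √Real.pi))⁻¹ := by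
  have : (0 : ℝ) < m.factorial := by exact_mod_cast m.factorial_pos
  have : (0 : ℝ) < (m + b).factorial := by exact_mod_cast (m + b).factorial_pos
  rw [← Real.sqrt_inv, ← Real.sqrt_inv, ← Real.sqrt_mul (by positivity)]
  congr 1
  field_simp

theorem hasSum_hermiteFunC (m : ℕ) (x ζ : ℂ) :
    HasSum (fun b : ℕ => ((√2 : ℝ) * ζ) ^ b / (b.factorial : ℂ) *
        (√(((m + b).factorial : ℝ) / m.factorial) : ℝ) * hermiteFunC (m + b) x)
      (Complex.exp (ζ * x - ζ ^ 2 / 2) * hermiteFunC m (x - ζ)) := by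
  have hsum : Complex.exp (ζ * x - ζ ^ 2 / 2) * hermiteFunC m (x - ζ) =
      ((√((m.factorial : ℝ) * √Real.pi))⁻¹ : ℝ) * Complex.exp (-x ^ 2 / 2) *
        ((hermitePoly m).eval ((√2 : ℝ) * x - (√2 : ℝ) * ζ) *
          Complex.exp ((√2 : ℝ) * ζ * ((√2 : ℝ) * x) - ((√2 : ℝ) * ζ) ^ 2 / 2)) := by
    have hexp : Complex.exp (-x ^ 2 / 2) *
        Complex.exp ((√2 : ℝ) * ζ * ((√2 : ℝ) * x) - ((√2 : ℝ) * ζ) ^ 2 / 2) =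
        Complex.exp (ζ * x - ζ ^ 2 / 2) * Complex.exp (-(x - ζ) ^ 2 / 2) := by
      rw [← Complex.exp_add, ← Complex.exp_add]
      congr 1
      linear_combination (ζ * x - ζ ^ 2 / 2) * ofReal_sqrt_two_sq
    rw [hermiteFunC, ← mul_sub]
    linear_combination (-((√((m.factorial : ℝ) * √Real.pi))⁻¹ : ℝ) *
      (hermitePoly m).eval (((√2 : ℝ) : ℂ) * (x - ζ))) * hexp
  rw [hsum]
  refine ((hasSum_hermitePoly m ((√2 : ℝ) * x) ((√2 : ℝ) * ζ)).mul_left _).congr_fun fun b => ?_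
  rw [hermiteFunC, inv_sqrt_factorial_mul_sqrt_pi m b]
  push_cast
  ring

/-- The Gaussian `y ↦ e^{-(y - s)²/(2v)}` on the real line, with complex center `s`. -/
noncomputable def shiftedGaussian (s : ℂ) (v y : ℝ) : ℂ :=
  Complex.exp (-((y : ℂ) - s) ^ 2 / (2 * v))

theorem continuous_shiftedGaussian (s : ℂ) (v : ℝ) : Continuous (shiftedGaussian s v) := by
  unfold shiftedGaussian
  fun_prop

theorem norm_shiftedGaussian (s : ℂ) (v y : ℝ) :
    ‖shiftedGaussian s v y‖ = Real.exp (-(y - s.re) ^ 2 / (2 * v) + s.im ^ 2 / (2 * v)) := by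
  have hden : (2 * v : ℂ) = ((2 * v : ℝ) : ℂ) := by push_cast; rfl
  rw [shiftedGaussian, Complex.norm_exp, hden, Complex.div_ofReal_re]
  congr 1
  simp only [Complex.neg_re, pow_two, Complex.mul_re, Complex.sub_re, Complex.ofReal_re,
    Complex.sub_im, Complex.ofReal_im]
  ring

theorem norm_shiftedGaussian_le (s : ℂ) {v : ℝ} (hv : 0 < v) (y : ℝ) :
    ‖shiftedGaussian s v y‖ ≤
      Real.exp ((s.re ^ 2 + s.im ^ 2) / (2 * v)) * Real.exp (-(1 / (4 * v)) * y ^ 2) := by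
  rw [norm_shiftedGaussian, ← Real.exp_add]
  refine Real.exp_le_exp.2 ?_
  calc -(y - s.re) ^ 2 / (2 * v) + s.im ^ 2 / (2 * v)
      ≤ (s.re ^ 2 - y ^ 2 / 2) / (2 * v) + s.im ^ 2 / (2 * v) := by
        gcongr
        nlinarith [sq_nonneg (y - 2 * s.re)]
    _ = _ := by
        field_simp
        ring

theorem integrable_eval_mul_shiftedGaussian (p : Polynomial ℂ) (s : ℂ) {v : ℝ} (hv : 0 < v) :
    Integrable fun y : ℝ => p.eval (y : ℂ) * shiftedGaussian s v y := by
  induction p using Polynomial.induction_on' with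
  | add p q hp hq =>
    simp only [Polynomial.eval_add, add_mul]
    exact hp.add hq
  | monomial k a =>
    have hintg := (integrable_rpow_mul_exp_neg_mul_sq (b := 1 / (4 * v)) (by positivity)
      (s := (k : ℝ)) (neg_one_lt_zero.trans_le k.cast_nonneg)).norm
    refine (hintg.const_mul (‖a‖ * Real.exp ((s.re ^ 2 + s.im ^ 2) / (2 * v)))).mono'
      (Continuous.aestronglyMeasurable (by have := continuous_shiftedGaussian s v; fun_prop))
      (Eventually.of_forall fun y => ?_)
    rw [norm_mul, Polynomial.eval_monomial, norm_mul, norm_pow, norm_mul, Real.rpow_natCast,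
      norm_pow, Complex.norm_real, Real.norm_of_nonneg (Real.exp_pos _).le]
    calc ‖a‖ * ‖y‖ ^ k * ‖shiftedGaussian s v y‖
        ≤ ‖a‖ * ‖y‖ ^ k * (Real.exp ((s.re ^ 2 + s.im ^ 2) / (2 * v)) *
          Real.exp (-(1 / (4 * v)) * y ^ 2)) := by gcongr; exact norm_shiftedGaussian_le s hv y
      _ = _ := by ring

theorem hasDerivAt_eval_mul_shiftedGaussian (p : Polynomial ℂ) (s : ℂ) {v : ℝ} (hv : v ≠ 0)
    (y : ℝ) :
    HasDerivAt (fun y : ℝ => p.eval (y : ℂ) * shiftedGaussian s v y)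
      ((Polynomial.derivative p - (v : ℂ)⁻¹ • (Polynomial.X * p - s • p)).eval (y : ℂ) *
        shiftedGaussian s v y) y := by
  have hv' : (v : ℂ) ≠ 0 := Complex.ofReal_ne_zero.2 hv
  have hexponent : HasDerivAt (fun y : ℂ => -(y - s) ^ 2 / (2 * v)) (-((y : ℂ) - s) / v) (y : ℂ) :=
    (((((hasDerivAt_id (y : ℂ)).sub_const s).pow 2).neg).div_const (2 * (v : ℂ))).congr_deriv (by
      simp only [id]
      field_simp
      push_cast
      ring)
  refine ((p.hasDerivAt (y : ℂ)).mul hexponent.cexp).comp_ofReal.congr_deriv ?_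
  simp only [shiftedGaussian, Polynomial.eval_mul, Polynomial.eval_sub, Polynomial.eval_smul,
    Polynomial.eval_X, smul_eq_mul]
  field_simp
  ring

theorem integral_shiftedGaussian (s : ℂ) {v : ℝ} (hv : 0 < v) :
    ∫ y : ℝ, shiftedGaussian s v y = (√(2 * Real.pi * v) : ℝ) := by
  have hv' : (v : ℂ) ≠ 0 := Complex.ofReal_ne_zero.2 hv.ne'
  have hquadratic := integral_cexp_quadratic (b := -(1 / (2 * v) : ℝ))
    (by rw [Complex.neg_re, Complex.ofReal_re]; exact neg_lt_zero.2 (by positivity))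
    (s / v) (-s ^ 2 / (2 * v))
  have hexpand (y : ℝ) : shiftedGaussian s v y =
      Complex.exp (-((1 / (2 * v) : ℝ) : ℂ) * (y : ℂ) ^ 2 + s / v * y + -s ^ 2 / (2 * v)) := by
    rw [shiftedGaussian]
    congr 1
    push_cast
    field_simp
    ring
  have hconst : -s ^ 2 / (2 * v) - (s / v) ^ 2 / (4 * -((1 / (2 * v) : ℝ) : ℂ)) = 0 := by
    push_cast
    field_simp
    norm_num
  have hbase : (Real.pi : ℂ) / -(-((1 / (2 * v) : ℝ) : ℂ)) = ((2 * Real.pi * v : ℝ) : ℂ) := by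
    push_cast
    field_simp
  simp_rw [hexpand]
  rw [hquadratic, hconst, hbase, Complex.exp_zero, mul_one, Real.sqrt_eq_rpow,
    Complex.ofReal_cpow (by positivity)]
  norm_num

/-- Integration of polynomials against `shiftedGaussian s v`, as a linear functional. -/
noncomputable def gaussianFunctional (s : ℂ) {v : ℝ} (hv : 0 < v) : Polynomial ℂ →ₗ[ℂ] ℂ where
  toFun p := ∫ y : ℝ, p.eval (y : ℂ) * shiftedGaussian s v y
  map_add' p q := by
    simp only [Polynomial.eval_add, add_mul]
    exact integral_add (integrable_eval_mul_shiftedGaussian p s hv)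
      (integrable_eval_mul_shiftedGaussian q s hv)
  map_smul' a p := by
    simp only [Polynomial.eval_smul, smul_eq_mul, mul_assoc, integral_const_mul, RingHom.id_apply]

section gaussianFunctional

variable (s : ℂ) {v : ℝ} (hv : 0 < v)

theorem gaussianFunctional_apply (p : Polynomial ℂ) :
    gaussianFunctional s hv p = ∫ y : ℝ, p.eval (y : ℂ) * shiftedGaussian s v y :=
  rfl

theorem gaussianFunctional_one : gaussianFunctional s hv 1 = (√(2 * Real.pi * v) : ℝ) := by
  simp only [gaussianFunctional_apply, Polynomial.eval_one, one_mul, integral_shiftedGaussian s hv]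

-- Integration by parts.
theorem gaussianFunctional_X_mul (p : Polynomial ℂ) :
    gaussianFunctional s hv (Polynomial.X * p) =
      s * gaussianFunctional s hv p + v * gaussianFunctional s hv (Polynomial.derivative p) := by
  have hv' : (v : ℂ) ≠ 0 := Complex.ofReal_ne_zero.2 hv.ne'
  have hparts := integral_eq_zero_of_hasDerivAt_of_integrable
    (hasDerivAt_eval_mul_shiftedGaussian p s hv.ne')
    (integrable_eval_mul_shiftedGaussian _ s hv) (integrable_eval_mul_shiftedGaussian p s hv)
  rw [← gaussianFunctional_apply s hv, map_sub, map_smul, map_sub, map_smul, smul_eq_mul,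
    smul_eq_mul] at hparts
  field_simp at hparts
  linear_combination -hparts

end gaussianFunctional

theorem gaussianFunctional_hermitePoly {r : ℝ} (hr : 0 < 1 - r ^ 2) (a : ℂ) (m : ℕ) :
    gaussianFunctional (r * a) hr (hermitePoly m) =
      r ^ m * (hermitePoly m).eval a * (√(2 * Real.pi * (1 - r ^ 2)) : ℝ) := by
  induction m using Nat.twoStepInduction with
  | zero => rw [hermitePoly_zero, gaussianFunctional_one]; simp
  | one =>
    rw [hermitePoly_succ, hermitePoly_zero, map_sub, gaussianFunctional_X_mul,
      gaussianFunctional_one]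
    simp
  | more m ih ih' =>
    rw [hermitePoly_succ_succ, map_sub, gaussianFunctional_X_mul, derivative_hermitePoly_succ,
      map_smul, ih, ih']
    simp only [Polynomial.eval_sub, Polynomial.eval_mul, Polynomial.eval_X, Polynomial.eval_smul,
      smul_eq_mul]
    push_cast
    ring

theorem gaussianFunctional_hermitePoly_succ_mul (m : ℕ) (p : Polynomial ℂ) :
    gaussianFunctional 0 one_pos (hermitePoly (m + 1) * p) =
      gaussianFunctional 0 one_pos (hermitePoly m * Polynomial.derivative p) := by
  rw [hermitePoly_succ, sub_mul, mul_assoc, map_sub, gaussianFunctional_X_mul,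
    Polynomial.derivative_mul, map_add, Complex.ofReal_one]
  ring

theorem gaussianFunctional_hermitePoly_mul_hermitePoly (m k : ℕ) :
    gaussianFunctional 0 one_pos (hermitePoly m * hermitePoly k) =
      if m = k then (m.factorial : ℂ) * (√(2 * Real.pi) : ℝ) else 0 := by
  induction m generalizing k with
  | zero =>
    cases k with
    | zero => simp [hermitePoly_zero, gaussianFunctional_one]
    | succ k =>
      rw [mul_comm, gaussianFunctional_hermitePoly_succ_mul, hermitePoly_zero]
      simp
  | succ m ih =>
    rw [gaussianFunctional_hermitePoly_succ_mul]
    cases k with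
    | zero => simp [hermitePoly_zero]
    | succ k =>
      rw [derivative_hermitePoly_succ, mul_smul_comm, map_smul, ih]
      by_cases hmk : m = k
      · simp [hmk, Nat.factorial_succ, mul_assoc]
      · simp [hmk]

theorem integral_hermiteFun_mul_hermiteFun (m k : ℕ) :
    ∫ x : ℝ, (hermiteFun m x : ℂ) * (hermiteFun k x : ℂ) = if m = k then 1 else 0 := by
  have hscale := Measure.integral_comp_mul_left
    (fun y : ℝ => (hermitePoly m * hermitePoly k).eval (y : ℂ) * shiftedGaussian 0 1 y) (√2)
  rw [← gaussianFunctional_apply 0 one_pos, gaussianFunctional_hermitePoly_mul_hermitePoly]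
    at hscale
  have hprod (x : ℝ) : (hermiteFun m x : ℂ) * (hermiteFun k x : ℂ) =
      (((√((m.factorial : ℝ) * √Real.pi))⁻¹ : ℝ) * ((√((k.factorial : ℝ) * √Real.pi))⁻¹ : ℝ)) *
      ((hermitePoly m * hermitePoly k).eval ((√2 * x : ℝ) : ℂ) * shiftedGaussian 0 1 (√2 * x)) := by
    have hexp : shiftedGaussian 0 1 (√2 * x) =
        Complex.exp (-(x : ℂ) ^ 2 / 2) * Complex.exp (-(x : ℂ) ^ 2 / 2) := by
      rw [shiftedGaussian, ← Complex.exp_add]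
      congr 1
      push_cast
      linear_combination (-(x : ℂ) ^ 2 / 2) * ofReal_sqrt_two_sq
    rw [← hermiteFunC_ofReal, ← hermiteFunC_ofReal, hermiteFunC, hermiteFunC, hexp,
      Polynomial.eval_mul]
    push_cast
    ring
  simp_rw [hprod]
  rw [integral_const_mul, hscale]
  by_cases hmk : m = k
  · have : (0 : ℝ) < m.factorial := by exact_mod_cast m.factorial_pos
    have hnormalize : (√((m.factorial : ℝ) * √Real.pi))⁻¹ * (√((m.factorial : ℝ) * √Real.pi))⁻¹ *
        (|(√2)⁻¹| * ((m.factorial : ℝ) * √(2 * Real.pi))) = 1 := by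
      rw [← mul_inv, Real.mul_self_sqrt (by positivity), abs_of_pos (by positivity),
        Real.sqrt_mul zero_le_two]
      field_simp
    subst hmk
    rw [if_pos rfl, if_pos rfl, Complex.real_smul]
    exact_mod_cast hnormalize
  · simp [hmk]

theorem memLp_hermiteFun (m : ℕ) : MemLp (fun x : ℝ => (hermiteFun m x : ℂ)) 2 volume := by
  have hc : Continuous fun x : ℝ => (hermiteFun m x : ℂ) :=
    Complex.continuous_ofReal.comp (continuous_hermiteFun m)
  rw [memLp_two_iff_integrable_sq_norm hc.aestronglyMeasurable]
  simpa using integrable_hermiteFun_sq m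

theorem inner_toLp_eq_integral {X : Type*} [MeasurableSpace X] {μ : Measure X} {f g : X → ℂ}
    (hf : MemLp f 2 μ) (hg : MemLp g 2 μ) :
    inner ℂ (hf.toLp f) (hg.toLp g) = ∫ x, inner ℂ (f x) (g x) ∂μ := by
  rw [L2.inner_def]
  refine integral_congr_ae ?_
  filter_upwards [hf.coeFn_toLp, hg.coeFn_toLp] with x hx hx'
  rw [hx, hx']

theorem norm_toLp_sq_eq_integral {X : Type*} [MeasurableSpace X] {μ : Measure X} {f : X → ℂ}
    (hf : MemLp f 2 μ) : ‖hf.toLp f‖ ^ 2 = ∫ x, ‖f x‖ ^ 2 ∂μ := by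
  have h := inner_toLp_eq_integral hf hf
  simp only [inner_self_eq_norm_sq_to_K, ← RCLike.ofReal_pow] at h
  exact Complex.ofReal_injective (h.trans integral_ofReal)

theorem inner_hermiteFun_toLp (m : ℕ) {f : ℝ → ℂ} (hf : MemLp f 2) :
    inner ℂ ((memLp_hermiteFun m).toLp _) (hf.toLp f) = ∫ x, (hermiteFun m x : ℂ) * f x := by
  rw [inner_toLp_eq_integral]
  simp only [RCLike.inner_apply, Complex.conj_ofReal, mul_comm]

theorem orthonormal_hermiteFun :
    Orthonormal ℂ fun m : ℕ => (memLp_hermiteFun m).toLp (fun x : ℝ => (hermiteFun m x : ℂ)) := by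
  rw [orthonormal_iff_ite]
  intro m k
  rw [inner_hermiteFun_toLp, integral_hermiteFun_mul_hermiteFun]

theorem sum_norm_integral_hermiteFun_mul_sq_le {f : ℝ → ℂ} (hf : MemLp f 2) (S : Finset ℕ) :
    ∑ m ∈ S, ‖∫ x, (hermiteFun m x : ℂ) * f x‖ ^ 2 ≤ ∫ x, ‖f x‖ ^ 2 := by
  have hbessel := Orthonormal.sum_inner_products_le (hf.toLp f) orthonormal_hermiteFun (s := S)
  simpa only [inner_hermiteFun_toLp, norm_toLp_sq_eq_integral] using hbessel

/-- The function whose `m`-th Hermite coefficient is `r ^ m * hermiteFunC m z`, up to a factor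
independent of `m`; as a function of `x` and `z` it is a multiple of the Mehler kernel. -/
noncomputable def mehlerFun (r : ℝ) (z : ℂ) (x : ℝ) : ℂ :=
  shiftedGaussian (r * ((√2 : ℝ) * z)) (1 - r ^ 2) (√2 * x) * Complex.exp ((x : ℂ) ^ 2 / 2)

theorem norm_mehlerFun_sq {r : ℝ} (hr : 0 < 1 - r ^ 2) (z : ℂ) (x : ℝ) :
    ‖mehlerFun r z x‖ ^ 2 =
      Real.exp (2 * r ^ 2 * z.re ^ 2 / (1 + r ^ 2) + 2 * r ^ 2 * z.im ^ 2 / (1 - r ^ 2)) *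
        Real.exp (-((1 + r ^ 2) / (1 - r ^ 2)) * (x - 2 * r * z.re / (1 + r ^ 2)) ^ 2) := by
  have hexp : ‖Complex.exp ((x : ℂ) ^ 2 / 2)‖ = Real.exp (x ^ 2 / 2) := by
    rw [← Complex.norm_exp_ofReal]
    push_cast
    rfl
  have hre : (r * ((√2 : ℝ) * z)).re = √2 * (r * z.re) := by
    simp only [Complex.re_ofReal_mul]
    ring
  have him : (r * ((√2 : ℝ) * z)).im = √2 * (r * z.im) := by
    simp only [Complex.im_ofReal_mul]
    ring
  have : 0 < 1 + r ^ 2 := by positivity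
  rw [mehlerFun, norm_mul, norm_shiftedGaussian, hexp, ← Real.exp_add, ← Real.exp_nat_mul,
    ← Real.exp_add, hre, him, ← mul_sub, mul_pow, mul_pow, Real.sq_sqrt zero_le_two]
  congr 1
  push_cast
  field_simp
  ring

theorem memLp_mehlerFun {r : ℝ} (hr : 0 < 1 - r ^ 2) (z : ℂ) : MemLp (mehlerFun r z) 2 := by
  have hc : Continuous (mehlerFun r z) := by
    have := continuous_shiftedGaussian (r * ((√2 : ℝ) * z)) (1 - r ^ 2)
    unfold mehlerFun
    fun_prop
  rw [memLp_two_iff_integrable_sq_norm hc.aestronglyMeasurable]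
  simp_rw [norm_mehlerFun_sq hr]
  exact ((integrable_exp_neg_mul_sq (by positivity)).comp_sub_right _).const_mul _

theorem integral_norm_mehlerFun_sq_le {r : ℝ} (hr : 0 < 1 - r ^ 2) (z : ℂ) :
    ∫ x, ‖mehlerFun r z x‖ ^ 2 ≤
      Real.exp (2 * r ^ 2 * z.re ^ 2 / (1 + r ^ 2) + 2 * r ^ 2 * z.im ^ 2 / (1 - r ^ 2)) *
        √Real.pi := by
  simp_rw [norm_mehlerFun_sq hr]
  rw [integral_const_mul, integral_sub_right_eq_self
    (fun x : ℝ => Real.exp (-((1 + r ^ 2) / (1 - r ^ 2)) * x ^ 2)), integral_gaussian]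
  gcongr
  refine div_le_self Real.pi_pos.le ((one_le_div₀ hr).2 ?_)
  linarith [sq_nonneg r]

theorem pow_mul_hermiteFunC_eq_integral {r : ℝ} (hr : 0 < 1 - r ^ 2) (z : ℂ) (m : ℕ) :
    (r : ℂ) ^ m * hermiteFunC m z =
      Complex.exp (-z ^ 2 / 2) * ((√Real.pi * √(1 - r ^ 2))⁻¹ : ℝ) *
        ∫ x : ℝ, (hermiteFun m x : ℂ) * mehlerFun r z x := by
  have hscale := Measure.integral_comp_mul_left (fun y : ℝ => (hermitePoly m).eval (y : ℂ) *
    shiftedGaussian (r * ((√2 : ℝ) * z)) (1 - r ^ 2) y) (√2)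
  rw [← gaussianFunctional_apply _ hr, gaussianFunctional_hermitePoly] at hscale
  have hprod (x : ℝ) : (hermiteFun m x : ℂ) * mehlerFun r z x =
      ((√((m.factorial : ℝ) * √Real.pi))⁻¹ : ℝ) * ((hermitePoly m).eval ((√2 * x : ℝ) : ℂ) *
        shiftedGaussian (r * ((√2 : ℝ) * z)) (1 - r ^ 2) (√2 * x)) := by
    have hexp : Complex.exp (-(x : ℂ) ^ 2 / 2) * Complex.exp ((x : ℂ) ^ 2 / 2) = 1 := by
      rw [neg_div, ← Complex.exp_add, neg_add_cancel, Complex.exp_zero]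
    rw [← hermiteFunC_ofReal, hermiteFunC, mehlerFun]
    push_cast
    linear_combination (((√((m.factorial : ℝ) * √Real.pi) : ℂ)⁻¹) *
      (hermitePoly m).eval ((√2 : ℂ) * x) *
        shiftedGaussian (r * ((√2 : ℝ) * z)) (1 - r ^ 2) (√2 * x)) * hexp
  have hnormalize : (√Real.pi * √(1 - r ^ 2))⁻¹ *
      (|(√2)⁻¹| * √(2 * Real.pi * (1 - r ^ 2))) = 1 := by
    rw [abs_of_pos (by positivity), Real.sqrt_mul (by positivity), Real.sqrt_mul zero_le_two]
    field_simp
  have hnormalize' : (((√Real.pi * √(1 - r ^ 2))⁻¹ : ℝ) : ℂ) * (((|(√2)⁻¹| : ℝ) : ℂ) *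
      ((√(2 * Real.pi * (1 - r ^ 2)) : ℝ) : ℂ)) = 1 := by exact_mod_cast hnormalize
  simp_rw [hprod]
  rw [integral_const_mul, hscale, hermiteFunC, Complex.real_smul]
  linear_combination (-(r : ℂ) ^ m * (hermitePoly m).eval ((√2 : ℝ) * z) *
    Complex.exp (-z ^ 2 / 2) * ((√((m.factorial : ℝ) * √Real.pi))⁻¹ : ℝ)) * hnormalize'

theorem norm_exp_neg_sq_div_two_sq (z : ℂ) :
    ‖Complex.exp (-z ^ 2 / 2)‖ ^ 2 = Real.exp (-z.re ^ 2 + z.im ^ 2) := by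
  rw [← norm_pow, ← Complex.exp_nat_mul, Complex.norm_exp]
  congr 1
  rw [Nat.cast_ofNat, mul_div_cancel₀ _ two_ne_zero]
  simp only [Complex.neg_re, pow_two, Complex.mul_re]
  ring

-- Bessel's inequality for `mehlerFun r z`; the left side is a partial sum of the diagonal of the
-- Mehler kernel.
theorem sum_pow_mul_norm_hermiteFunC_sq_le {r : ℝ} (hr : 0 < 1 - r ^ 2) (z : ℂ) (S : Finset ℕ) :
    ∑ m ∈ S, (r ^ 2) ^ m * ‖hermiteFunC m z‖ ^ 2 ≤
      (1 - r ^ 2)⁻¹ * Real.exp (-((1 - r ^ 2) / (1 + r ^ 2)) * z.re ^ 2 +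
        ((1 + r ^ 2) / (1 - r ^ 2)) * z.im ^ 2) := by
  have hterm (m : ℕ) : (r ^ 2) ^ m * ‖hermiteFunC m z‖ ^ 2 =
      (Real.exp (-z.re ^ 2 + z.im ^ 2) * (Real.pi * (1 - r ^ 2))⁻¹) *
        ‖∫ x : ℝ, (hermiteFun m x : ℂ) * mehlerFun r z x‖ ^ 2 := by
    have hcoeff := congrArg (fun w => ‖w‖ ^ 2) (pow_mul_hermiteFunC_eq_integral hr z m)
    simp only [norm_mul, norm_pow, Complex.norm_real, mul_pow, norm_exp_neg_sq_div_two_sq,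
      Real.norm_eq_abs, sq_abs, inv_pow, Real.sq_sqrt Real.pi_pos.le, Real.sq_sqrt hr.le]
      at hcoeff
    rw [← hcoeff, ← abs_pow, sq_abs, pow_right_comm]
  have hpi : √Real.pi ≤ Real.pi :=
    Real.sqrt_le_iff.2 ⟨Real.pi_pos.le, by nlinarith [Real.pi_gt_three]⟩
  simp_rw [hterm]
  rw [← Finset.mul_sum]
  calc (Real.exp (-z.re ^ 2 + z.im ^ 2) * (Real.pi * (1 - r ^ 2))⁻¹) *
        ∑ m ∈ S, ‖∫ x : ℝ, (hermiteFun m x : ℂ) * mehlerFun r z x‖ ^ 2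
      ≤ (Real.exp (-z.re ^ 2 + z.im ^ 2) * (Real.pi * (1 - r ^ 2))⁻¹) *
          (Real.exp (2 * r ^ 2 * z.re ^ 2 / (1 + r ^ 2) + 2 * r ^ 2 * z.im ^ 2 / (1 - r ^ 2)) *
            Real.pi) := by
        gcongr
        refine (sum_norm_integral_hermiteFun_mul_sq_le (memLp_mehlerFun hr z) S).trans
          ((integral_norm_mehlerFun_sq_le hr z).trans ?_)
        gcongr
    _ = (1 - r ^ 2)⁻¹ * (Real.exp (-z.re ^ 2 + z.im ^ 2) *
          Real.exp (2 * r ^ 2 * z.re ^ 2 / (1 + r ^ 2) + 2 * r ^ 2 * z.im ^ 2 / (1 - r ^ 2))) := by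
        field_simp
    _ = _ := by
        rw [← Real.exp_add]
        congr 2
        have : 0 < 1 + r ^ 2 := by positivity
        field_simp
        ring

/-! ### Hermite functions of several variables -/

section ProductSeries

variable {𝕜 ι : Type*} [NormedField 𝕜]

theorem prod_consEquiv {n : ℕ} (f : Fin (n + 1) → ι → 𝕜) (p : ι × (Fin n → ι)) :
    ∏ j, f j (Fin.consEquiv (fun _ : Fin (n + 1) => ι) p j) =
      f 0 p.1 * ∏ j : Fin n, f j.succ (p.2 j) := by
  simp [Fin.consEquiv, Fin.prod_univ_succ]

theorem summable_norm_prod_pi {n : ℕ} {f : Fin n → ι → 𝕜} (hf : ∀ j, Summable fun b => ‖f j b‖) :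
    Summable fun β : Fin n → ι => ‖∏ j, f j (β j)‖ := by
  induction n with
  | zero => exact Summable.of_finite
  | succ n ih =>
    rw [← (Fin.consEquiv fun _ : Fin (n + 1) => ι).summable_iff]
    refine ((hf 0).mul_of_nonneg (ih fun j => hf j.succ) (fun _ => norm_nonneg _)
      fun _ => norm_nonneg _).congr fun p => ?_
    rw [Function.comp, prod_consEquiv, norm_mul]

theorem hasSum_prod_pi [CompleteSpace 𝕜] {n : ℕ} {f : Fin n → ι → 𝕜} {s : Fin n → 𝕜}
    (hs : ∀ j, HasSum (f j) (s j)) (hf : ∀ j, Summable fun b => ‖f j b‖) :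
    HasSum (fun β : Fin n → ι => ∏ j, f j (β j)) (∏ j, s j) := by
  induction n with
  | zero => simp
  | succ n ih =>
    rw [← (Fin.consEquiv fun _ : Fin (n + 1) => ι).hasSum_iff, Fin.prod_univ_succ]
    have hsummable : Summable fun p : ι × (Fin n → ι) => f 0 p.1 * ∏ j : Fin n, f j.succ (p.2 j) :=
      summable_mul_of_summable_norm (g := fun β : Fin n → ι => ∏ j : Fin n, f j.succ (β j)) (hf 0)
        (summable_norm_prod_pi fun j => hf j.succ)
    have hmul := HasSum.mul (g := fun β : Fin n → ι => ∏ j : Fin n, f j.succ (β j)) (hs 0)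
      (ih (fun j => hs j.succ) fun j => hf j.succ) hsummable
    exact hmul.congr_fun fun p => prod_consEquiv f p

end ProductSeries

theorem summable_pow_div_sqrt_factorial (c : ℝ) :
    Summable fun b : ℕ => c ^ b / √(b.factorial : ℝ) := by
  have hmajorant := (Real.summable_pow_div_factorial (2 * c ^ 2)).add
    (summable_geometric_of_lt_one (r := (2⁻¹ : ℝ)) (by norm_num) (by norm_num))
  refine hmajorant.of_norm_bounded fun b => ?_
  have hsq : (2 * c ^ 2) ^ b / (b.factorial : ℝ) = ‖c ^ b / √(b.factorial : ℝ)‖ ^ 2 * 2 ^ b := by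
    rw [Real.norm_eq_abs, sq_abs, div_pow, Real.sq_sqrt (Nat.cast_nonneg _), mul_pow]
    ring
  have : (0 : ℝ) < 2 ^ b := by positivity
  rw [hsq, inv_pow]
  generalize ‖c ^ b / √(b.factorial : ℝ)‖ = A
  rw [← sub_nonneg, show A ^ 2 * 2 ^ b + (2 ^ b)⁻¹ - A =
    (2 ^ b)⁻¹ * ((A * 2 ^ b - 1 / 2) ^ 2 + 3 / 4) by field_simp; ring]
  positivity

theorem factorial_add_div_factorial_le (m b : ℕ) :
    ((m + b).factorial : ℝ) / m.factorial ≤ 2 ^ (m + b) * b.factorial := by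
  have hchoose : ((m + b).choose b : ℝ) ≤ 2 ^ (m + b) := by
    exact_mod_cast Nat.choose_le_two_pow (m + b) b
  rw [div_le_iff₀ (by exact_mod_cast m.factorial_pos),
    ← Nat.add_choose_mul_factorial_mul_factorial m b]
  push_cast
  calc ((m + b).choose b : ℝ) * m.factorial * b.factorial
      ≤ 2 ^ (m + b) * m.factorial * b.factorial := by gcongr
    _ = 2 ^ (m + b) * b.factorial * m.factorial := by ring

theorem summable_pow_div_factorial_mul_sqrt (m : ℕ) {c : ℝ} (hc : 0 ≤ c) :
    Summable fun b : ℕ => c ^ b / (b.factorial : ℝ) * √(((m + b).factorial : ℝ) / m.factorial) := by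
  refine Summable.of_nonneg_of_le (fun b => by positivity) (fun b => ?_)
    ((summable_pow_div_sqrt_factorial (√2 * c)).mul_left (√2 ^ m))
  have : (0 : ℝ) < b.factorial := by exact_mod_cast b.factorial_pos
  have hsqrt : √(((m + b).factorial : ℝ) / m.factorial) ≤ √2 ^ (m + b) * √(b.factorial : ℝ) := by
    rw [Real.sqrt_le_left (by positivity), mul_pow, pow_right_comm, Real.sq_sqrt zero_le_two,
      Real.sq_sqrt (Nat.cast_nonneg _)]
    exact factorial_add_div_factorial_le m b
  calc c ^ b / (b.factorial : ℝ) * √(((m + b).factorial : ℝ) / m.factorial)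
      ≤ c ^ b / (b.factorial : ℝ) * (√2 ^ (m + b) * √(b.factorial : ℝ)) := by gcongr
    _ = √2 ^ m * ((√2 * c) ^ b * (√(b.factorial : ℝ) / b.factorial)) := by
      rw [pow_add, mul_pow]
      ring
    _ = √2 ^ m * ((√2 * c) ^ b / √(b.factorial : ℝ)) := by
      rw [Real.sqrt_div_self', mul_one_div]

section FourierUniqueness

variable {E : Type*} [NormedAddCommGroup E] [InnerProductSpace ℝ E] [MeasurableSpace E]
  {μ : Measure E}

theorem integrable_exp_inner_mul [OpensMeasurableSpace E] {f : E → ℂ} (hf : Integrable f μ)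
    (η : E) : Integrable (fun x => Complex.exp (inner ℝ x η * Complex.I) * f x) μ :=
  hf.bdd_mul (c := 1) (Continuous.aestronglyMeasurable (by fun_prop))
    (Eventually.of_forall fun x => by rw [Complex.norm_exp_ofReal_mul_I])

theorem charFun_withDensity_ofReal {g : E → ℝ} (hg : Integrable g μ) (η : E) :
    charFun (μ.withDensity fun x => ENNReal.ofReal (g x)) η =
      ∫ x, Complex.exp (inner ℝ x η * Complex.I) * ((max (g x) 0 : ℝ) : ℂ) ∂μ := by
  rw [charFun, integral_withDensity_eq_integral_toReal_smul₀ hg.1.aemeasurable.ennreal_ofReal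
    (Eventually.of_forall fun x => ENNReal.ofReal_lt_top)]
  simp only [ENNReal.toReal_ofReal', Complex.real_smul, mul_comm]

-- The positive and negative parts of `g` are densities of measures with equal characteristic
-- functions.
theorem ae_eq_zero_of_integral_exp_inner_mul_ofReal_eq_zero [BorelSpace E]
    [SecondCountableTopology E] [CompleteSpace E] {g : E → ℝ} (hg : Integrable g μ)
    (h : ∀ η : E, ∫ x, Complex.exp (inner ℝ x η * Complex.I) * (g x : ℂ) ∂μ = 0) : g =ᵐ[μ] 0 := by
  have hneg : Integrable (fun x => -g x) μ := hg.neg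
  have := isFiniteMeasure_withDensity_ofReal hg.2
  have := isFiniteMeasure_withDensity_ofReal hneg.2
  have heq : (μ.withDensity fun x => ENNReal.ofReal (g x)) =
      μ.withDensity fun x => ENNReal.ofReal (-g x) := by
    refine Measure.ext_of_charFun (funext fun η => ?_)
    have hintg {g' : E → ℝ} (hg' : Integrable g' μ) : Integrable (fun x =>
        Complex.exp (inner ℝ x η * Complex.I) * ((max (g' x) 0 : ℝ) : ℂ)) μ :=
      integrable_exp_inner_mul hg'.pos_part.ofReal η
    rw [charFun_withDensity_ofReal hg, charFun_withDensity_ofReal hneg, ← sub_eq_zero,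
      ← integral_sub (hintg hg) (hintg hneg), ← h η]
    simp only [← mul_sub, ← Complex.ofReal_sub, max_zero_sub_max_neg_zero_eq_self]
  rw [withDensity_eq_iff hg.1.aemeasurable.ennreal_ofReal hneg.1.aemeasurable.ennreal_ofReal
    hg.lintegral_lt_top.ne] at heq
  filter_upwards [heq] with x hx
  have hmax := congrArg ENNReal.toReal hx
  rw [ENNReal.toReal_ofReal', ENNReal.toReal_ofReal', ← sub_eq_zero] at hmax
  exact (max_zero_sub_max_neg_zero_eq_self (g x)).symm.trans hmax

theorem ae_eq_zero_of_integral_exp_inner_eq_zero [BorelSpace E] [SecondCountableTopology E]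
    [CompleteSpace E] {f : E → ℂ} (hf : Integrable f μ)
    (h : ∀ η : E, ∫ x, Complex.exp (inner ℝ x η * Complex.I) * f x ∂μ = 0) : f =ᵐ[μ] 0 := by
  have hconj (η : E) : ∫ x, Complex.exp (inner ℝ x η * Complex.I) *
      (starRingEnd ℂ) (f x) ∂μ = 0 := by
    rw [← map_zero (starRingEnd ℂ), ← h (-η), ← integral_conj]
    simp [← Complex.exp_conj, inner_neg_right]
  have hf' : Integrable (fun x => (starRingEnd ℂ) (f x)) μ :=
    (LinearIsometryEquiv.integrable_comp_iff Complex.conjLIE).2 hf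
  have hre := ae_eq_zero_of_integral_exp_inner_mul_ofReal_eq_zero hf.re fun η => by
    have hsplit (x : E) : Complex.exp (inner ℝ x η * Complex.I) * ((f x).re : ℂ) =
        (1 / 2 : ℂ) * (Complex.exp (inner ℝ x η * Complex.I) * f x +
          Complex.exp (inner ℝ x η * Complex.I) * (starRingEnd ℂ) (f x)) := by
      rw [Complex.re_eq_add_conj]
      ring
    simp only [RCLike.re_to_complex, hsplit]
    rw [integral_const_mul, integral_add (integrable_exp_inner_mul hf η)
      (integrable_exp_inner_mul hf' η), h, hconj, add_zero, mul_zero]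
  have him := ae_eq_zero_of_integral_exp_inner_mul_ofReal_eq_zero hf.im fun η => by
    have hsplit (x : E) : Complex.exp (inner ℝ x η * Complex.I) * ((f x).im : ℂ) =
        (1 / (2 * Complex.I) : ℂ) * (Complex.exp (inner ℝ x η * Complex.I) * f x -
          Complex.exp (inner ℝ x η * Complex.I) * (starRingEnd ℂ) (f x)) := by
      rw [Complex.im_eq_sub_conj]
      ring
    simp only [RCLike.im_to_complex, hsplit]
    rw [integral_const_mul, integral_sub (integrable_exp_inner_mul hf η)
      (integrable_exp_inner_mul hf' η), h, hconj, sub_zero, mul_zero]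
  filter_upwards [hre, him] with x hx hx'
  exact Complex.ext hx hx'

end FourierUniqueness

section HermiteSeveralVariables

variable {n : ℕ}

/-- The entire extension of the Hermite function `Φ_α`. -/
noncomputable def hermiteMultiC (α : Fin n → ℕ) (z : CSpace n) : ℂ :=
  ∏ j, hermiteFunC (α j) (z j)

theorem hermiteMultiC_toComplex (α : Fin n → ℕ) (x : RSpace n) :
    hermiteMultiC α (toComplex x) = hermiteMulti α x := by
  simp [hermiteMultiC, hermiteMulti, toComplex, hermiteFunC_ofReal]

theorem differentiable_hermiteMultiC (α : Fin n → ℕ) : Differentiable ℂ (hermiteMultiC α) := by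
  have hcoord (j : Fin n) : Differentiable ℂ fun z : CSpace n => hermiteFunC (α j) (z j) :=
    (differentiable_hermiteFunC (α j)).comp (by fun_prop)
  unfold hermiteMultiC
  fun_prop

theorem hermiteMultiC_zero (z : CSpace n) :
    hermiteMultiC 0 z = (((√(√Real.pi))⁻¹ : ℝ) : ℂ) ^ n * Complex.exp (-(∑ j, z j ^ 2) / 2) := by
  simp only [hermiteMultiC, hermiteFunC, Pi.zero_apply, hermitePoly_zero, Polynomial.eval_one,
    Nat.factorial_zero, Nat.cast_one, one_mul, mul_one]
  rw [Finset.prod_mul_distrib, Finset.prod_const, Finset.card_univ, Fintype.card_fin,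
    ← Complex.exp_sum, ← Finset.sum_neg_distrib, Finset.sum_div]

theorem hermiteMulti_zero_ne_zero (x : RSpace n) : hermiteMulti (0 : Fin n → ℕ) x ≠ 0 := by
  have hpi : √(√Real.pi) ≠ 0 := (Real.sqrt_pos.2 (Real.sqrt_pos.2 Real.pi_pos)).ne'
  rw [← hermiteMultiC_toComplex, hermiteMultiC_zero]
  exact mul_ne_zero (pow_ne_zero _ (by exact_mod_cast inv_ne_zero hpi)) (Complex.exp_ne_zero _)

theorem conj_hermiteMulti (α : Fin n → ℕ) (x : RSpace n) :
    (starRingEnd ℂ) (hermiteMulti α x) = hermiteMulti α x := by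
  simp [hermiteMulti, map_prod]

theorem integral_hermiteMulti_mul_hermiteMulti (α β : Fin n → ℕ) :
    ∫ x : RSpace n, hermiteMulti α x * hermiteMulti β x = if α = β then 1 else 0 := by
  have hprod := (EuclideanSpace.volume_preserving_symm_measurableEquiv_toLp (Fin n)).integral_comp'
    (fun x : Fin n → ℝ => ∏ j, ((hermiteFun (α j) (x j) : ℂ) * (hermiteFun (β j) (x j) : ℂ)))
  rw [volume_pi, integral_fintype_prod_eq_prod
    (fun j x => (hermiteFun (α j) x : ℂ) * (hermiteFun (β j) x : ℂ))] at hprod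
  simp only [integral_hermiteFun_mul_hermiteFun] at hprod
  simp only [hermiteMulti, ← Finset.prod_mul_distrib]
  refine hprod.trans ?_
  split_ifs with hαβ
  · simp [hαβ]
  · obtain ⟨j, hj⟩ := Function.ne_iff.1 hαβ
    exact Finset.prod_eq_zero (Finset.mem_univ j) (if_neg hj)

theorem inner_hermiteVec_toLp (α : Fin n → ℕ) {f : RSpace n → ℂ} (hf : MemLp f 2) :
    inner ℂ (hermiteVec α) (hf.toLp f) = ∫ x, f x * hermiteMulti α x := by
  rw [hermiteVec, inner_toLp_eq_integral]
  simp only [RCLike.inner_apply, conj_hermiteMulti]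

theorem inner_hermiteVec (α : Fin n → ℕ) (φ : LTwo n) :
    inner ℂ (hermiteVec α) φ = ∫ x, (φ : RSpace n → ℂ) x * hermiteMulti α x := by
  rw [← inner_hermiteVec_toLp α (Lp.memLp φ), Lp.toLp_coeFn]

theorem orthonormal_hermiteVec : Orthonormal ℂ (hermiteVec (n := n)) := by
  rw [orthonormal_iff_ite]
  intro α β
  rw [← integral_hermiteMulti_mul_hermiteMulti, hermiteVec.eq_def β, inner_hermiteVec_toLp]
  simp only [mul_comm]

theorem integral_norm_hermiteMulti_sq (α : Fin n → ℕ) :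
    ∫ x : RSpace n, ‖hermiteMulti α x‖ ^ 2 = 1 := by
  rw [← norm_toLp_sq_eq_integral (memLp_hermiteMulti α)]
  change ‖hermiteVec α‖ ^ 2 = 1
  rw [orthonormal_hermiteVec.1 α, one_pow]

/-- The function `x ↦ exp (ζ·x - ζ²/2) Φ_α(x - ζ)`, that is, the exponential of the creation
operator `√2 ζ·A*` applied to `Φ_α`. -/
noncomputable def creationFun (ζ : CSpace n) (α : Fin n → ℕ) (x : RSpace n) : ℂ :=
  Complex.exp ((∑ j, ζ j * x j) - (∑ j, ζ j ^ 2) / 2) * hermiteMultiC α (toComplex x - ζ)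

/-- The coefficient of `Φ_{α+β}` in the Hermite expansion of `creationFun ζ α`. -/
noncomputable def creationCoeff (ζ : CSpace n) (α β : Fin n → ℕ) : ℂ :=
  ∏ j, (((√2 : ℝ) * ζ j) ^ (β j) / ((β j).factorial : ℂ) *
    (√(((α j + β j).factorial : ℝ) / (α j).factorial) : ℝ))

theorem hasSum_creationFun (ζ : CSpace n) (α : Fin n → ℕ) (x : RSpace n) :
    HasSum (fun β => creationCoeff ζ α β * hermiteMulti (α + β) x) (creationFun ζ α x) := by
  have hcoord (j : Fin n) := hasSum_hermiteFunC (α j) (x j : ℂ) (ζ j)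
  have hval : creationFun ζ α x = ∏ j, (Complex.exp (ζ j * x j - ζ j ^ 2 / 2) *
      hermiteFunC (α j) (x j - ζ j)) := by
    rw [creationFun, hermiteMultiC, Finset.prod_mul_distrib, ← Complex.exp_sum,
      Finset.sum_sub_distrib, Finset.sum_div]
    rfl
  rw [hval]
  refine (hasSum_prod_pi hcoord fun j => (hcoord j).summable.norm).congr_fun fun β => ?_
  simp only [creationCoeff, hermiteMulti, ← Finset.prod_mul_distrib, hermiteFunC_ofReal,
    Pi.add_apply]

theorem summable_norm_creationCoeff (ζ : CSpace n) (α : Fin n → ℕ) :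
    Summable fun β => ‖creationCoeff ζ α β‖ := by
  refine summable_norm_prod_pi (f := fun j b => ((√2 : ℝ) * ζ j) ^ b / (b.factorial : ℂ) *
    (√(((α j + b).factorial : ℝ) / (α j).factorial) : ℝ)) fun j => ?_
  simpa only [norm_mul, norm_div, norm_pow, Complex.norm_natCast, Complex.norm_real,
    Real.norm_of_nonneg (Real.sqrt_nonneg _)] using
    summable_pow_div_factorial_mul_sqrt (α j) (norm_nonneg ((√2 : ℝ) * ζ j))

theorem integral_norm_mul_le {X : Type*} [MeasurableSpace X] {μ : Measure X} {f g : X → ℂ}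
    (hf : MemLp f 2 μ) (hg : MemLp g 2 μ) :
    ∫ x, ‖f x * g x‖ ∂μ ≤ (∫ x, ‖f x‖ ^ 2 ∂μ) + ∫ x, ‖g x‖ ^ 2 ∂μ := by
  have hf2 := (memLp_two_iff_integrable_sq_norm hf.1).1 hf
  have hg2 := (memLp_two_iff_integrable_sq_norm hg.1).1 hg
  rw [← integral_add hf2 hg2]
  refine integral_mono (hf.integrable_mul hg).norm (hf2.add hg2) fun x => ?_
  simp only [norm_mul]
  nlinarith [sq_nonneg (‖f x‖ - ‖g x‖), mul_nonneg (norm_nonneg (f x)) (norm_nonneg (g x))]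

theorem hasSum_integral_mul_creationFun (φ : LTwo n) (ζ : CSpace n) (α : Fin n → ℕ) :
    HasSum (fun β => creationCoeff ζ α β * inner ℂ (hermiteVec (α + β)) φ)
      (∫ x, (φ : RSpace n → ℂ) x * creationFun ζ α x) := by
  have hbound (β : Fin n → ℕ) : ∫ x, ‖(φ : RSpace n → ℂ) x * hermiteMulti β x‖ ≤
      (∫ x, ‖(φ : RSpace n → ℂ) x‖ ^ 2) + 1 := by
    rw [← integral_norm_hermiteMulti_sq β]
    exact integral_norm_mul_le (Lp.memLp φ) (memLp_hermiteMulti β)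
  have hsum := hasSum_integral_of_summable_integral_norm (μ := (volume : Measure (RSpace n)))
    (F := fun β x => creationCoeff ζ α β * ((φ : RSpace n → ℂ) x * hermiteMulti (α + β) x))
    (fun β => ((Lp.memLp φ).integrable_mul (memLp_hermiteMulti _)).const_mul _) <| by
      refine ((summable_norm_creationCoeff ζ α).mul_right
        ((∫ x, ‖(φ : RSpace n → ℂ) x‖ ^ 2) + 1)).of_nonneg_of_le (fun β => by positivity)
        fun β => ?_
      simp only [norm_mul (creationCoeff ζ α β)]
      rw [integral_const_mul]
      exact mul_le_mul_of_nonneg_left (hbound _) (norm_nonneg _)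
  have hval (x : RSpace n) : (φ : RSpace n → ℂ) x * creationFun ζ α x =
      ∑' β, creationCoeff ζ α β * ((φ : RSpace n → ℂ) x * hermiteMulti (α + β) x) := by
    rw [← ((hasSum_creationFun ζ α x).mul_left ((φ : RSpace n → ℂ) x)).tsum_eq]
    exact tsum_congr fun β => mul_left_comm _ _ _
  simp only [hval]
  refine hsum.congr_fun fun β => ?_
  rw [integral_const_mul, inner_hermiteVec]

theorem creationFun_I_div_two_smul_toComplex (η x : RSpace n) :
    creationFun ((Complex.I / 2) • toComplex η) 0 x =
      Complex.exp (-∑ j, ((Complex.I / 2) • toComplex η) j ^ 2) *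
        (Complex.exp (inner ℝ x η * Complex.I) * hermiteMulti 0 x) := by
  set ζ := (Complex.I / 2) • toComplex η with hζ
  have hinner : (inner ℝ x η : ℂ) * Complex.I = 2 * ∑ j, ζ j * x j := by
    rw [PiLp.inner_apply, Complex.ofReal_sum, Finset.sum_mul, Finset.mul_sum]
    refine Finset.sum_congr rfl fun j _ => ?_
    simp [hζ, toComplex]
    ring
  have hsq : ∑ j, (toComplex x - ζ) j ^ 2 =
      (∑ j, (toComplex x) j ^ 2) - 2 * (∑ j, ζ j * x j) + ∑ j, ζ j ^ 2 := by
    rw [Finset.mul_sum, ← Finset.sum_sub_distrib, ← Finset.sum_add_distrib]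
    refine Finset.sum_congr rfl fun j _ => ?_
    simp [toComplex]
    ring
  have hexp : Complex.exp ((∑ j, ζ j * x j) - (∑ j, ζ j ^ 2) / 2) *
      Complex.exp (-(∑ j, (toComplex x - ζ) j ^ 2) / 2) =
      Complex.exp (-∑ j, ζ j ^ 2) * (Complex.exp (inner ℝ x η * Complex.I) *
        Complex.exp (-(∑ j, (toComplex x) j ^ 2) / 2)) := by
    rw [← Complex.exp_add, ← Complex.exp_add, ← Complex.exp_add, hinner, hsq]
    ring_nf
  rw [creationFun, ← hermiteMultiC_toComplex, hermiteMultiC_zero, hermiteMultiC_zero]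
  linear_combination (((√(√Real.pi))⁻¹ : ℝ) : ℂ) ^ n * hexp

-- The functions `creationFun ((i/2) η) 0` give the Fourier transform of `φ Φ_0`.
theorem eq_zero_of_inner_hermiteVec_eq_zero {φ : LTwo n}
    (h : ∀ α, inner ℂ (hermiteVec α) φ = 0) : φ = 0 := by
  have hfourier (η : RSpace n) : ∫ x, Complex.exp (inner ℝ x η * Complex.I) *
      ((φ : RSpace n → ℂ) x * hermiteMulti 0 x) = 0 := by
    have hzero := hasSum_integral_mul_creationFun φ ((Complex.I / 2) • toComplex η) 0
    simp only [h, mul_zero, creationFun_I_div_two_smul_toComplex, mul_left_comm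
      ((φ : RSpace n → ℂ) _)] at hzero
    rw [integral_const_mul] at hzero
    exact (mul_eq_zero.1 (hasSum_zero.unique hzero).symm).resolve_left (Complex.exp_ne_zero _)
  rw [Lp.eq_zero_iff_ae_eq_zero]
  filter_upwards [ae_eq_zero_of_integral_exp_inner_eq_zero
    ((Lp.memLp φ).integrable_mul (memLp_hermiteMulti 0)) hfourier] with x hx
  exact (mul_eq_zero.1 hx).resolve_right (hermiteMulti_zero_ne_zero x)

theorem hasSum_hermiteVec (φ : LTwo n) :
    HasSum (fun α => inner ℂ (hermiteVec α) φ • hermiteVec α) φ := by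
  have hcomplete : (Submodule.span ℂ (Set.range (hermiteVec (n := n))))ᗮ = ⊥ := by
    rw [Submodule.eq_bot_iff]
    exact fun ψ hψ => eq_zero_of_inner_hermiteVec_eq_zero fun α =>
      (Submodule.mem_orthogonal _ _).1 hψ _ (Submodule.subset_span ⟨α, rfl⟩)
  simpa [HilbertBasis.repr_apply_apply] using
    (HilbertBasis.mkOfOrthogonalEqBot orthonormal_hermiteVec hcomplete).hasSum_repr φ

theorem hermiteProj_eq_sum (k : ℕ) (φ : LTwo n) :
    hermiteProj k φ = ∑ α ∈ Finset.piAntidiag (Finset.univ : Finset (Fin n)) k,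
      inner ℂ (hermiteVec α) φ • hermiteVec α := by
  refine Submodule.eq_starProjection_of_mem_orthogonal ?_ ?_
  · exact Submodule.sum_mem _ fun α hα =>
      Submodule.smul_mem _ _ (Submodule.subset_span ⟨α, hα, rfl⟩)
  · refine (Submodule.isOrtho_span.2 ?_ : Submodule.span ℂ {_} ⟂ hermiteSpace n k)
      (Submodule.mem_span_singleton_self _)
    rintro _ rfl _ ⟨α, hα, rfl⟩
    rw [inner_sub_left, orthonormal_hermiteVec.inner_left_sum _ hα, inner_conj_symm, sub_self]

theorem norm_hermiteProj_sq (k : ℕ) (φ : LTwo n) :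
    ‖hermiteProj k φ‖ ^ 2 = ∑ α ∈ Finset.piAntidiag (Finset.univ : Finset (Fin n)) k,
      ‖inner ℂ (hermiteVec α) φ‖ ^ 2 := by
  have hinner := orthonormal_hermiteVec.inner_sum (fun α => inner ℂ (hermiteVec α) φ)
    (fun α => inner ℂ (hermiteVec α) φ) (Finset.piAntidiag (Finset.univ : Finset (Fin n)) k)
  rw [inner_self_eq_norm_sq_to_K] at hinner
  simp only [RCLike.conj_mul] at hinner
  rw [hermiteProj_eq_sum]
  exact_mod_cast hinner

end HermiteSeveralVariables

/-! ### Laguerre weights and the annihilation bound -/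

section CauchyEstimate

open UnitAddTorus

theorem integral_mFourier_neg_mul_mFourier {d : Type*} [Fintype d] (k m : d → ℤ) :
    ∫ x : UnitAddTorus d, mFourier (-k) x * mFourier m x
      ∂(Measure.pi fun _ => AddCircle.haarAddCircle) = if k = m then 1 else 0 := by
  classical
  have h := orthonormal_iff_ite.1 (orthonormal_mFourier (d := d)) k m
  rw [ContinuousMap.inner_toLp] at h
  simp only [mFourier_neg, mul_comm _ (mFourier m _)]
  exact h

theorem norm_mFourier_apply {d : Type*} [Fintype d] (k : d → ℤ) (x : UnitAddTorus d) :
    ‖mFourier k x‖ = 1 := by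
  simp only [mFourier, fourier_apply, ContinuousMap.coe_mk, norm_prod, Circle.norm_coe,
    Finset.prod_const_one]

theorem norm_coeff_le_of_norm_tsum_mFourier_le {κ d : Type*} [Countable κ] [Fintype d]
    {e : κ → d → ℤ} (he : Function.Injective e) {a : κ → ℂ} (ha : Summable fun γ => ‖a γ‖) {B : ℝ}
    (hB : ∀ x, ‖∑' γ, a γ * mFourier (e γ) x‖ ≤ B) (β : κ) : ‖a β‖ ≤ B := by
  classical
  set μ : Measure (UnitAddTorus d) := Measure.pi fun _ => AddCircle.haarAddCircle
  set F : κ → UnitAddTorus d → ℂ := fun γ x => mFourier (-e β) x * (a γ * mFourier (e γ) x) with hF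
  have hnorm : ∀ γ x, ‖F γ x‖ = ‖a γ‖ := fun γ x => by
    rw [hF, norm_mul, norm_mul, norm_mFourier_apply, norm_mFourier_apply, one_mul, mul_one]
  have hintg : ∀ γ, ∫ x, F γ x ∂μ = if γ = β then a β else 0 := by
    intro γ
    simp_rw [hF, mul_left_comm _ (a γ)]
    rw [integral_const_mul, integral_mFourier_neg_mul_mFourier]
    by_cases h : γ = β
    · simp [h]
    · simp [h, he.ne (Ne.symm h)]
  have hsum : HasSum (fun γ => ∫ x, F γ x ∂μ) (∫ x, ∑' γ, F γ x ∂μ) := by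
    refine hasSum_integral_of_summable_integral_norm (fun γ => ?_) ?_
    · exact Integrable.of_bound (by fun_prop) ‖a γ‖ (Eventually.of_forall fun x => (hnorm γ x).le)
    · simpa only [hnorm, integral_const, probReal_univ, one_smul] using ha
  simp_rw [hintg] at hsum
  rw [← hsum.unique (hasSum_ite_eq β (a β))]
  refine (norm_integral_le_of_norm_le_const (C := B) (Eventually.of_forall fun x => ?_)).trans_eq
    (by rw [probReal_univ, mul_one])
  rw [hF, tsum_mul_left, norm_mul, norm_mFourier_apply, one_mul]
  exact hB x

theorem norm_coeff_mul_prod_pow_le {ι : Type*} [Fintype ι] {A : (ι → ℕ) → ℂ} {r : ι → ℝ}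
    (hr : ∀ j, 0 ≤ r j) (hs : Summable fun β => ‖A β‖ * ∏ j, r j ^ β j) {B : ℝ}
    (hB : ∀ ζ : ι → ℂ, (∀ j, ‖ζ j‖ = r j) → ‖∑' β, A β * ∏ j, ζ j ^ β j‖ ≤ B) (β : ι → ℕ) :
    ‖A β‖ * ∏ j, r j ^ β j ≤ B := by
  set a : (ι → ℕ) → ℂ := fun γ => A γ * ∏ j, (r j : ℂ) ^ γ j with ha
  have hnorm : ∀ γ, ‖a γ‖ = ‖A γ‖ * ∏ j, r j ^ γ j := by
    intro γ
    simp_rw [ha, norm_mul, norm_prod, norm_pow, Complex.norm_real, Real.norm_of_nonneg (hr _)]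
  have he : Function.Injective fun (γ : ι → ℕ) j => (γ j : ℤ) := fun γ γ' h =>
    funext fun j => Int.ofNat_inj.1 (congrFun h j)
  rw [← hnorm]
  refine norm_coeff_le_of_norm_tsum_mFourier_le he (by simpa only [hnorm] using hs)
    (fun x => ?_) β
  have hterm : ∀ γ : ι → ℕ, a γ * mFourier (fun j => (γ j : ℤ)) x =
      A γ * ∏ j, ((r j : ℂ) * fourier 1 (x j)) ^ γ j := by
    intro γ
    have hpow : ∀ j, fourier (γ j : ℤ) (x j) = fourier 1 (x j) ^ γ j := fun j => by
      rw [fourier_apply, fourier_apply, ← Circle.coe_pow, ← AddCircle.toCircle_nsmul, one_zsmul,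
        natCast_zsmul]
    simp only [ha, mFourier, ContinuousMap.coe_mk, hpow, mul_pow, Finset.prod_mul_distrib,
      mul_assoc]
  simp_rw [hterm]
  refine hB _ fun j => ?_
  rw [norm_mul, Complex.norm_real, Real.norm_of_nonneg (hr j), fourier_apply, Circle.norm_coe,
    mul_one]

end CauchyEstimate

theorem sum_choose_mul_eq_sum_prod_choose_mul {ι R : Type*} [Fintype ι] [DecidableEq ι]
    [CommSemiring R] (γ : ι → ℕ) (w : ℕ → R) :
    ∑ j ∈ Finset.range ((∑ i, γ i) + 1), ((∑ i, γ i).choose j : R) * w j =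
      ∑ β ∈ Fintype.piFinset fun i => Finset.range (γ i + 1),
        (∏ i, ((γ i).choose (β i) : R)) * w (∑ i, β i) := by
  -- The functional `X ^ j ↦ w j` applied to `(X + 1) ^ |γ| = ∏ i, (X + 1) ^ γ i`.
  let L : Polynomial R →ₗ[R] R := Polynomial.lsum fun j => w j • LinearMap.id
  have hL : ∀ (c : R) (j : ℕ), L (Polynomial.C c * Polynomial.X ^ j) = c * w j := by
    intro c j
    rw [Polynomial.C_mul_X_pow_eq_monomial, Polynomial.lsum_apply,
      Polynomial.sum_monomial_index _ _ (LinearMap.map_zero _), LinearMap.smul_apply,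
      LinearMap.id_apply, smul_eq_mul, mul_comm]
  have hpow : ∀ k : ℕ, (Polynomial.X + 1 : Polynomial R) ^ k =
      ∑ j ∈ Finset.range (k + 1), Polynomial.C (k.choose j : R) * Polynomial.X ^ j := by
    intro k
    rw [add_pow]
    refine Finset.sum_congr rfl fun j _ => ?_
    rw [one_pow, mul_one, mul_comm, map_natCast]
  have h := congrArg L (Finset.prod_pow_eq_pow_sum Finset.univ γ (Polynomial.X + 1)).symm
  simp_rw [hpow, Finset.prod_univ_sum, Finset.prod_mul_distrib, Finset.prod_pow_eq_pow_sum] at h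
  simp_rw [← map_prod, map_sum, hL] at h
  exact h

theorem factorial_mul_exp_le (b : ℕ) :
    (b.factorial : ℝ) * Real.exp b ≤ Real.exp 1 * (b + 1) * (b : ℝ) ^ b := by
  rcases Nat.eq_zero_or_pos b with rfl | hb
  · simp
  have hb' : (1 : ℝ) ≤ b := by exact_mod_cast hb
  have hle : Stirling.stirlingSeq b ≤ Real.exp 1 / √2 := by
    have h := Stirling.stirlingSeq'_antitone (Nat.zero_le (b - 1))
    simpa only [Function.comp_apply, Nat.succ_eq_add_one, Nat.sub_add_cancel hb, zero_add,
      Stirling.stirlingSeq_one] using h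
  rw [Stirling.stirlingSeq, div_pow, div_le_iff₀ (by positivity), ← Real.exp_nat_mul, mul_one,
    ← mul_div_assoc, ← mul_div_assoc, le_div_iff₀ (Real.exp_pos _), Real.sqrt_mul zero_le_two,
    ← mul_assoc, ← mul_assoc, div_mul_cancel₀ _ (by positivity)] at hle
  refine hle.trans ?_
  gcongr
  exact (Real.sqrt_le_self_iff.2 (Or.inr hb')).trans (by linarith)

theorem summable_geometric_mul_add_one {q : ℝ} (hq0 : 0 ≤ q) (hq : q < 1) :
    Summable fun b : ℕ => q ^ b * (Real.exp 1 * (b + 1)) := by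
  have h := (summable_choose_mul_geometric_of_norm_lt_one 1 (r := q)
    (by rwa [Real.norm_of_nonneg hq0])).mul_left (Real.exp 1)
  refine h.congr fun b => ?_
  rw [Nat.choose_one_right]
  push_cast
  ring

variable {n : ℕ}

/-- The Laguerre polynomial `L_k^a` at `-x`, normalized to have the value `1` at `0`. -/
noncomputable def laguerreWeight (a k : ℕ) (x : ℝ) : ℝ :=
  ∑ j ∈ Finset.range (k + 1),
    (k.choose j : ℝ) * ((a.factorial : ℝ) / ((a + j).factorial : ℝ)) * x ^ j

theorem laguerreWeight_nonneg (a k : ℕ) {x : ℝ} (hx : 0 ≤ x) : 0 ≤ laguerreWeight a k x :=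
  Finset.sum_nonneg fun j _ => by positivity

theorem laguerreWeight_mono (a k : ℕ) {x y : ℝ} (hx : 0 ≤ x) (hxy : x ≤ y) :
    laguerreWeight a k x ≤ laguerreWeight a k y :=
  Finset.sum_le_sum fun j _ => by gcongr

theorem factorial_mul_factorial_div_mul_choose_div {j k : ℕ} (a : ℕ) (hjk : j ≤ k) :
    (k.factorial : ℝ) * a.factorial / (k + a).factorial *
        ((k + a).choose (k - j) / j.factorial) =
      k.choose j * (a.factorial / (a + j).factorial) := by
  rw [Nat.cast_choose ℝ hjk, Nat.cast_choose ℝ (show k - j ≤ k + a by lia),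
    show k + a - (k - j) = a + j by lia]
  field_simp

theorem factorial_mul_laguerre_neg (k a : ℕ) (x : ℝ) :
    (((k.factorial : ℝ) * a.factorial / (k + a).factorial : ℝ) : ℂ) * laguerre k a (-x) =
      (laguerreWeight a k x : ℂ) := by
  rw [laguerre, laguerreWeight, Complex.ofReal_sum, Finset.mul_sum]
  refine Finset.sum_congr rfl fun j hj => ?_
  rw [← factorial_mul_factorial_div_mul_choose_div a (Finset.mem_range_succ_iff.1 hj),
    neg_pow (x : ℂ)]
  have hsign : (-1 : ℂ) ^ j * (-1) ^ j = 1 := by rw [← mul_pow, neg_one_mul, neg_neg, one_pow]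
  push_cast
  linear_combination ((k.factorial : ℂ) * a.factorial / (k + a).factorial *
    ((k + a).choose (k - j) * x ^ j / j.factorial)) * hsign

theorem sum_two_I_smul_toComplex_sq (y : RSpace n) :
    ∑ j, ((2 * Complex.I) • toComplex y) j ^ 2 = -(4 * (‖y‖ ^ 2 : ℝ)) := by
  rw [EuclideanSpace.real_norm_sq_eq, Complex.ofReal_sum, Finset.mul_sum, ← Finset.sum_neg_distrib]
  refine Finset.sum_congr rfl fun j _ => ?_
  simp only [PiLp.smul_apply, smul_eq_mul, toComplex, mul_pow, Complex.I_sq, Complex.ofReal_pow]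
  ring

theorem factorial_mul_laguerreFun (k a : ℕ) (y v : RSpace n) :
    (((k.factorial : ℝ) * a.factorial / (k + a).factorial : ℝ) : ℂ) *
        laguerreFun k a ((2 * Complex.I) • toComplex y) ((2 * Complex.I) • toComplex v) =
      ((laguerreWeight a k (2 * (‖y‖ ^ 2 + ‖v‖ ^ 2)) * Real.exp (‖y‖ ^ 2 + ‖v‖ ^ 2) : ℝ) : ℂ) := by
  rw [laguerreFun, sum_two_I_smul_toComplex_sq, sum_two_I_smul_toComplex_sq, Complex.ofReal_mul,
    ← factorial_mul_laguerre_neg, mul_assoc, Complex.ofReal_exp]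
  congr 3
  · push_cast
    ring
  · push_cast
    ring

theorem mem_VOmega_iff (hn : 0 < n) {t : ℝ} (ht : 0 ≤ t) (φ : LTwo n) :
    φ ∈ VOmega n t ↔
      Summable fun k : ℕ => ‖hermiteProj k φ‖ ^ 2 * laguerreWeight (n - 1) k (2 * t ^ 2) := by
  have hiff : ∀ y v : RSpace n, (Summable fun k : ℕ =>
      ((‖hermiteProj k φ‖ ^ 2 * ((k.factorial : ℝ) * ((n - 1).factorial : ℝ) /
        ((k + n - 1).factorial : ℝ)) : ℝ) : ℂ) *
        laguerreFun k (n - 1) ((2 * Complex.I) • toComplex y) ((2 * Complex.I) • toComplex v)) ↔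
      Summable fun k : ℕ =>
        ‖hermiteProj k φ‖ ^ 2 * laguerreWeight (n - 1) k (2 * (‖y‖ ^ 2 + ‖v‖ ^ 2)) := by
    intro y v
    simp_rw [Nat.add_sub_assoc hn, Complex.ofReal_mul (‖_‖ ^ 2), mul_assoc,
      factorial_mul_laguerreFun, ← Complex.ofReal_mul, ← mul_assoc]
    rw [Complex.summable_ofReal, summable_mul_right_iff (Real.exp_pos _).ne']
  constructor
  · intro h
    have hnorm : ‖(EuclideanSpace.single ⟨0, hn⟩ t : RSpace n)‖ = t := by
      rw [PiLp.norm_single, Real.norm_of_nonneg ht]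
    have hsum := (hiff _ 0).1 (h (EuclideanSpace.single ⟨0, hn⟩ t) 0 (by simp [hnorm]))
    simpa [hnorm] using hsum
  · intro h y v hyv
    refine (hiff y v).2 (h.of_nonneg_of_le (fun k => ?_) (fun k => ?_))
    · exact mul_nonneg (sq_nonneg _) (laguerreWeight_nonneg _ k (by positivity))
    · exact mul_le_mul_of_nonneg_left
        (laguerreWeight_mono _ k (by positivity) (by linarith)) (sq_nonneg _)

/-- The scalar factor of `creationCoeff ζ α β`, which multiplies the monomial `ζ ^ β`. -/
noncomputable def creationConst (α β : Fin n → ℕ) : ℝ :=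
  ∏ j, (√2 ^ (β j) / ((β j).factorial : ℝ) * √(((α j + β j).factorial : ℝ) / (α j).factorial))

theorem creationConst_nonneg (α β : Fin n → ℕ) : 0 ≤ creationConst α β :=
  Finset.prod_nonneg fun j _ => by positivity

theorem creationCoeff_eq (ζ : CSpace n) (α β : Fin n → ℕ) :
    creationCoeff ζ α β = creationConst α β * ∏ j, ζ j ^ β j := by
  rw [creationCoeff, creationConst, Complex.ofReal_prod, ← Finset.prod_mul_distrib]
  refine Finset.prod_congr rfl fun j _ => ?_
  push_cast
  ring

theorem creationConst_sq_mul_prod_factorial (α β : Fin n → ℕ) :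
    creationConst α β ^ 2 * ∏ j, ((β j).factorial : ℝ) =
      2 ^ (∑ j, β j) * ∏ j, ((α j + β j).choose (β j) : ℝ) := by
  rw [creationConst, ← Finset.prod_pow, ← Finset.prod_mul_distrib,
    ← Finset.prod_pow_eq_pow_sum, ← Finset.prod_mul_distrib]
  refine Finset.prod_congr rfl fun j _ => ?_
  rw [mul_pow, div_pow, pow_right_comm, Real.sq_sqrt zero_le_two, Real.sq_sqrt (by positivity),
    Nat.cast_choose ℝ (Nat.le_add_left _ _), Nat.add_sub_cancel]
  field_simp

/-- The exponentials `exp (√2 ζ·A)` of the annihilation operators, `‖ζ‖ ≤ t`, map `φ` to vectors of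
norm at most `M`. This is encoded by duality: the coefficient of `exp (√2 ζ·A) φ` at `Φ_α` is the
integral of `φ` against `creationFun ζ α`. -/
def HasAnnihilationBound (φ : LTwo n) (t M : ℝ) : Prop :=
  ∀ ζ : CSpace n, ‖ζ‖ ^ 2 ≤ t ^ 2 → ∀ (S : Finset (Fin n → ℕ)) (d : (Fin n → ℕ) → ℂ),
    ‖∑ α ∈ S, d α * ∫ x, (φ : RSpace n → ℂ) x * creationFun ζ α x‖ ≤ M * √(∑ α ∈ S, ‖d α‖ ^ 2)

theorem HasAnnihilationBound.norm_sum_creationConst_mul_le {φ : LTwo n} {t M : ℝ}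
    (hφ : HasAnnihilationBound φ t M) {r : Fin n → ℝ} (hr0 : ∀ j, 0 ≤ r j)
    (hr : ∑ j, r j ^ 2 ≤ t ^ 2) (S : Finset (Fin n → ℕ)) (β : Fin n → ℕ) (d : (Fin n → ℕ) → ℂ) :
    ‖∑ α ∈ S, d α * (creationConst α β * inner ℂ (hermiteVec (α + β)) φ)‖ * ∏ j, r j ^ β j ≤
      M * √(∑ α ∈ S, ‖d α‖ ^ 2) := by
  set A : (Fin n → ℕ) → ℂ := fun γ =>
    ∑ α ∈ S, d α * (creationConst α γ * inner ℂ (hermiteVec (α + γ)) φ) with hA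
  have hsum : ∀ ζ : CSpace n, HasSum (fun γ => A γ * ∏ j, ζ j ^ γ j)
      (∑ α ∈ S, d α * ∫ x, (φ : RSpace n → ℂ) x * creationFun ζ α x) := by
    intro ζ
    refine (hasSum_sum fun α _ =>
      (hasSum_integral_mul_creationFun φ ζ α).mul_left (d α)).congr_fun fun γ => ?_
    rw [hA, Finset.sum_mul]
    refine Finset.sum_congr rfl fun α _ => ?_
    rw [creationCoeff_eq]
    ring
  refine norm_coeff_mul_prod_pow_le (A := A) hr0 ?_ (fun ζ hζ => ?_) β
  · refine (hsum (WithLp.toLp 2 fun j => (r j : ℂ))).summable.norm.congr fun γ => ?_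
    simp only [norm_mul, norm_prod, norm_pow, Complex.norm_real, Real.norm_of_nonneg (hr0 _)]
  · rw [(hsum (WithLp.toLp 2 ζ)).tsum_eq]
    refine hφ _ ?_ S d
    rw [EuclideanSpace.norm_sq_eq]
    simpa only [hζ] using hr

theorem sum_norm_sq_mul_sq_le_of_norm_sum_mul_le {ι : Type*} {w : ι → ℂ} {S : Finset ι} {R M : ℝ}
    (hR : 0 ≤ R)
    (h : ∀ d : ι → ℂ, ‖∑ i ∈ S, d i * w i‖ * R ≤ M * √(∑ i ∈ S, ‖d i‖ ^ 2)) :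
    (∑ i ∈ S, ‖w i‖ ^ 2) * R ^ 2 ≤ M ^ 2 := by
  set Q := ∑ i ∈ S, ‖w i‖ ^ 2 with hQ
  have hQ0 : 0 ≤ Q := Finset.sum_nonneg fun i _ => sq_nonneg _
  have hconj : √Q * √Q * R ≤ M * √Q := by
    have h := h fun i => (starRingEnd ℂ) (w i)
    simp_rw [Complex.conj_mul', ← Complex.ofReal_pow, ← Complex.ofReal_sum, RCLike.norm_conj] at h
    rwa [← hQ, Complex.norm_real, Real.norm_of_nonneg hQ0, ← Real.mul_self_sqrt hQ0,
      Real.sqrt_mul_self (Real.sqrt_nonneg Q)] at h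
  rcases (Real.sqrt_nonneg Q).eq_or_lt with h0 | hpos
  · rw [← Real.mul_self_sqrt hQ0, ← h0, zero_mul, zero_mul]
    exact sq_nonneg M
  · have hle : √Q * R ≤ M := le_of_mul_le_mul_right (by linarith) hpos
    calc Q * R ^ 2 = (√Q * R) ^ 2 := by rw [mul_pow, Real.sq_sqrt hQ0]
      _ ≤ M ^ 2 := by gcongr

theorem HasAnnihilationBound.sum_creationConst_sq_le {φ : LTwo n} {t M : ℝ}
    (hφ : HasAnnihilationBound φ t M) {ρ : Fin n → ℝ} (hρ0 : ∀ j, 0 ≤ ρ j)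
    (hρ : ∑ j, ρ j ≤ t ^ 2) (S : Finset (Fin n → ℕ)) (β : Fin n → ℕ) :
    (∑ α ∈ S, creationConst α β ^ 2 * ‖inner ℂ (hermiteVec (α + β)) φ‖ ^ 2) *
      ∏ j, ρ j ^ β j ≤ M ^ 2 := by
  have h := sum_norm_sq_mul_sq_le_of_norm_sum_mul_le
    (Finset.prod_nonneg fun j _ => pow_nonneg (Real.sqrt_nonneg (ρ j)) (β j))
    (hφ.norm_sum_creationConst_mul_le (r := fun j => √(ρ j)) (fun j => Real.sqrt_nonneg _)
      (by simpa only [Real.sq_sqrt (hρ0 _)] using hρ) S β)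
  simpa only [norm_mul, Complex.norm_real, Real.norm_of_nonneg (creationConst_nonneg _ _), mul_pow,
    ← Finset.prod_pow, pow_right_comm _ (β _) 2, Real.sq_sqrt (hρ0 _)] using h

theorem prod_factorial_div_factorial_sum_le {ι : Type*} [Fintype ι] (β : ι → ℕ) :
    (∏ j, ((β j).factorial : ℝ)) / ((∑ j, β j).factorial : ℝ) ≤
      (∏ j, Real.exp 1 * ((β j : ℝ) + 1)) * ∏ j, ((β j : ℝ) / (∑ j, β j : ℕ)) ^ β j := by
  set m := ∑ j, β j with hm
  have hprod : (∏ j, ((β j).factorial : ℝ)) * Real.exp m ≤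
      (∏ j, (Real.exp 1 * ((β j : ℝ) + 1))) * ∏ j, (β j : ℝ) ^ β j := by
    rw [hm, Nat.cast_sum, Real.exp_sum, ← Finset.prod_mul_distrib, ← Finset.prod_mul_distrib]
    exact Finset.prod_le_prod (fun j _ => by positivity) fun j _ => factorial_mul_exp_le (β j)
  have hmm : (0 : ℝ) < (m : ℝ) ^ m := by
    rcases Nat.eq_zero_or_pos m with h | h
    · simp [h]
    · positivity
  have hexp : (m : ℝ) ^ m / m.factorial ≤ Real.exp m :=
    Real.pow_div_factorial_le_exp (m : ℝ) m.cast_nonneg m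
  simp_rw [div_pow]
  rw [Finset.prod_div_distrib, Finset.prod_pow_eq_pow_sum, ← hm, ← mul_div_assoc, le_div_iff₀ hmm]
  calc (∏ j, ((β j).factorial : ℝ)) / m.factorial * (m : ℝ) ^ m
      = (∏ j, ((β j).factorial : ℝ)) * ((m : ℝ) ^ m / m.factorial) := by ring
    _ ≤ (∏ j, ((β j).factorial : ℝ)) * Real.exp m := by gcongr
    _ ≤ _ := hprod

theorem prod_choose_mul_pow_div_factorial_le {s t : ℝ} (ht : t ≠ 0) (α β : Fin n → ℕ) :
    (∏ j, ((α j + β j).choose (β j) : ℝ)) *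
        ((2 * s ^ 2) ^ (∑ j, β j) / ((∑ j, β j).factorial : ℝ)) ≤
      creationConst α β ^ 2 * (∏ j, (t ^ 2 * ((β j : ℝ) / (∑ j, β j : ℕ))) ^ β j) *
        ∏ j, (((s / t) ^ 2) ^ β j * (Real.exp 1 * ((β j : ℝ) + 1))) := by
  have hle := prod_factorial_div_factorial_sum_le β
  simp_rw [mul_pow (t ^ 2), Finset.prod_mul_distrib, Finset.prod_pow_eq_pow_sum]
  rw [Finset.prod_mul_distrib] at hle
  set m := ∑ j, β j
  have hst : (t ^ 2) ^ m * ((s / t) ^ 2) ^ m = (s ^ 2) ^ m := by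
    rw [← mul_pow, div_pow, mul_div_cancel₀ _ (pow_ne_zero 2 ht)]
  calc (∏ j, ((α j + β j).choose (β j) : ℝ)) * ((2 * s ^ 2) ^ m / (m.factorial : ℝ))
      = (2 ^ m * ∏ j, ((α j + β j).choose (β j) : ℝ)) * (s ^ 2) ^ m / m.factorial := by
        rw [mul_pow]
        ring
    _ = creationConst α β ^ 2 * (s ^ 2) ^ m * ((∏ j, ((β j).factorial : ℝ)) / m.factorial) := by
        rw [← creationConst_sq_mul_prod_factorial]
        ring
    _ ≤ creationConst α β ^ 2 * (s ^ 2) ^ m * (((∏ _ : Fin n, Real.exp 1) *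
          ∏ j, ((β j : ℝ) + 1)) * ∏ j, ((β j : ℝ) / m) ^ β j) := by gcongr
    _ = _ := by
        rw [← hst]
        ring

theorem HasAnnihilationBound.sum_prod_choose_mul_le {φ : LTwo n} {t M : ℝ}
    (hφ : HasAnnihilationBound φ t M) (ht : t ≠ 0) (s : ℝ) (S : Finset (Fin n → ℕ))
    (β : Fin n → ℕ) :
    ∑ α ∈ S, ‖inner ℂ (hermiteVec (α + β)) φ‖ ^ 2 *
        ((∏ j, ((α j + β j).choose (β j) : ℝ)) *
          ((2 * s ^ 2) ^ (∑ j, β j) / ((∑ j, β j).factorial : ℝ))) ≤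
      M ^ 2 * ∏ j, (((s / t) ^ 2) ^ β j * (Real.exp 1 * ((β j : ℝ) + 1))) := by
  -- The radii for which Cauchy's estimate for the coefficient of `ζ ^ β` is optimal.
  set ρ : Fin n → ℝ := fun j => t ^ 2 * ((β j : ℝ) / (∑ j, β j : ℕ))
  set E : ℝ := ∏ j, (((s / t) ^ 2) ^ β j * (Real.exp 1 * ((β j : ℝ) + 1)))
  have hE : 0 ≤ E := Finset.prod_nonneg fun j _ => by positivity
  have hρ : ∑ j, ρ j ≤ t ^ 2 := by
    rw [← Finset.mul_sum, ← Finset.sum_div, ← Nat.cast_sum]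
    exact mul_le_of_le_one_right (sq_nonneg t) (div_self_le_one _)
  calc ∑ α ∈ S, ‖inner ℂ (hermiteVec (α + β)) φ‖ ^ 2 *
        ((∏ j, ((α j + β j).choose (β j) : ℝ)) *
          ((2 * s ^ 2) ^ (∑ j, β j) / ((∑ j, β j).factorial : ℝ)))
      ≤ ∑ α ∈ S, ‖inner ℂ (hermiteVec (α + β)) φ‖ ^ 2 *
          (creationConst α β ^ 2 * (∏ j, ρ j ^ β j) * E) :=
        Finset.sum_le_sum fun α _ => mul_le_mul_of_nonneg_left
          (prod_choose_mul_pow_div_factorial_le ht α β) (sq_nonneg _)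
    _ = ((∑ α ∈ S, creationConst α β ^ 2 * ‖inner ℂ (hermiteVec (α + β)) φ‖ ^ 2) *
          ∏ j, ρ j ^ β j) * E := by
        rw [Finset.sum_mul, Finset.sum_mul]
        exact Finset.sum_congr rfl fun α _ => by ring
    _ ≤ M ^ 2 * E := mul_le_mul_of_nonneg_right
        (hφ.sum_creationConst_sq_le (fun j => by positivity) hρ S β) hE

theorem HasAnnihilationBound.summable_prod_choose_mul {φ : LTwo n} {s t M : ℝ}
    (hφ : HasAnnihilationBound φ t M) (hs : 0 < s) (hst : s < t) :
    Summable fun p : (Fin n → ℕ) × (Fin n → ℕ) => ‖inner ℂ (hermiteVec (p.2 + p.1)) φ‖ ^ 2 *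
      ((∏ j, ((p.2 j + p.1 j).choose (p.1 j) : ℝ)) *
        ((2 * s ^ 2) ^ (∑ j, p.1 j) / ((∑ j, p.1 j).factorial : ℝ))) := by
  have ht : 0 < t := hs.trans hst
  have hq : (s / t) ^ 2 < 1 := pow_lt_one₀ (by positivity) ((div_lt_one ht).2 hst) two_ne_zero
  have hgeom := summable_geometric_mul_add_one (q := (s / t) ^ 2) (by positivity) hq
  have hbound := hφ.sum_prod_choose_mul_le ht.ne' s
  rw [summable_prod_of_nonneg fun p => by positivity]
  refine ⟨fun β => summable_of_sum_le (fun α => by positivity) fun S => hbound S β,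
    Summable.of_nonneg_of_le (fun β => tsum_nonneg fun α => by positivity)
      (fun β => Real.tsum_le_of_sum_le (fun α => by positivity) fun S => hbound S β)
      ((hasSum_prod_pi (fun _ : Fin n => hgeom.hasSum) fun _ => hgeom.norm).summable.mul_left _)⟩

theorem summable_sum_piFinset_range_sub {ι E : Type*} [Fintype ι] [DecidableEq ι]
    [NormedAddCommGroup E] [CompleteSpace E] {u : (ι → ℕ) × (ι → ℕ) → E} (hu : Summable u) :
    Summable fun γ : ι → ℕ =>
      ∑ β ∈ Fintype.piFinset fun i => Finset.range (γ i + 1), u (β, γ - β) := by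
  let e : (Σ γ : ι → ℕ, Fintype.piFinset fun i => Finset.range (γ i + 1)) →
      (ι → ℕ) × (ι → ℕ) := fun p => (p.2, p.1 - p.2)
  have hle : ∀ p : Σ γ : ι → ℕ, Fintype.piFinset fun i => Finset.range (γ i + 1),
      (p.2 : ι → ℕ) ≤ p.1 := fun p i =>
    Finset.mem_range_succ_iff.1 (Fintype.mem_piFinset.1 p.2.2 i)
  have he : Function.Injective e := by
    intro p q h
    obtain ⟨h₁, h₂⟩ := Prod.mk.inj h
    have hγ : p.1 = q.1 := by
      rw [← tsub_add_cancel_of_le (hle p), ← tsub_add_cancel_of_le (hle q), h₂, h₁]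
    rcases p with ⟨γ, β⟩
    rcases q with ⟨γ', β'⟩
    obtain rfl : γ = γ' := hγ
    obtain rfl : β = β' := Subtype.ext h₁
    rfl
  refine (hu.comp_injective he).sigma.congr fun γ => ?_
  rw [tsum_fintype]
  exact Finset.sum_coe_sort _ fun β => u (β, γ - β)

theorem summable_norm_hermiteProj_sq_mul {φ : LTwo n} {w : ℕ → ℝ}
    (h : Summable fun γ : Fin n → ℕ => ‖inner ℂ (hermiteVec γ) φ‖ ^ 2 * w (∑ j, γ j)) :
    Summable fun k => ‖hermiteProj k φ‖ ^ 2 * w k := by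
  let e : (Σ k : ℕ, Finset.piAntidiag (Finset.univ : Finset (Fin n)) k) → Fin n → ℕ := fun p => p.2
  have hsum : ∀ p : Σ k : ℕ, Finset.piAntidiag (Finset.univ : Finset (Fin n)) k,
      ∑ j, e p j = p.1 := fun p => (Finset.mem_piAntidiag.1 p.2.2).1
  have he : Function.Injective e := by
    intro p q h
    have hk : p.1 = q.1 := by rw [← hsum p, ← hsum q, h]
    rcases p with ⟨k, γ⟩
    rcases q with ⟨k', γ'⟩
    obtain rfl : k = k' := hk
    obtain rfl : γ = γ' := Subtype.ext h
    rfl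
  refine (h.comp_injective he).sigma.congr fun k => ?_
  simp only [Function.comp_apply, hsum, tsum_fintype]
  rw [norm_hermiteProj_sq, Finset.sum_mul]
  exact Finset.sum_coe_sort _ fun γ => ‖inner ℂ (hermiteVec γ) φ‖ ^ 2 * w k

theorem laguerreWeight_sum_le {ι : Type*} [Fintype ι] [DecidableEq ι] (a : ℕ) (γ : ι → ℕ) {x : ℝ}
    (hx : 0 ≤ x) :
    laguerreWeight a (∑ j, γ j) x ≤
      ∑ β ∈ Fintype.piFinset fun i => Finset.range (γ i + 1),
        (∏ i, ((γ i).choose (β i) : ℝ)) * (x ^ (∑ j, β j) / ((∑ j, β j).factorial : ℝ)) := by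
  rw [← sum_choose_mul_eq_sum_prod_choose_mul γ fun j => x ^ j / (j.factorial : ℝ), laguerreWeight]
  refine Finset.sum_le_sum fun j _ => ?_
  rw [mul_assoc, ← one_div_mul_eq_div (j.factorial : ℝ) (x ^ j)]
  have hfac : (a.factorial : ℝ) / (a + j).factorial ≤ 1 / j.factorial := by
    rw [div_le_div_iff₀ (by positivity) (by positivity), one_mul]
    exact_mod_cast Nat.le_of_dvd (Nat.factorial_pos _)
      (Nat.factorial_mul_factorial_dvd_factorial_add a j)
  gcongr

theorem HasAnnihilationBound.mem_VOmega (hn : 0 < n) {φ : LTwo n} {s t M : ℝ}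
    (hφ : HasAnnihilationBound φ t M) (hs : 0 < s) (hst : s < t) : φ ∈ VOmega n s := by
  classical
  rw [mem_VOmega_iff hn hs.le]
  refine summable_norm_hermiteProj_sq_mul (Summable.of_nonneg_of_le (fun γ => ?_) (fun γ => ?_)
    (summable_sum_piFinset_range_sub (hφ.summable_prod_choose_mul hs hst)))
  · exact mul_nonneg (sq_nonneg _) (laguerreWeight_nonneg _ _ (by positivity))
  · have hsub : ∀ β ∈ Fintype.piFinset fun i => Finset.range (γ i + 1), γ - β + β = γ :=
      fun β hβ => tsub_add_cancel_of_le fun i =>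
        Finset.mem_range_succ_iff.1 (Fintype.mem_piFinset.1 hβ i)
    calc ‖inner ℂ (hermiteVec γ) φ‖ ^ 2 * laguerreWeight (n - 1) (∑ j, γ j) (2 * s ^ 2)
        ≤ ‖inner ℂ (hermiteVec γ) φ‖ ^ 2 *
            ∑ β ∈ Fintype.piFinset fun i => Finset.range (γ i + 1),
              (∏ i, ((γ i).choose (β i) : ℝ)) *
                ((2 * s ^ 2) ^ (∑ j, β j) / ((∑ j, β j).factorial : ℝ)) :=
          mul_le_mul_of_nonneg_left (laguerreWeight_sum_le _ γ (by positivity)) (sq_nonneg _)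
      _ = _ := by
          rw [Finset.mul_sum]
          refine Finset.sum_congr rfl fun β hβ => ?_
          simp only [← Pi.add_apply, hsub β hβ]

/-! ### Hermite series on tubes -/

theorem term_le_laguerreWeight (a : ℕ) {j k : ℕ} {x : ℝ} (hx : 0 ≤ x) (hjk : j ≤ k) :
    (k.choose j : ℝ) * ((a.factorial : ℝ) / ((a + j).factorial : ℝ)) * x ^ j ≤
      laguerreWeight a k x :=
  Finset.single_le_sum
    (f := fun j => (k.choose j : ℝ) * ((a.factorial : ℝ) / ((a + j).factorial : ℝ)) * x ^ j)
    (fun j _ => by positivity) (Finset.mem_range_succ_iff.2 hjk)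

theorem one_le_laguerreWeight (a k : ℕ) {x : ℝ} (hx : 0 ≤ x) : 1 ≤ laguerreWeight a k x := by
  simpa [div_self (show (a.factorial : ℝ) ≠ 0 by positivity)] using
    term_le_laguerreWeight a hx k.zero_le

theorem pow_le_exp_mul_choose_mul_factorial {j k : ℕ} {x : ℝ} (hk : 0 < k) (hjk : 2 * j ≤ k)
    (hjx : (j : ℝ) ^ 2 ≤ x * k) :
    (k : ℝ) ^ j ≤ Real.exp (2 * x) * (k.choose j * j.factorial) := by
  have hjk' : 2 * (j : ℝ) ≤ k := mod_cast hjk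
  have hk' : (0 : ℝ) < k := mod_cast hk
  have hsub : 0 < (k : ℝ) - j := by linarith
  have hbase : (k : ℝ) ≤ (k - j) * Real.exp (j / (k - j)) :=
    calc (k : ℝ) = (k - j) * (j / (k - j) + 1) := by field_simp; ring
      _ ≤ _ := by gcongr; exact Real.add_one_le_exp _
  have hexponent : (j : ℝ) * (j / (k - j)) ≤ 2 * x := by
    have hx : 0 ≤ x := nonneg_of_mul_nonneg_left ((sq_nonneg _).trans hjx) hk'
    rw [mul_div_assoc', div_le_iff₀ hsub]
    nlinarith
  have hdesc : ((k : ℝ) - j) ^ j ≤ k.choose j * j.factorial := by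
    have hnat : (k - j) ^ j ≤ k.descFactorial j :=
      (Nat.pow_le_pow_left (by lia) j).trans (Nat.pow_sub_le_descFactorial k j)
    rw [Nat.descFactorial_eq_factorial_mul_choose, mul_comm] at hnat
    rw [← Nat.cast_sub (by lia)]
    exact_mod_cast hnat
  calc (k : ℝ) ^ j ≤ ((k - j) * Real.exp (j / (k - j))) ^ j := by gcongr
    _ = Real.exp (j * (j / (k - j))) * (k - j) ^ j := by
        rw [mul_pow, ← Real.exp_nat_mul, mul_comm]
    _ ≤ Real.exp (2 * x) * (k.choose j * j.factorial) := by gcongr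

theorem exp_sq_mul_factorial_le {j k : ℕ} {x : ℝ} (hk : 0 < k) (hjk : 2 * j ≤ k)
    (hjx : (j : ℝ) ^ 2 ≤ x * k) :
    Real.exp j ^ 2 * j.factorial ≤
      Real.exp (2 * x + 2) * ((j : ℝ) + 1) ^ 2 * (k.choose j * x ^ j) := by
  have hx : 0 ≤ x := nonneg_of_mul_nonneg_left ((sq_nonneg _).trans hjx) (by exact_mod_cast hk)
  have hexp : Real.exp 1 ^ 2 = Real.exp 2 := by rw [← Real.exp_nat_mul]; norm_num
  have hself : ((j : ℝ) ^ j) ^ 2 ≤ x ^ j * k ^ j := by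
    rw [← mul_pow, pow_right_comm]
    gcongr
  refine le_of_mul_le_mul_right ?_ (show (0 : ℝ) < j.factorial by positivity)
  calc Real.exp j ^ 2 * j.factorial * j.factorial
      = (j.factorial * Real.exp j) ^ 2 := by ring
    _ ≤ (Real.exp 1 * (j + 1) * (j : ℝ) ^ j) ^ 2 :=
        pow_le_pow_left₀ (by positivity) (factorial_mul_exp_le j) 2
    _ = Real.exp 2 * ((j : ℝ) + 1) ^ 2 * ((j : ℝ) ^ j) ^ 2 := by rw [mul_pow, mul_pow, hexp]
    _ ≤ Real.exp 2 * ((j : ℝ) + 1) ^ 2 *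
          (x ^ j * (Real.exp (2 * x) * (k.choose j * j.factorial))) := by
        gcongr
        refine hself.trans ?_
        gcongr
        exact pow_le_exp_mul_choose_mul_factorial hk hjk hjx
    _ = _ := by rw [Real.exp_add]; ring

theorem factorial_add_le (a j : ℕ) : (a + j).factorial ≤ j.factorial * (j + a) ^ a := by
  rw [add_comm a j, ← Nat.factorial_mul_ascFactorial]
  exact Nat.mul_le_mul_left _ (Nat.ascFactorial_le_pow_add j a)

theorem exp_sq_le_mul_laguerreWeight (a : ℕ) {j k : ℕ} {x : ℝ} (hk : 0 < k) (hjk : 2 * j ≤ k)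
    (hjx : (j : ℝ) ^ 2 ≤ x * k) :
    Real.exp j ^ 2 ≤
      Real.exp (2 * x + 2) * ((k : ℝ) + a + 1) ^ (a + 2) * laguerreWeight a k x := by
  have hx : 0 ≤ x := nonneg_of_mul_nonneg_left ((sq_nonneg _).trans hjx) (by exact_mod_cast hk)
  have hj : (j : ℝ) ≤ k := by exact_mod_cast (show j ≤ k by lia)
  have hfac : ((a + j).factorial : ℝ) ≤ j.factorial * ((k : ℝ) + a + 1) ^ a :=
    calc ((a + j).factorial : ℝ) ≤ j.factorial * ((j : ℝ) + a) ^ a := by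
          exact_mod_cast factorial_add_le a j
      _ ≤ _ := by gcongr _ * ?_ ^ _; linarith
  refine le_of_mul_le_mul_right ?_ (show (0 : ℝ) < (a + j).factorial by positivity)
  calc Real.exp j ^ 2 * (a + j).factorial
      ≤ (Real.exp j ^ 2 * j.factorial) * ((k : ℝ) + a + 1) ^ a := by
        rw [mul_assoc]
        gcongr
    _ ≤ (Real.exp (2 * x + 2) * ((k : ℝ) + a + 1) ^ 2 * (k.choose j * x ^ j)) *
          ((k : ℝ) + a + 1) ^ a := by
        refine mul_le_mul_of_nonneg_right ?_ (by positivity)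
        refine (exp_sq_mul_factorial_le hk hjk hjx).trans ?_
        gcongr
        linarith [a.cast_nonneg (α := ℝ)]
    _ ≤ (Real.exp (2 * x + 2) * ((k : ℝ) + a + 1) ^ 2 * (k.choose j * x ^ j)) *
          ((k : ℝ) + a + 1) ^ a * a.factorial :=
        le_mul_of_one_le_right (by positivity) (by exact_mod_cast a.factorial_pos)
    _ = Real.exp (2 * x + 2) * ((k : ℝ) + a + 1) ^ (a + 2) *
          ((k.choose j : ℝ) * ((a.factorial : ℝ) / ((a + j).factorial : ℝ)) * x ^ j) *
          (a + j).factorial := by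
        rw [pow_add _ a 2]
        field_simp
    _ ≤ _ := by
        gcongr
        exact term_le_laguerreWeight a hx (by lia)

theorem exp_le_mul_laguerreWeight (a k : ℕ) {x : ℝ} (hx : 0 ≤ x) :
    Real.exp (2 * √(x * k)) ≤
      Real.exp (4 * x + 4) * ((k : ℝ) + a + 1) ^ (a + 2) * laguerreWeight a k x := by
  have hk0 : (0 : ℝ) ≤ k := k.cast_nonneg
  have hweight := laguerreWeight_nonneg a k hx
  rcases le_or_gt (k : ℝ) (4 * x) with hk | hk
  · have hsqrt : √(x * k) ≤ 2 * x := by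
      rw [Real.sqrt_le_left (by positivity)]
      nlinarith
    calc Real.exp (2 * √(x * k)) ≤ Real.exp (4 * x + 4) * 1 * 1 := by
          rw [mul_one, mul_one]
          gcongr
          linarith
      _ ≤ _ := by
          gcongr
          · exact one_le_pow₀ (by linarith [a.cast_nonneg (α := ℝ)])
          · exact one_le_laguerreWeight a k hx
  -- The term of index `j ≈ √(x k)` alone is large enough.
  set j := ⌊√(x * k)⌋₊
  have hjle : (j : ℝ) ≤ √(x * k) := Nat.floor_le (Real.sqrt_nonneg _)
  have hltj : √(x * k) < j + 1 := Nat.lt_floor_add_one _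
  have hkpos : (0 : ℝ) < k := by linarith
  have hjx : (j : ℝ) ^ 2 ≤ x * k := (Real.le_sqrt (by positivity) (by positivity)).1 hjle
  have hjk : 2 * (j : ℝ) ≤ k := le_of_sq_le_sq (by nlinarith) hk0
  calc Real.exp (2 * √(x * k)) ≤ Real.exp (2 + 2 * j) := by
        gcongr
        linarith
    _ = Real.exp 2 * Real.exp j ^ 2 := by
        rw [Real.exp_add, ← Real.exp_nat_mul, Nat.cast_ofNat]
    _ ≤ Real.exp 2 *
          (Real.exp (2 * x + 2) * ((k : ℝ) + a + 1) ^ (a + 2) * laguerreWeight a k x) := by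
        gcongr
        exact exp_sq_le_mul_laguerreWeight a (by exact_mod_cast hkpos) (by exact_mod_cast hjk) hjx
    _ = Real.exp (2 * x + 4) * ((k : ℝ) + a + 1) ^ (a + 2) * laguerreWeight a k x := by
        rw [show 2 * x + 4 = 2 + (2 * x + 2) by ring, Real.exp_add 2]
        ring
    _ ≤ _ := by
        gcongr
        linarith

theorem norm_rePart_sq (z : CSpace n) : ‖rePart z‖ ^ 2 = ∑ j, (z j).re ^ 2 :=
  EuclideanSpace.real_norm_sq_eq _

theorem norm_imPart_sq (z : CSpace n) : ‖imPart z‖ ^ 2 = ∑ j, (z j).im ^ 2 :=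
  EuclideanSpace.real_norm_sq_eq _

theorem sum_pow_mul_norm_hermiteFunC_sq_le_one_div {σ : ℝ} (h0 : 0 < σ) (h1 : σ < 1) (w : ℂ)
    (S : Finset ℕ) :
    ∑ m ∈ S, ((1 - σ) / (1 + σ)) ^ m * ‖hermiteFunC m w‖ ^ 2 ≤
      1 / σ * Real.exp (-σ * w.re ^ 2 + 1 / σ * w.im ^ 2) := by
  have : 0 < 1 - σ := by linarith
  have hr : √((1 - σ) / (1 + σ)) ^ 2 = (1 - σ) / (1 + σ) := Real.sq_sqrt (by positivity)
  have hsub : 1 - (1 - σ) / (1 + σ) = 2 * σ / (1 + σ) := by field_simp; ring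
  have hadd : 1 + (1 - σ) / (1 + σ) = 2 / (1 + σ) := by field_simp; ring
  have hbound := sum_pow_mul_norm_hermiteFunC_sq_le
    (r := √((1 - σ) / (1 + σ))) (by rw [hr, hsub]; positivity) w S
  rw [hr, hsub, hadd, show 2 * σ / (1 + σ) / (2 / (1 + σ)) = σ by field_simp,
    show 2 / (1 + σ) / (2 * σ / (1 + σ)) = 1 / σ by field_simp, inv_div] at hbound
  refine hbound.trans (mul_le_mul_of_nonneg_right ?_ (Real.exp_nonneg _))
  rw [div_le_div_iff₀ (by positivity) h0]
  nlinarith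

theorem sum_norm_hermiteMultiC_sq_mul_pow_le {σ : ℝ} (h0 : 0 < σ) (h1 : σ < 1) (z : CSpace n)
    (k : ℕ) :
    (∑ γ ∈ Finset.piAntidiag (Finset.univ : Finset (Fin n)) k, ‖hermiteMultiC γ z‖ ^ 2) *
        ((1 - σ) / (1 + σ)) ^ k ≤
      (1 / σ) ^ n * Real.exp (-σ * ‖rePart z‖ ^ 2 + 1 / σ * ‖imPart z‖ ^ 2) := by
  have : 0 < 1 - σ := by linarith
  have hsub : Finset.piAntidiag (Finset.univ : Finset (Fin n)) k ⊆
      Fintype.piFinset fun _ => Finset.range (k + 1) := fun γ hγ =>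
    Fintype.mem_piFinset.2 fun j => Finset.mem_range_succ_iff.2 <|
      (Finset.single_le_sum (fun i _ => Nat.zero_le _) (Finset.mem_univ j)).trans_eq
        (Finset.mem_piAntidiag.1 hγ).1
  calc (∑ γ ∈ Finset.piAntidiag (Finset.univ : Finset (Fin n)) k, ‖hermiteMultiC γ z‖ ^ 2) *
        ((1 - σ) / (1 + σ)) ^ k
      = ∑ γ ∈ Finset.piAntidiag Finset.univ k,
          ∏ j, ((1 - σ) / (1 + σ)) ^ γ j * ‖hermiteFunC (γ j) (z j)‖ ^ 2 := by
        rw [Finset.sum_mul]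
        refine Finset.sum_congr rfl fun γ hγ => ?_
        rw [← (Finset.mem_piAntidiag.1 hγ).1, Finset.prod_mul_distrib, Finset.prod_pow_eq_pow_sum,
          hermiteMultiC, norm_prod, Finset.prod_pow, mul_comm]
    _ ≤ ∑ γ ∈ Fintype.piFinset fun _ => Finset.range (k + 1),
          ∏ j, ((1 - σ) / (1 + σ)) ^ γ j * ‖hermiteFunC (γ j) (z j)‖ ^ 2 :=
        Finset.sum_le_sum_of_subset_of_nonneg hsub fun γ _ _ =>
          Finset.prod_nonneg fun j _ => by positivity
    _ = ∏ j, ∑ m ∈ Finset.range (k + 1),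
          ((1 - σ) / (1 + σ)) ^ m * ‖hermiteFunC m (z j)‖ ^ 2 :=
        (Finset.prod_univ_sum (fun _ => Finset.range (k + 1))
          fun j m => ((1 - σ) / (1 + σ)) ^ m * ‖hermiteFunC m (z j)‖ ^ 2).symm
    _ ≤ ∏ j, 1 / σ * Real.exp (-σ * (z j).re ^ 2 + 1 / σ * (z j).im ^ 2) :=
        Finset.prod_le_prod (fun j _ => Finset.sum_nonneg fun m _ => by positivity) fun j _ =>
          sum_pow_mul_norm_hermiteFunC_sq_le_one_div h0 h1 (z j) _
    _ = (1 / σ) ^ n * Real.exp (-σ * ‖rePart z‖ ^ 2 + 1 / σ * ‖imPart z‖ ^ 2) := by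
        rw [Finset.prod_mul_distrib, Finset.prod_const, Finset.card_univ, Fintype.card_fin,
          ← Real.exp_sum, Finset.sum_add_distrib, ← Finset.mul_sum, ← Finset.mul_sum,
          norm_rePart_sq, norm_imPart_sq]

theorem one_le_exp_mul_pow {σ : ℝ} (h0 : 0 ≤ σ) (h1 : σ < 1) (k : ℕ) :
    1 ≤ Real.exp (2 * k * σ / (1 - σ)) * ((1 - σ) / (1 + σ)) ^ k := by
  have : 0 < 1 - σ := by linarith
  have hbase : 1 ≤ Real.exp (2 * σ / (1 - σ)) * ((1 - σ) / (1 + σ)) :=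
    calc 1 = (2 * σ / (1 - σ) + 1) * ((1 - σ) / (1 + σ)) := by field_simp; ring
      _ ≤ _ := by gcongr; exact Real.add_one_le_exp _
  rw [show 2 * k * σ / (1 - σ) = k * (2 * σ / (1 - σ)) by ring, Real.exp_nat_mul, ← mul_pow]
  exact one_le_pow₀ hbase

theorem sum_norm_hermiteMultiC_sq_le {σ : ℝ} (h0 : 0 < σ) (h1 : σ < 1) (z : CSpace n) (k : ℕ) :
    ∑ γ ∈ Finset.piAntidiag (Finset.univ : Finset (Fin n)) k, ‖hermiteMultiC γ z‖ ^ 2 ≤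
      Real.exp (2 * k * σ / (1 - σ)) * ((1 / σ) ^ n *
        Real.exp (-σ * ‖rePart z‖ ^ 2 + 1 / σ * ‖imPart z‖ ^ 2)) := by
  refine (le_mul_of_one_le_right (by positivity) (one_le_exp_mul_pow h0.le h1 k)).trans ?_
  rw [mul_left_comm]
  exact mul_le_mul_of_nonneg_left (sum_norm_hermiteMultiC_sq_mul_pow_le h0 h1 z k)
    (Real.exp_nonneg _)

/-- The entire extension of the projection of `φ` to the `k`-th eigenspace. -/
noncomputable def hermiteBlock (φ : LTwo n) (k : ℕ) (z : CSpace n) : ℂ :=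
  ∑ γ ∈ Finset.piAntidiag (Finset.univ : Finset (Fin n)) k,
    inner ℂ (hermiteVec γ) φ * hermiteMultiC γ z

theorem differentiable_hermiteBlock (φ : LTwo n) (k : ℕ) : Differentiable ℂ (hermiteBlock φ k) := by
  unfold hermiteBlock
  have := fun γ : Fin n → ℕ => differentiable_hermiteMultiC γ
  fun_prop

theorem norm_hermiteBlock_sq_le (φ : LTwo n) (k : ℕ) (z : CSpace n) :
    ‖hermiteBlock φ k z‖ ^ 2 ≤ ‖hermiteProj k φ‖ ^ 2 *
      ∑ γ ∈ Finset.piAntidiag (Finset.univ : Finset (Fin n)) k, ‖hermiteMultiC γ z‖ ^ 2 := by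
  rw [norm_hermiteProj_sq]
  refine le_trans ?_ (Finset.sum_mul_sq_le_sq_mul_sq _ _ _)
  gcongr
  exact (norm_sum_le _ _).trans_eq (by simp only [norm_mul])

theorem exists_norm_hermiteProj_sq_le (hn : 0 < n) {t : ℝ} (ht : 0 ≤ t) {φ : LTwo n}
    (hφ : φ ∈ VOmega n t) :
    ∃ M : ℝ, 0 ≤ M ∧ ∀ k : ℕ, ‖hermiteProj k φ‖ ^ 2 ≤
      M * ((k : ℝ) + n) ^ (n + 1) * Real.exp (-(2 * t * √(2 * k))) := by
  have hnonneg (k : ℕ) : 0 ≤ ‖hermiteProj k φ‖ ^ 2 * laguerreWeight (n - 1) k (2 * t ^ 2) :=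
    mul_nonneg (sq_nonneg _) (laguerreWeight_nonneg _ _ (by positivity))
  have hsum := (mem_VOmega_iff hn ht φ).1 hφ
  set M := ∑' k, ‖hermiteProj k φ‖ ^ 2 * laguerreWeight (n - 1) k (2 * t ^ 2)
  refine ⟨M * Real.exp (8 * t ^ 2 + 4), mul_nonneg (tsum_nonneg hnonneg) (Real.exp_nonneg _),
    fun k => ?_⟩
  have hweight : Real.exp (2 * t * √(2 * k)) ≤
      Real.exp (8 * t ^ 2 + 4) * ((k : ℝ) + n) ^ (n + 1) *
        laguerreWeight (n - 1) k (2 * t ^ 2) := by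
    have h := exp_le_mul_laguerreWeight (n - 1) k (show 0 ≤ 2 * t ^ 2 by positivity)
    rwa [show 2 * t ^ 2 * (k : ℝ) = t ^ 2 * (2 * k) by ring, Real.sqrt_mul (sq_nonneg t),
      Real.sqrt_sq ht, ← mul_assoc, show 4 * (2 * t ^ 2) = 8 * t ^ 2 by ring, Nat.cast_pred hn,
      show (k : ℝ) + (n - 1) + 1 = k + n by ring, show n - 1 + 2 = n + 1 by lia] at h
  rw [Real.exp_neg, ← div_eq_mul_inv, le_div_iff₀ (Real.exp_pos _)]
  calc ‖hermiteProj k φ‖ ^ 2 * Real.exp (2 * t * √(2 * k))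
      ≤ ‖hermiteProj k φ‖ ^ 2 * (Real.exp (8 * t ^ 2 + 4) * ((k : ℝ) + n) ^ (n + 1) *
          laguerreWeight (n - 1) k (2 * t ^ 2)) := by gcongr
    _ = ‖hermiteProj k φ‖ ^ 2 * laguerreWeight (n - 1) k (2 * t ^ 2) *
          (Real.exp (8 * t ^ 2 + 4) * ((k : ℝ) + n) ^ (n + 1)) := by ring
    _ ≤ M * (Real.exp (8 * t ^ 2 + 4) * ((k : ℝ) + n) ^ (n + 1)) := by
        gcongr
        exact hsum.le_tsum k fun j _ => hnonneg j
    _ = _ := (mul_assoc _ _ _).symm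

theorem neg_mul_sq_add_div_mul_sq_le {s σ x y : ℝ} (hσ : 0 < σ) (hy : 0 ≤ s ^ 2 - y ^ 2) :
    -σ * x ^ 2 + 1 / σ * y ^ 2 ≤ s ^ 2 / σ - 2 * (x * √(s ^ 2 - y ^ 2)) := by
  have hcomplete : s ^ 2 / σ - 2 * (x * √(s ^ 2 - y ^ 2)) - (-σ * x ^ 2 + 1 / σ * y ^ 2) =
      (σ * x - √(s ^ 2 - y ^ 2)) ^ 2 / σ := by
    rw [sub_sq, Real.sq_sqrt hy]
    field_simp
    ring
  rw [← sub_nonneg, hcomplete]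
  positivity

theorem sum_norm_hermiteMultiC_sq_le_of_norm_imPart_le {s : ℝ} (hs : 0 < s) {z : CSpace n}
    (hz : ‖imPart z‖ ≤ s) (k : ℕ) :
    ∑ γ ∈ Finset.piAntidiag (Finset.univ : Finset (Fin n)) k, ‖hermiteMultiC γ z‖ ^ 2 ≤
      ((√(2 * k) + 2 * s) / s) ^ n * Real.exp (2 * s * √(2 * k) + 2 * s ^ 2 -
        2 * (‖rePart z‖ * √(s ^ 2 - ‖imPart z‖ ^ 2))) := by
  set lam := √(2 * (k : ℝ))
  have hlam : 0 ≤ lam := Real.sqrt_nonneg _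
  have hlam2 : 2 * (k : ℝ) = lam ^ 2 := (Real.sq_sqrt (by positivity)).symm
  -- This choice of `σ` balances the two exponential factors.
  set σ := s / (lam + 2 * s) with hσ
  have hσ0 : 0 < σ := by positivity
  have hσ1 : 1 - σ = (lam + s) / (lam + 2 * s) := by rw [hσ]; field_simp; ring
  have hσ1' : σ < 1 := sub_pos.1 (hσ1 ▸ by positivity)
  have hgrowth : 2 * k * σ / (1 - σ) ≤ s * lam := by
    rw [hσ1, hσ, hlam2, mul_div_assoc', div_div_div_cancel_right₀ (by positivity),
      div_le_iff₀ (by positivity)]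
    nlinarith [mul_nonneg hlam (sq_nonneg s)]
  have hgauss := neg_mul_sq_add_div_mul_sq_le (s := s) (x := ‖rePart z‖) (y := ‖imPart z‖) hσ0
    (sub_nonneg.2 (by gcongr))
  have hdiv : s ^ 2 / σ = s * (lam + 2 * s) := by rw [hσ]; field_simp
  calc ∑ γ ∈ Finset.piAntidiag (Finset.univ : Finset (Fin n)) k, ‖hermiteMultiC γ z‖ ^ 2
      ≤ Real.exp (2 * k * σ / (1 - σ)) * ((1 / σ) ^ n *
          Real.exp (-σ * ‖rePart z‖ ^ 2 + 1 / σ * ‖imPart z‖ ^ 2)) :=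
        sum_norm_hermiteMultiC_sq_le hσ0 hσ1' z k
    _ = ((lam + 2 * s) / s) ^ n * Real.exp (2 * k * σ / (1 - σ) +
          (-σ * ‖rePart z‖ ^ 2 + 1 / σ * ‖imPart z‖ ^ 2)) := by
        rw [mul_left_comm, ← Real.exp_add, hσ, one_div_div]
    _ ≤ _ := by
        gcongr
        linarith

theorem exists_eval_le_mul_exp (p : Polynomial ℝ) {a : ℝ} (ha : 0 < a) :
    ∃ K : ℝ, 0 ≤ K ∧ ∀ x, 0 ≤ x → p.eval x ≤ K * Real.exp (a * x) := by
  induction p using Polynomial.induction_on' with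
  | add p q hp hq =>
    obtain ⟨K, hK, hp⟩ := hp
    obtain ⟨L, hL, hq⟩ := hq
    refine ⟨K + L, add_nonneg hK hL, fun x hx => ?_⟩
    rw [Polynomial.eval_add, add_mul]
    exact add_le_add (hp x hx) (hq x hx)
  | monomial m c =>
    refine ⟨|c| * (m.factorial / a ^ m), by positivity, fun x hx => ?_⟩
    have hpow : x ^ m ≤ m.factorial / a ^ m * Real.exp (a * x) := by
      have h := Real.pow_div_factorial_le_exp (a * x) (by positivity) m
      rw [div_le_iff₀ (by positivity), mul_pow] at h
      rw [div_mul_eq_mul_div, le_div_iff₀ (by positivity)]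
      linarith
    rw [Polynomial.eval_monomial, mul_assoc]
    exact mul_le_mul (le_abs_self c) hpow (by positivity) (abs_nonneg c)

theorem exists_norm_hermiteBlock_le (hn : 0 < n) {s t : ℝ} (hs : 0 < s) (hst : s < t)
    {φ : LTwo n} (hφ : φ ∈ VOmega n t) :
    ∃ C : ℝ, 0 ≤ C ∧ ∀ (k : ℕ) (z : CSpace n), ‖imPart z‖ ≤ s →
      ‖hermiteBlock φ k z‖ ≤ C / ((k : ℝ) + 1) ^ 2 *
        Real.exp (-(‖rePart z‖ * √(s ^ 2 - ‖imPart z‖ ^ 2))) := by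
  obtain ⟨M, hM, hproj⟩ := exists_norm_hermiteProj_sq_le hn (hs.trans hst).le hφ
  obtain ⟨K, hK, hpoly⟩ := exists_eval_le_mul_exp (a := 2 * (t - s))
    ((Polynomial.C (1 / 2) * Polynomial.X ^ 2 + Polynomial.C (n : ℝ)) ^ (n + 1) *
      (Polynomial.C (1 / s) * (Polynomial.X + Polynomial.C (2 * s))) ^ n *
      (Polynomial.C (1 / 2) * Polynomial.X ^ 2 + 1) ^ 4) (by linarith)
  refine ⟨√(M * K * Real.exp (2 * s ^ 2)), Real.sqrt_nonneg _, fun k z hz => ?_⟩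
  set κ := ‖rePart z‖ * √(s ^ 2 - ‖imPart z‖ ^ 2)
  set lam := √(2 * (k : ℝ)) with hlam
  have hlam2 : (1 / 2) * lam ^ 2 = (k : ℝ) := by rw [hlam, Real.sq_sqrt (by positivity)]; ring
  have hk := hpoly lam (Real.sqrt_nonneg _)
  simp only [Polynomial.eval_mul, Polynomial.eval_pow, Polynomial.eval_add, Polynomial.eval_C,
    Polynomial.eval_X, Polynomial.eval_one, hlam2] at hk
  rw [div_mul_eq_mul_div, le_div_iff₀ (by positivity)]
  refine le_of_sq_le_sq ?_ (by positivity)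
  calc (‖hermiteBlock φ k z‖ * ((k : ℝ) + 1) ^ 2) ^ 2
      = ‖hermiteBlock φ k z‖ ^ 2 * ((k : ℝ) + 1) ^ 4 := by ring
    _ ≤ (M * ((k : ℝ) + n) ^ (n + 1) * Real.exp (-(2 * t * lam))) *
          (((lam + 2 * s) / s) ^ n * Real.exp (2 * s * lam + 2 * s ^ 2 - 2 * κ)) *
          ((k : ℝ) + 1) ^ 4 := by
        gcongr
        refine (norm_hermiteBlock_sq_le φ k z).trans ?_
        gcongr
        · exact hproj k
        · exact sum_norm_hermiteMultiC_sq_le_of_norm_imPart_le hs hz k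
    _ = M * (((k : ℝ) + n) ^ (n + 1) * (1 / s * (lam + 2 * s)) ^ n * ((k : ℝ) + 1) ^ 4) *
          (Real.exp (-(2 * t * lam)) * Real.exp (2 * s * lam + 2 * s ^ 2 - 2 * κ)) := by ring
    _ ≤ M * (K * Real.exp (2 * (t - s) * lam)) *
          (Real.exp (-(2 * t * lam)) * Real.exp (2 * s * lam + 2 * s ^ 2 - 2 * κ)) := by gcongr
    _ = M * K * (Real.exp (2 * (t - s) * lam) *
          (Real.exp (-(2 * t * lam)) * Real.exp (2 * s * lam + 2 * s ^ 2 - 2 * κ))) := by ring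
    _ = M * K * (Real.exp (2 * s ^ 2) * Real.exp (((2 : ℕ) : ℝ) * -κ)) := by
        rw [← Real.exp_add, ← Real.exp_add, ← Real.exp_add]
        congr 2
        push_cast
        ring
    _ = (√(M * K * Real.exp (2 * s ^ 2)) * Real.exp (-κ)) ^ 2 := by
        rw [mul_pow, Real.sq_sqrt (by positivity), ← Real.exp_nat_mul]
        ring

theorem continuous_imPart : Continuous (imPart (n := n)) := by
  unfold imPart
  fun_prop

theorem imPart_toComplex (x : RSpace n) : imPart (toComplex x) = 0 := by
  ext
  simp [imPart, toComplex]

theorem isOpen_tube (t : ℝ) : IsOpen (tube n t) :=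
  isOpen_lt continuous_imPart.norm continuous_const

theorem toComplex_mem_tube {t : ℝ} (ht : 0 < t) (x : RSpace n) : toComplex x ∈ tube n t := by
  change ‖imPart (toComplex x)‖ < t
  rwa [imPart_toComplex, norm_zero]

theorem exists_lt_mem_tube {t : ℝ} {z : CSpace n} (hz : z ∈ tube n t) :
    ∃ s, 0 < s ∧ s < t ∧ z ∈ tube n s := by
  obtain ⟨s, hs, hst⟩ := exists_between (show ‖imPart z‖ < t from hz)
  exact ⟨s, (norm_nonneg _).trans_lt hs, hst, hs⟩

theorem coeFn_hermiteProj (φ : LTwo n) (k : ℕ) :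
    (hermiteProj k φ : RSpace n → ℂ) =ᵐ[volume] fun x => hermiteBlock φ k (toComplex x) := by
  have hterm (γ : Fin n → ℕ) : ∀ᵐ x, (inner ℂ (hermiteVec γ) φ • hermiteVec γ : LTwo n) x =
      inner ℂ (hermiteVec γ) φ * hermiteMultiC γ (toComplex x) := by
    filter_upwards [Lp.coeFn_smul (inner ℂ (hermiteVec γ) φ) (hermiteVec γ),
      (memLp_hermiteMulti γ).coeFn_toLp] with x hsmul hvec
    rw [hsmul, Pi.smul_apply, hermiteVec, hvec, hermiteMultiC_toComplex, smul_eq_mul]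
  rw [hermiteProj_eq_sum]
  filter_upwards [Lp.coeFn_fun_finsetSum (Finset.piAntidiag Finset.univ k) fun γ =>
    inner ℂ (hermiteVec γ) φ • hermiteVec γ, ae_all_iff.2 hterm] with x hsum hx
  rw [hsum]
  exact Finset.sum_congr rfl fun γ _ => hx γ

theorem tendsto_sum_hermiteProj (φ : LTwo n) :
    Tendsto (fun K => ∑ k ∈ Finset.range K, hermiteProj k φ) atTop (𝓝 φ) := by
  have hexhaust : Tendsto (fun K : ℕ => (Finset.range K).biUnion
      fun k => Finset.piAntidiag (Finset.univ : Finset (Fin n)) k) atTop atTop := by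
    refine tendsto_atTop_finset_of_monotone (fun K L hKL => ?_) fun γ => ⟨∑ j, γ j + 1, ?_⟩
    · exact Finset.biUnion_subset_biUnion_of_subset_left _ (Finset.range_mono hKL)
    · exact Finset.mem_biUnion.2 ⟨∑ j, γ j, by simp, by simp⟩
  refine (Tendsto.comp (hasSum_hermiteVec φ) hexhaust).congr fun K => ?_
  rw [Function.comp_apply, Finset.sum_biUnion]
  · exact Finset.sum_congr rfl fun k _ => (hermiteProj_eq_sum k φ).symm
  · intro k _ l _ hkl
    refine Finset.disjoint_left.2 fun γ hk hl => hkl ?_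
    rw [← (Finset.mem_piAntidiag.1 hk).1, (Finset.mem_piAntidiag.1 hl).1]

theorem exists_seq_tendsto_hermiteBlock (φ : LTwo n) :
    ∃ ns : ℕ → ℕ, StrictMono ns ∧ ∀ᵐ x, Tendsto
      (fun i => ∑ k ∈ Finset.range (ns i), hermiteBlock φ k (toComplex x)) atTop (𝓝 (φ x)) := by
  obtain ⟨ns, hns, hlim⟩ :=
    (tendstoInMeasure_of_tendsto_Lp (tendsto_sum_hermiteProj φ)).exists_seq_tendsto_ae
  refine ⟨ns, hns, ?_⟩
  filter_upwards [hlim, ae_all_iff.2 (coeFn_hermiteProj φ),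
    ae_all_iff.2 fun i => Lp.coeFn_fun_finsetSum (Finset.range (ns i)) fun k => hermiteProj k φ]
    with x hx hblock hsum
  refine hx.congr fun i => ?_
  rw [hsum]
  exact Finset.sum_congr rfl fun k _ => hblock k

theorem ae_eq_tsum_hermiteBlock (φ : LTwo n)
    (hsum : ∀ x, Summable fun k => hermiteBlock φ k (toComplex x)) :
    ∀ᵐ x, φ x = ∑' k, hermiteBlock φ k (toComplex x) := by
  obtain ⟨ns, hns, hlim⟩ := exists_seq_tendsto_hermiteBlock φ
  filter_upwards [hlim] with x hx
  exact tendsto_nhds_unique hx ((hsum x).hasSum.tendsto_sum_nat.comp hns.tendsto_atTop)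

theorem summable_div_add_one_sq (C : ℝ) : Summable fun k : ℕ => C / ((k : ℝ) + 1) ^ 2 := by
  have h := (summable_nat_add_iff 1).2 (Real.summable_one_div_nat_pow.2 one_lt_two)
  refine (h.mul_left C).congr fun k => ?_
  push_cast
  ring

theorem differentiableOn_tsum_hermiteBlock {φ : LTwo n} {t : ℝ}
    (hbound : ∀ s, 0 < s → s < t → ∃ u : ℕ → ℝ, Summable u ∧
      ∀ k, ∀ z ∈ tube n s, ‖hermiteBlock φ k z‖ ≤ u k) :
    DifferentiableOn ℂ (fun z => ∑' k, hermiteBlock φ k z) (tube n t) := by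
  refine (analyticOnNhd_of_lineDifferentiableAt_of_locally_bounded (isOpen_tube t)
    (fun z hz v => ?_) fun z hz => ?_).differentiableOn
  all_goals
    obtain ⟨s, hs, hst, hzs⟩ := exists_lt_mem_tube hz
    obtain ⟨u, hu, hle⟩ := hbound s hs hst
  · have hline : IsOpen {l : ℂ | z + l • v ∈ tube n s} := (isOpen_tube s).preimage (by fun_prop)
    refine (Complex.differentiableOn_tsum_of_summable_norm hu
      (fun k => ((differentiable_hermiteBlock φ k).comp (by fun_prop)).differentiableOn) hline
      fun k l hl => hle k _ hl).differentiableAt (hline.mem_nhds ?_)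
    simpa using hzs
  · refine ⟨∑' k, u k, ?_⟩
    filter_upwards [(isOpen_tube s).mem_nhds hzs] with w hw
    exact tsum_of_norm_bounded hu.hasSum fun k => hle k w hw

theorem exists_holomorphicExtension_of_mem_VOmega (hn : 0 < n) {t : ℝ} (ht : 0 < t) {φ : LTwo n}
    (hφ : φ ∈ VOmega n t) :
    ∃ F : CSpace n → ℂ, IsHolomorphicExtension φ t F ∧
      ∀ s : ℝ, 0 < s → s < t → HasTubeBound s F := by
  have hbound (s : ℝ) (hs : 0 < s) (hst : s < t) : ∃ u : ℕ → ℝ, Summable u ∧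
      ∀ k, ∀ z ∈ tube n s, ‖hermiteBlock φ k z‖ ≤ u k := by
    obtain ⟨C, hC, hle⟩ := exists_norm_hermiteBlock_le hn hs hst hφ
    refine ⟨_, summable_div_add_one_sq C, fun k z hz => (hle k z (le_of_lt hz)).trans ?_⟩
    exact mul_le_of_le_one_right (by positivity)
      (Real.exp_le_one_iff.2 (neg_nonpos.2 (by positivity)))
  refine ⟨fun z => ∑' k, hermiteBlock φ k z,
    ⟨differentiableOn_tsum_hermiteBlock hbound, ae_eq_tsum_hermiteBlock φ fun x => ?_⟩,
    fun s hs hst => ?_⟩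
  · obtain ⟨u, hu, hle⟩ := hbound (t / 2) (by linarith) (by linarith)
    exact .of_norm_bounded hu fun k => hle k _ (toComplex_mem_tube (by linarith) x)
  · obtain ⟨C, -, hle⟩ := exists_norm_hermiteBlock_le hn hs hst hφ
    refine ⟨∑' k : ℕ, C / ((k : ℝ) + 1) ^ 2, fun z hz => ?_⟩
    rw [← tsum_mul_right]
    exact tsum_of_norm_bounded ((summable_div_add_one_sq C).mul_right _).hasSum
      fun k => hle k z (le_of_lt hz)

/-! ### Shift of contour -/

section ExponentialDecay

variable {E : Type*} [NormedAddCommGroup E] [NormedSpace ℝ E] [FiniteDimensional ℝ E]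
  [MeasurableSpace E] [BorelSpace E] (μ : Measure E) [μ.IsAddHaarMeasure] {c : ℝ}

theorem integrable_exp_neg_mul_norm (hc : 0 < c) :
    Integrable (fun x : E => Real.exp (-(c * ‖x‖))) μ := by
  set m := Module.finrank ℝ E + 1
  have hpow : Integrable (fun x : E => (1 + ‖x‖) ^ (-(m : ℝ))) μ :=
    integrable_one_add_norm (by simp [m])
  refine (hpow.const_mul (m.factorial / c ^ m * Real.exp c)).mono' (by fun_prop)
    (Eventually.of_forall fun x => ?_)
  have hx : (0 : ℝ) < 1 + ‖x‖ := by positivity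
  have hexp : (c * (1 + ‖x‖)) ^ m / m.factorial ≤ Real.exp c * Real.exp (c * ‖x‖) := by
    rw [← Real.exp_add]
    exact (Real.pow_div_factorial_le_exp _ (by positivity) m).trans_eq (by ring_nf)
  rw [Real.norm_of_nonneg (Real.exp_nonneg _), Real.rpow_neg hx.le, Real.rpow_natCast, Real.exp_neg,
    inv_le_iff_one_le_mul₀ (Real.exp_pos _)]
  rw [div_le_iff₀ (by positivity), mul_pow] at hexp
  field_simp
  rw [mul_comm ‖x‖]
  linarith

theorem memLp_exp_neg_mul_norm (hc : 0 < c) :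
    MemLp (fun x : E => Real.exp (-(c * ‖x‖))) 2 μ := by
  rw [memLp_two_iff_integrable_sq_norm (by fun_prop)]
  refine (integrable_exp_neg_mul_norm μ (mul_pos two_pos hc)).congr
    (Eventually.of_forall fun x => ?_)
  simp only [Real.norm_of_nonneg (Real.exp_nonneg _), ← Real.exp_nat_mul]
  ring_nf

end ExponentialDecay

theorem rePart_add (z w : CSpace n) : rePart (z + w) = rePart z + rePart w := by
  ext j
  simp [rePart]

theorem imPart_add (z w : CSpace n) : imPart (z + w) = imPart z + imPart w := by
  ext j
  simp [imPart]

theorem imPart_smul (r : ℝ) (z : CSpace n) : imPart (r • z) = r • imPart z := by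
  ext j
  simp [imPart]

theorem rePart_toComplex (x : RSpace n) : rePart (toComplex x) = x := by
  ext j
  simp [rePart, toComplex]

theorem toComplex_add (x y : RSpace n) : toComplex (x + y) = toComplex x + toComplex y := by
  ext j
  simp [toComplex]

theorem toComplex_smul (r : ℝ) (x : RSpace n) : toComplex (r • x) = (r : ℂ) • toComplex x := by
  ext j
  simp [toComplex]

theorem continuous_toComplex : Continuous (toComplex (n := n)) := by
  unfold toComplex
  fun_prop

theorem toComplex_rePart_add_I_smul (z : CSpace n) :
    toComplex (rePart z) + Complex.I • toComplex (imPart z) = z := by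
  ext j
  simp [toComplex, rePart, imPart, mul_comm Complex.I, Complex.re_add_im]

theorem norm_sq_eq_rePart_add_imPart (z : CSpace n) :
    ‖z‖ ^ 2 = ‖rePart z‖ ^ 2 + ‖imPart z‖ ^ 2 := by
  rw [norm_rePart_sq, norm_imPart_sq, EuclideanSpace.norm_sq_eq, ← Finset.sum_add_distrib]
  refine Finset.sum_congr rfl fun j _ => ?_
  rw [Complex.sq_norm, Complex.normSq_apply, sq, sq]

theorem norm_rePart_le (z : CSpace n) : ‖rePart z‖ ≤ ‖z‖ := by
  refine le_of_sq_le_sq ?_ (norm_nonneg _)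
  linarith [norm_sq_eq_rePart_add_imPart z, sq_nonneg ‖imPart z‖]

theorem norm_imPart_le (z : CSpace n) : ‖imPart z‖ ≤ ‖z‖ := by
  refine le_of_sq_le_sq ?_ (norm_nonneg _)
  linarith [norm_sq_eq_rePart_add_imPart z, sq_nonneg ‖rePart z‖]

theorem norm_toComplex (x : RSpace n) : ‖toComplex x‖ = ‖x‖ := by
  rw [← sq_eq_sq₀ (norm_nonneg _) (norm_nonneg _), norm_sq_eq_rePart_add_imPart, rePart_toComplex,
    imPart_toComplex]
  simp

theorem norm_sub_norm_le_norm_add_rePart (x : RSpace n) (w : CSpace n) :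
    ‖x‖ - ‖w‖ ≤ ‖x + rePart w‖ := by
  have hx : ‖x‖ ≤ ‖x + rePart w‖ + ‖rePart w‖ := by
    simpa only [add_sub_cancel_right] using norm_sub_le (x + rePart w) (rePart w)
  linarith [norm_rePart_le w]

theorem norm_sum_mul_le (z w : CSpace n) : ‖∑ j, z j * w j‖ ≤ ‖z‖ * ‖w‖ := by
  rw [EuclideanSpace.norm_eq, EuclideanSpace.norm_eq]
  refine (norm_sum_le _ _).trans ?_
  simp only [norm_mul]
  exact Real.sum_mul_le_sqrt_mul_sqrt _ _ _

theorem tube_mono {s t : ℝ} (hst : s ≤ t) : tube n s ⊆ tube n t :=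
  fun _ hz => lt_of_lt_of_le hz hst

theorem convex_tube (t : ℝ) : Convex ℝ (tube n t) := by
  have h : tube n t = imPart ⁻¹' ball 0 t := by
    ext z
    exact mem_ball_zero_iff.symm
  exact h ▸ (convex_ball 0 t).is_linear_preimage ⟨imPart_add, imPart_smul⟩

theorem toComplex_add_mem_tube_iff {t : ℝ} {x : RSpace n} {w : CSpace n} :
    toComplex x + w ∈ tube n t ↔ w ∈ tube n t := by
  change ‖imPart _‖ < t ↔ ‖imPart w‖ < t
  rw [imPart_add, imPart_toComplex, zero_add]

theorem I_smul_toComplex_imPart_mem_tube_iff {t : ℝ} {w : CSpace n} :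
    Complex.I • toComplex (imPart w) ∈ tube n t ↔ w ∈ tube n t := by
  rw [← toComplex_add_mem_tube_iff (x := rePart w), toComplex_rePart_add_I_smul]

theorem frequently_ofReal_nhdsNE {p : ℂ → Prop} (h : ∀ r : ℝ, p r) :
    ∃ᶠ z in 𝓝[≠] (0 : ℂ), p z := by
  have hofReal : Tendsto (fun r : ℝ => (r : ℂ)) (𝓝[≠] 0) (𝓝[≠] 0) := by
    refine tendsto_nhdsWithin_iff.2 ⟨?_, ?_⟩
    · exact (Complex.continuous_ofReal.tendsto' 0 0 (by simp)).mono_left nhdsWithin_le_nhds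
    · filter_upwards [self_mem_nhdsWithin] with r hr
      simpa using hr
  exact hofReal.frequently (Eventually.of_forall h).frequently

section ContourShift

variable {t : ℝ} {Ψ : CSpace n → ℂ}

theorem differentiableOn_integral_toComplex_add (hΨ : DifferentiableOn ℂ Ψ (tube n t))
    (hdec : ∀ R : ℝ, ∃ g : RSpace n → ℝ, Integrable g ∧
      ∀ w ∈ tube n t, ‖w‖ ≤ R → ∀ x, ‖Ψ (toComplex x + w)‖ ≤ g x) :
    DifferentiableOn ℂ (fun w => ∫ x, Ψ (toComplex x + w)) (tube n t) := by
  refine (analyticOnNhd_integral_of_dominated (isOpen_tube t) (fun w hw => ?_) (fun x => ?_)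
    fun w hw => ?_).differentiableOn
  · refine Continuous.aestronglyMeasurable (hΨ.continuousOn.comp_continuous
      (continuous_toComplex.add continuous_const) fun x => toComplex_add_mem_tube_iff.2 hw)
  · exact hΨ.comp (by fun_prop) fun w hw => toComplex_add_mem_tube_iff.2 hw
  · obtain ⟨g, hg, hgb⟩ := hdec (‖w‖ + 1)
    refine ⟨g, hg, ?_⟩
    filter_upwards [(isOpen_tube t).mem_nhds hw, ball_mem_nhds w one_pos] with v hv hvw
    refine hgb v hv ?_
    linarith [norm_sub_norm_le v w, mem_ball_iff_norm.1 hvw]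

theorem integral_toComplex_add (hΨ : DifferentiableOn ℂ Ψ (tube n t))
    (hdec : ∀ R : ℝ, ∃ g : RSpace n → ℝ, Integrable g ∧
      ∀ w ∈ tube n t, ‖w‖ ≤ R → ∀ x, ‖Ψ (toComplex x + w)‖ ≤ g x)
    {w : CSpace n} (hw : w ∈ tube n t) :
    ∫ x, Ψ (toComplex x + w) = ∫ x, Ψ (toComplex x) := by
  have htrans : ∀ (y : RSpace n) (v : CSpace n),
      ∫ x, Ψ (toComplex x + (toComplex y + v)) = ∫ x, Ψ (toComplex x + v) := fun y v => by
    rw [← integral_add_right_eq_self (fun x => Ψ (toComplex x + v)) y]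
    simp only [toComplex_add, add_assoc]
  set line : ℂ → CSpace n := fun l => l • toComplex (imPart w)
  have hline : Differentiable ℂ line := by fun_prop
  have hopen : IsOpen (line ⁻¹' tube n t) := (isOpen_tube t).preimage hline.continuous
  have hconv : Convex ℝ (line ⁻¹' tube n t) := (convex_tube t).is_linear_preimage
    ⟨fun a b => add_smul a b _, fun r a => smul_assoc r a _⟩
  have hhol : DifferentiableOn ℂ (fun l => ∫ x, Ψ (toComplex x + line l)) (line ⁻¹' tube n t) :=
    (differentiableOn_integral_toComplex_add hΨ hdec).comp hline.differentiableOn fun _ hl => hl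
  have hreal : ∀ r : ℝ, ∫ x, Ψ (toComplex x + line r) = ∫ x, Ψ (toComplex x) := fun r => by
    simpa only [toComplex_smul, add_zero] using htrans (r • imPart w) 0
  have hzero : (0 : ℂ) ∈ line ⁻¹' tube n t := by
    have ht : 0 < t := (norm_nonneg _).trans_lt hw
    simpa only [line, mem_preimage, toComplex_smul, Complex.ofReal_zero] using
      toComplex_mem_tube ht ((0 : ℝ) • imPart w)
  have hI : Complex.I ∈ line ⁻¹' tube n t := I_smul_toComplex_imPart_mem_tube_iff.2 hw
  calc ∫ x, Ψ (toComplex x + w)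
      = ∫ x, Ψ (toComplex x + (toComplex (rePart w) + line Complex.I)) := by
        simp only [line, toComplex_rePart_add_I_smul]
    _ = ∫ x, Ψ (toComplex x + line Complex.I) := htrans _ _
    _ = ∫ x, Ψ (toComplex x) :=
        (hhol.analyticOnNhd hopen).eqOn_of_preconnected_of_frequently_eq
          analyticOnNhd_const hconv.isPreconnected hzero (frequently_ofReal_nhdsNE hreal) hI

end ContourShift

/-- The function `π(X, U, 0) F` restricted to `ℝⁿ`, where the Schrödinger representation is
continued to complex `X` and `U` and `F` is a function on `ℂⁿ`. -/
noncomputable def schrodingerFunC (X U : CSpace n) (F : CSpace n → ℂ) (ξ : RSpace n) : ℂ :=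
  Complex.exp (Complex.I * ((∑ j, X j * ξ j) + (∑ j, X j * U j) / 2)) * F (toComplex ξ + U)

theorem ofReal_inner (x y : RSpace n) :
    ((inner ℝ x y : ℝ) : ℂ) = ∑ j, toComplex x j * toComplex y j := by
  rw [PiLp.inner_apply, Complex.ofReal_sum]
  refine Finset.sum_congr rfl fun j _ => ?_
  simp [toComplex, mul_comm]

theorem schrodingerFunC_toComplex (x u : RSpace n) (F : CSpace n → ℂ) :
    schrodingerFunC (toComplex x) (toComplex u) F = schrodingerFun x u 0 (F ∘ toComplex) := by
  ext ξ
  rw [schrodingerFunC, schrodingerFun, Function.comp_apply, toComplex_add, Complex.ofReal_zero,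
    mul_zero, Complex.exp_zero, one_mul, Complex.ofReal_add, Complex.ofReal_mul, ofReal_inner,
    ofReal_inner, Complex.ofReal_div, Complex.ofReal_one, Complex.ofReal_ofNat, one_div_mul_eq_div]
  rfl

theorem creationFun_eq_schrodingerFunC (ζ : CSpace n) (α : Fin n → ℕ) :
    creationFun ζ α = schrodingerFunC (-Complex.I • ζ) (-ζ) (hermiteMultiC α) := by
  ext x
  rw [schrodingerFunC, creationFun, sub_eq_add_neg (toComplex x)]
  congr 2
  simp only [PiLp.smul_apply, PiLp.neg_apply, smul_eq_mul, mul_assoc, ← Finset.mul_sum, mul_neg,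
    Finset.sum_neg_distrib, ← sq]
  linear_combination ((∑ j, ζ j * (x j : ℂ)) - (∑ j, ζ j ^ 2) / 2) * Complex.I_sq

theorem integral_schrodingerFun_mul (x u : RSpace n) (f g : RSpace n → ℂ) :
    ∫ ξ, schrodingerFun x u 0 f ξ * g ξ = ∫ ξ, f ξ * schrodingerFun x (-u) 0 g ξ := by
  rw [← integral_add_right_eq_self (fun ξ => f ξ * schrodingerFun x (-u) 0 g ξ) u]
  refine integral_congr_ae (Eventually.of_forall fun ξ => ?_)
  simp only [schrodingerFun, inner_add_right, inner_neg_right, add_neg_cancel_right]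
  rw [show inner ℝ x ξ + inner ℝ x u + 1 / 2 * -inner ℝ x u =
    inner ℝ x ξ + 1 / 2 * inner ℝ x u by ring]
  ring

theorem inner_hermiteVec_schrodinger (x u : RSpace n) (φ : LTwo n) (α : Fin n → ℕ) :
    inner ℂ (hermiteVec α) (schrodinger x u 0 φ) = ∫ ξ, (φ : RSpace n → ℂ) ξ *
      schrodingerFunC (toComplex x) (-toComplex u) (hermiteMultiC α) ξ := by
  have hneg : -toComplex u = toComplex (-u) := by
    ext j
    simp [toComplex]
  have hmulti : hermiteMultiC α ∘ toComplex = hermiteMulti α :=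
    funext fun ξ => hermiteMultiC_toComplex α ξ
  rw [schrodinger, inner_hermiteVec_toLp, integral_schrodingerFun_mul, hneg,
    schrodingerFunC_toComplex, hmulti]

theorem exists_norm_hermiteMultiC_le (α : Fin n → ℕ) {c : ℝ} (hc : 0 ≤ c) (R : ℝ) :
    ∃ K : ℝ, 0 ≤ K ∧ ∀ (x : RSpace n) (w : CSpace n), ‖w‖ ≤ R →
      ‖hermiteMultiC α (toComplex x + w)‖ ≤ K * Real.exp (-(c * ‖x‖)) := by
  obtain ⟨A, hA, hle⟩ : ∃ A, 0 ≤ A ∧ ∀ z : CSpace n, ‖hermiteMultiC α z‖ ^ 2 ≤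
      A * Real.exp (-(1 / 2) * ‖rePart z‖ ^ 2 + 2 * ‖imPart z‖ ^ 2) := by
    refine ⟨Real.exp (2 * (∑ j, α j : ℕ) * (1 / 2) / (1 - 1 / 2)) * 2 ^ n, by positivity,
      fun z => ?_⟩
    refine (Finset.single_le_sum (fun γ _ => sq_nonneg ‖hermiteMultiC γ z‖)
      (Finset.mem_piAntidiag.2 ⟨rfl, fun j _ => Finset.mem_univ j⟩)).trans ?_
    refine (sum_norm_hermiteMultiC_sq_le one_half_pos one_half_lt_one z _).trans_eq ?_
    rw [← mul_assoc, one_div_one_div]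
  refine ⟨√(A * Real.exp (2 * c * R + 2 * c ^ 2 + 2 * R ^ 2)), Real.sqrt_nonneg _,
    fun x w hw => le_of_sq_le_sq ((hle _).trans ?_) (by positivity)⟩
  rw [mul_pow, Real.sq_sqrt (by positivity), ← Real.exp_nat_mul, mul_assoc A, ← Real.exp_add,
    rePart_add, imPart_add, rePart_toComplex, imPart_toComplex, zero_add]
  refine mul_le_mul_of_nonneg_left (Real.exp_le_exp.2 ?_) hA
  have him : ‖imPart w‖ ^ 2 ≤ R ^ 2 :=
    pow_le_pow_left₀ (norm_nonneg _) ((norm_imPart_le w).trans hw) 2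
  have hre : c * (‖x‖ - R) ≤ c * ‖x + rePart w‖ := by
    refine mul_le_mul_of_nonneg_left ?_ hc
    linarith [norm_sub_norm_le_norm_add_rePart x w]
  push_cast
  linarith [sq_nonneg (‖x + rePart w‖ - 2 * c)]

theorem exists_norm_schrodingerFunC_hermiteMultiC_le (α : Fin n → ℕ) {R : ℝ} (hR : 0 ≤ R) :
    ∃ K : ℝ, 0 ≤ K ∧ ∀ X U : CSpace n, ‖X‖ ≤ R → ‖U‖ ≤ R → ∀ x,
      ‖schrodingerFunC X U (hermiteMultiC α) x‖ ≤ K * Real.exp (-(1 * ‖x‖)) := by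
  obtain ⟨K, hK, hle⟩ := exists_norm_hermiteMultiC_le α (c := R + 1) (by positivity) R
  refine ⟨Real.exp (R * R) * K, by positivity, fun X U hX hU x => ?_⟩
  have hexp : ‖Complex.exp (Complex.I * ((∑ j, X j * x j) + (∑ j, X j * U j) / 2))‖ ≤
      Real.exp (R * ‖x‖ + R * R) := by
    refine (Complex.norm_exp_le_exp_norm _).trans (Real.exp_le_exp.2 ?_)
    rw [norm_mul, Complex.norm_I, one_mul]
    refine (norm_add_le _ _).trans (add_le_add ?_ ?_)
    · refine (norm_sum_mul_le X (toComplex x)).trans ?_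
      rw [norm_toComplex]
      exact mul_le_mul_of_nonneg_right hX (norm_nonneg x)
    · rw [norm_div]
      refine (div_le_self (norm_nonneg _) (by norm_num)).trans ((norm_sum_mul_le X U).trans ?_)
      exact mul_le_mul hX hU (norm_nonneg U) hR
  rw [schrodingerFunC, norm_mul]
  refine (mul_le_mul hexp (hle x U hU) (norm_nonneg _) (Real.exp_nonneg _)).trans_eq ?_
  rw [mul_left_comm, ← Real.exp_add, mul_comm (Real.exp (R * R)), mul_assoc, ← Real.exp_add]
  ring_nf

theorem norm_sum_mul_inner_hermiteVec_le (ψ : LTwo n) (S : Finset (Fin n → ℕ))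
    (d : (Fin n → ℕ) → ℂ) :
    ‖∑ α ∈ S, d α * inner ℂ (hermiteVec α) ψ‖ ≤ ‖ψ‖ * √(∑ α ∈ S, ‖d α‖ ^ 2) := by
  refine (norm_sum_le _ _).trans ?_
  simp only [norm_mul]
  refine (Real.sum_mul_le_sqrt_mul_sqrt _ _ _).trans ?_
  rw [mul_comm]
  exact mul_le_mul_of_nonneg_right
    ((Real.sqrt_le_left (norm_nonneg _)).2 (orthonormal_hermiteVec.sum_inner_products_le ψ))
    (Real.sqrt_nonneg _)

section ShiftedPairing

variable {t C : ℝ} {F : CSpace n → ℂ}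

theorem exists_norm_mul_hermiteMultiC_le (hC : ∀ z ∈ tube n t, ‖F z‖ ≤ C) (hC0 : 0 ≤ C)
    (ζ : CSpace n) (α : Fin n → ℕ) (R : ℝ) :
    ∃ g : RSpace n → ℝ, Integrable g ∧ ∀ w ∈ tube n t, ‖w‖ ≤ R → ∀ x,
      ‖F (toComplex x + w) * (Complex.exp ((∑ j, ζ j * (toComplex x + w) j) -
        (∑ j, ζ j ^ 2) / 2) * hermiteMultiC α (toComplex x + w - ζ))‖ ≤ g x := by
  obtain ⟨K, -, hle⟩ := exists_norm_schrodingerFunC_hermiteMultiC_le α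
    (R := |R| + ‖ζ‖) (by positivity)
  refine ⟨fun x => C * (Real.exp (‖ζ‖ * |R|) * K) * Real.exp (-(1 * ‖x‖)),
    (integrable_exp_neg_mul_norm volume one_pos).const_mul _, fun w hw hwR x => ?_⟩
  have hw' : ‖w‖ ≤ |R| := hwR.trans (le_abs_self R)
  have hsplit : Complex.exp ((∑ j, ζ j * (toComplex x + w) j) - (∑ j, ζ j ^ 2) / 2) *
      hermiteMultiC α (toComplex x + w - ζ) = Complex.exp ((∑ j, ζ j * w j) / 2) *
        schrodingerFunC (-Complex.I • ζ) (w - ζ) (hermiteMultiC α) x := by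
    rw [schrodingerFunC, ← mul_assoc, ← Complex.exp_add, add_sub_assoc]
    congr 2
    simp only [PiLp.smul_apply, PiLp.add_apply, PiLp.sub_apply, smul_eq_mul, mul_assoc,
      ← Finset.mul_sum, mul_add, mul_sub, Finset.sum_add_distrib, Finset.sum_sub_distrib, ← sq]
    change (∑ j, ζ j * (x j : ℂ)) + _ - _ = _
    linear_combination ((∑ j, ζ j * (x j : ℂ)) + (∑ j, ζ j * w j) / 2 -
      (∑ j, ζ j ^ 2) / 2) * Complex.I_sq
  have hexp : ‖Complex.exp ((∑ j, ζ j * w j) / 2)‖ ≤ Real.exp (‖ζ‖ * |R|) := by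
    refine (Complex.norm_exp_le_exp_norm _).trans (Real.exp_le_exp.2 ?_)
    rw [norm_div]
    exact (div_le_self (norm_nonneg _) (by norm_num)).trans ((norm_sum_mul_le ζ w).trans
      (mul_le_mul_of_nonneg_left hw' (norm_nonneg ζ)))
  have hherm : ‖schrodingerFunC (-Complex.I • ζ) (w - ζ) (hermiteMultiC α) x‖ ≤
      K * Real.exp (-(1 * ‖x‖)) := by
    refine hle _ _ ?_ ((norm_sub_le _ _).trans (by linarith)) x
    rw [norm_smul, norm_neg, Complex.norm_I, one_mul]
    exact le_add_of_nonneg_left (abs_nonneg R)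
  rw [hsplit, norm_mul, norm_mul]
  refine (mul_le_mul (hC _ (toComplex_add_mem_tube_iff.2 hw))
    (mul_le_mul hexp hherm (norm_nonneg _) (Real.exp_nonneg _)) (by positivity) hC0).trans_eq ?_
  simp only [mul_assoc]

theorem integral_mul_creationFun {φ : LTwo n} (hF : IsHolomorphicExtension φ t F)
    (hC : ∀ z ∈ tube n t, ‖F z‖ ≤ C) (hC0 : 0 ≤ C) {ζ : CSpace n} (hζ : ζ ∈ tube n t)
    (α : Fin n → ℕ) :
    ∫ x, (φ : RSpace n → ℂ) x * creationFun ζ α x =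
      ∫ x, schrodingerFunC (-Complex.I • ζ) ζ F x * hermiteMulti α x := by
  set Ψ : CSpace n → ℂ := fun z => F z *
    (Complex.exp ((∑ j, ζ j * z j) - (∑ j, ζ j ^ 2) / 2) * hermiteMultiC α (z - ζ)) with hΨ
  have hhol : DifferentiableOn ℂ Ψ (tube n t) := by
    have h := differentiable_hermiteMultiC α
    exact hF.1.mul (Differentiable.mul (by fun_prop) (h.comp (by fun_prop))).differentiableOn
  have hshift : ∀ x, Ψ (toComplex x + ζ) =
      schrodingerFunC (-Complex.I • ζ) ζ F x * hermiteMulti α x := fun x => by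
    simp only [hΨ, schrodingerFunC]
    rw [add_sub_cancel_right, hermiteMultiC_toComplex, ← mul_assoc, mul_comm (F _)]
    congr 3
    simp only [PiLp.smul_apply, PiLp.add_apply, smul_eq_mul, mul_assoc,
      ← Finset.mul_sum, mul_add, Finset.sum_add_distrib, ← sq]
    change (∑ j, ζ j * (x j : ℂ)) + _ - _ = _
    linear_combination ((∑ j, ζ j * (x j : ℂ)) + (∑ j, ζ j ^ 2) / 2) * Complex.I_sq
  calc ∫ x, (φ : RSpace n → ℂ) x * creationFun ζ α x = ∫ x, Ψ (toComplex x) := by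
        refine integral_congr_ae ?_
        filter_upwards [hF.2] with x hx
        rw [hx, creationFun]
        rfl
    _ = ∫ x, Ψ (toComplex x + ζ) := (integral_toComplex_add hhol
        (exists_norm_mul_hermiteMultiC_le hC hC0 ζ α) hζ).symm
    _ = _ := by simp only [hshift]

end ShiftedPairing

section TubeBound

variable {s t C : ℝ} {φ : LTwo n} {F : CSpace n → ℂ}

theorem HasTubeBound.exists_nonneg (hb : HasTubeBound t F) :
    ∃ C : ℝ, 0 ≤ C ∧ ∀ z ∈ tube n t,
      ‖F z‖ ≤ C * Real.exp (-(‖rePart z‖ * √(t ^ 2 - ‖imPart z‖ ^ 2))) := by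
  obtain ⟨C, hC⟩ := hb
  exact ⟨|C|, abs_nonneg C, fun z hz => (hC z hz).trans
    (mul_le_mul_of_nonneg_right (le_abs_self C) (Real.exp_nonneg _))⟩

theorem im_sum_mul (z w : CSpace n) :
    (∑ j, z j * w j).im = inner ℝ (rePart z) (imPart w) + inner ℝ (imPart z) (rePart w) := by
  rw [Complex.im_sum, PiLp.inner_apply, PiLp.inner_apply, ← Finset.sum_add_distrib]
  refine Finset.sum_congr rfl fun j _ => ?_
  simp [rePart, imPart, mul_comm]

theorem norm_schrodingerFunC_le (hC0 : 0 ≤ C)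
    (hC : ∀ z ∈ tube n t, ‖F z‖ ≤ C * Real.exp (-(‖rePart z‖ * √(t ^ 2 - ‖imPart z‖ ^ 2))))
    (X : CSpace n) {U : CSpace n} (hU : U ∈ tube n t) (ξ : RSpace n) :
    ‖schrodingerFunC X U F ξ‖ ≤
      C * Real.exp ((inner ℝ (imPart X) (rePart U) - inner ℝ (rePart X) (imPart U)) / 2 -
        (√(t ^ 2 - ‖imPart U‖ ^ 2) - ‖imPart X‖) * ‖ξ + rePart U‖) := by
  have hexp : (Complex.I * ((∑ j, X j * (ξ j : ℂ)) + (∑ j, X j * U j) / 2)).re =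
      (inner ℝ (imPart X) (rePart U) - inner ℝ (rePart X) (imPart U)) / 2 +
        inner ℝ (-imPart X) (ξ + rePart U) := by
    have hξ : (∑ j, X j * (ξ j : ℂ)).im = inner ℝ (imPart X) ξ :=
      (im_sum_mul X (toComplex ξ)).trans
        (by rw [imPart_toComplex, rePart_toComplex, inner_zero_right, zero_add])
    rw [Complex.I_mul_re, Complex.add_im, Complex.div_ofNat_im, hξ, im_sum_mul, inner_neg_left,
      inner_add_right]
    ring
  have hF := hC _ (toComplex_add_mem_tube_iff (x := ξ).2 hU)
  rw [rePart_add, imPart_add, rePart_toComplex, imPart_toComplex, zero_add] at hF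
  rw [schrodingerFunC, norm_mul, Complex.norm_exp, hexp, mul_comm]
  refine (mul_le_mul_of_nonneg_right hF (Real.exp_nonneg _)).trans ?_
  rw [mul_assoc, ← Real.exp_add]
  refine mul_le_mul_of_nonneg_left (Real.exp_le_exp.2 ?_) hC0
  have hcs := real_inner_le_norm (-imPart X) (ξ + rePart U)
  rw [norm_neg] at hcs
  linarith

theorem continuous_schrodingerFunC (hF : ContinuousOn F (tube n t)) (X : CSpace n) {U : CSpace n}
    (hU : U ∈ tube n t) : Continuous (schrodingerFunC X U F) := by
  unfold schrodingerFunC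
  exact Continuous.mul (by fun_prop) (hF.comp_continuous
    (continuous_toComplex.add continuous_const) fun ξ => toComplex_add_mem_tube_iff.2 hU)

theorem div_add_le_sqrt {a b r t : ℝ} (hr : 0 < r) (hrt : r < t)
    (hab : a ^ 2 + b ^ 2 ≤ r ^ 2) : (t ^ 2 - r ^ 2) / (2 * t) + a ≤ √(t ^ 2 - b ^ 2) := by
  have ht : 0 < t := hr.trans hrt
  have har : a ≤ r := le_of_sq_le_sq (by linarith [sq_nonneg b]) hr.le
  set δ := (t ^ 2 - r ^ 2) / (2 * t)
  have hδ : δ * (2 * t) = t ^ 2 - r ^ 2 := div_mul_cancel₀ _ (by positivity)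
  have hδ0 : 0 ≤ δ := div_nonneg (by nlinarith) (by positivity)
  have hδle : δ ≤ t - r := by
    rw [div_le_iff₀ (by positivity)]
    nlinarith
  refine Real.le_sqrt_of_sq_le ?_
  linarith [mul_le_mul_of_nonneg_left (show δ + 2 * a ≤ 2 * t by linarith) hδ0]

theorem norm_schrodingerFunC_neg_I_smul_le (hC0 : 0 ≤ C)
    (hC : ∀ z ∈ tube n t, ‖F z‖ ≤ C * Real.exp (-(‖rePart z‖ * √(t ^ 2 - ‖imPart z‖ ^ 2))))
    {r : ℝ} (hr : 0 < r) (hrt : r < t) {ζ : CSpace n} (hζ : ‖ζ‖ ^ 2 ≤ r ^ 2) (ξ : RSpace n) :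
    ‖schrodingerFunC (-Complex.I • ζ) ζ F ξ‖ ≤
      C * Real.exp (-((t ^ 2 - r ^ 2) / (2 * t) * ‖ξ + rePart ζ‖)) := by
  have hζt : ζ ∈ tube n t :=
    (norm_imPart_le ζ).trans_lt ((le_of_sq_le_sq hζ hr.le).trans_lt hrt)
  have hre : rePart (-Complex.I • ζ) = imPart ζ := by
    ext j
    simp [rePart, imPart]
  have him : imPart (-Complex.I • ζ) = -rePart ζ := by
    ext j
    simp [rePart, imPart]
  refine (norm_schrodingerFunC_le hC0 hC _ hζt ξ).trans
    (mul_le_mul_of_nonneg_left (Real.exp_le_exp.2 ?_) hC0)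
  rw [hre, him, inner_neg_left, real_inner_self_eq_norm_sq, real_inner_self_eq_norm_sq, norm_neg]
  rw [norm_sq_eq_rePart_add_imPart] at hζ
  have hδ := mul_le_mul_of_nonneg_right (div_add_le_sqrt hr hrt hζ)
    (norm_nonneg (ξ + rePart ζ))
  linarith [sq_nonneg ‖rePart ζ‖, sq_nonneg ‖imPart ζ‖]

theorem exists_hasAnnihilationBound_of_hasTubeBound {r : ℝ} (hr : 0 < r) (hrt : r < t)
    (hF : IsHolomorphicExtension φ t F) (hb : HasTubeBound t F) :
    ∃ M, HasAnnihilationBound φ r M := by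
  obtain ⟨C, hC0, hC⟩ := hb.exists_nonneg
  have hbdd : ∀ z ∈ tube n t, ‖F z‖ ≤ C := fun z hz => (hC z hz).trans
    (mul_le_of_le_one_right hC0 (Real.exp_le_one_iff.2 (neg_nonpos.2 (by positivity))))
  set δ := (t ^ 2 - r ^ 2) / (2 * t)
  have hδ : 0 < δ := div_pos (by nlinarith) (by linarith)
  set bound : RSpace n → ℝ := fun x => C * Real.exp (-(δ * ‖x‖))
  have hbound : MemLp bound 2 := (memLp_exp_neg_mul_norm volume hδ).const_mul C
  refine ⟨(eLpNorm bound 2 volume).toReal, fun ζ hζ S d => ?_⟩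
  have hζt : ζ ∈ tube n t :=
    (norm_imPart_le ζ).trans_lt ((le_of_sq_le_sq hζ hr.le).trans_lt hrt)
  have hshift := measurePreserving_add_right (volume : Measure (RSpace n)) (rePart ζ)
  have hle : ∀ x, ‖schrodingerFunC (-Complex.I • ζ) ζ F x‖ ≤ bound (x + rePart ζ) :=
    norm_schrodingerFunC_neg_I_smul_le hC0 hC hr hrt hζ
  have hmem : MemLp (schrodingerFunC (-Complex.I • ζ) ζ F) 2 :=
    (hbound.comp_measurePreserving hshift).of_le
      (continuous_schrodingerFunC hF.1.continuousOn _ hζt).aestronglyMeasurable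
      (Eventually.of_forall fun x => (hle x).trans (Real.le_norm_self _))
  have hnorm : ‖hmem.toLp _‖ ≤ (eLpNorm bound 2 volume).toReal := by
    rw [Lp.norm_toLp, ← eLpNorm_comp_measurePreserving hbound.1 hshift]
    exact ENNReal.toReal_mono (hbound.comp_measurePreserving hshift).2.ne (eLpNorm_mono_real hle)
  simp only [integral_mul_creationFun hF hbdd hC0 hζt, ← inner_hermiteVec_toLp _ hmem]
  exact (norm_sum_mul_inner_hermiteVec_le _ S d).trans
    (mul_le_mul_of_nonneg_right hnorm (Real.sqrt_nonneg _))

theorem mem_VOmega_of_hasTubeBound (hn : 0 < n) (hs : 0 < s) (hst : s < t)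
    (hF : IsHolomorphicExtension φ t F) (hb : HasTubeBound t F) : φ ∈ VOmega n s := by
  obtain ⟨r, hsr, hrt⟩ := exists_between hst
  obtain ⟨M, hM⟩ := exists_hasAnnihilationBound_of_hasTubeBound (hs.trans hsr) hrt hF hb
  exact hM.mem_VOmega hn hs hsr

end TubeBound

/-! ### Analytic vectors -/

section Complexification

variable {E H : Type*} [NormedAddCommGroup E] [NormedSpace ℝ E] [NormedAddCommGroup H]
  [NormedSpace ℝ H] [NormedSpace ℂ H]

/-- The polynomial in a complex variable that extends `μ ↦ p (v + μ w, …, v + μ w)`, for a real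
multilinear map `p` with values in a complex space. -/
def complexLine {m : ℕ} (p : E [×m]→L[ℝ] H) (v w : E) (μ : ℂ) : H :=
  ∑ s : Finset (Fin m), μ ^ s.card • p (s.piecewise (fun _ => w) fun _ => v)

theorem complexLine_ofReal [IsScalarTower ℝ ℂ H] {m : ℕ} (p : E [×m]→L[ℝ] H) (v w : E) (μ : ℝ) :
    complexLine p v w μ = p fun _ => v + μ • w := by
  have hpiecewise : ∀ s : Finset (Fin m), p (s.piecewise (fun _ => μ • w) fun _ => v) =
      μ ^ s.card • p (s.piecewise (fun _ => w) fun _ => v) := fun s => by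
    have h := p.map_piecewise_smul (fun _ => μ) (s.piecewise (fun _ => w) fun _ => v) s
    rw [Finset.prod_const] at h
    rw [← h]
    congr 1
    ext i
    by_cases hi : i ∈ s <;> simp [hi]
  have hsplit : (fun _ : Fin m => v + μ • w) = (fun _ => μ • w) + fun _ => v :=
    funext fun _ => add_comm _ _
  rw [hsplit, ContinuousMultilinearMap.map_add_univ, complexLine]
  refine Finset.sum_congr rfl fun s _ => ?_
  rw [hpiecewise, ← Complex.ofReal_pow]
  exact algebraMap_smul ℂ (μ ^ s.card) _

theorem norm_complexLine_le {m : ℕ} (p : E [×m]→L[ℝ] H) (v w : E) (μ : ℂ) :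
    ‖complexLine p v w μ‖ ≤ ‖p‖ * (‖μ‖ * ‖w‖ + ‖v‖) ^ m := by
  have hterm : ∀ s : Finset (Fin m), ‖μ ^ s.card • p (s.piecewise (fun _ => w) fun _ => v)‖ ≤
      ‖p‖ * ((‖μ‖ * ‖w‖) ^ s.card * ‖v‖ ^ (m - s.card)) := fun s => by
    have hprod : ∏ i, ‖s.piecewise (fun _ => w) (fun _ => v) i‖ =
        ‖w‖ ^ s.card * ‖v‖ ^ (m - s.card) := by
      simp only [Finset.piecewise, apply_ite norm, Finset.prod_ite, Finset.prod_const,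
        Finset.filter_mem_eq_inter, Finset.filter_notMem_eq_sdiff, Finset.univ_inter,
        Finset.card_univ_sdiff, Fintype.card_fin]
    rw [norm_smul, norm_pow, mul_pow, mul_assoc, mul_left_comm]
    refine mul_le_mul_of_nonneg_left ?_ (by positivity)
    exact hprod ▸ p.le_opNorm _
  refine (norm_sum_le _ _).trans ((Finset.sum_le_sum fun s _ => hterm s).trans_eq ?_)
  rw [← Finset.mul_sum]
  congr 1
  simpa using Fintype.sum_pow_mul_eq_add_pow (Fin m) (‖μ‖ * ‖w‖) ‖v‖

theorem exists_differentiableOn_eq_of_analyticAt [IsScalarTower ℝ ℂ H] [CompleteSpace H]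
    {f : E → H} (hf : AnalyticAt ℝ f 0) :
    ∃ ρ M : ℝ, 0 < ρ ∧ ∀ v w : E, ‖v‖ ≤ ρ → ‖w‖ ≤ ρ → ∃ c : ℂ → H,
      DifferentiableOn ℂ c (ball 0 2) ∧ (∀ μ : ℝ, |μ| < 2 → c μ = f (v + μ • w)) ∧
        ∀ μ ∈ ball (0 : ℂ) 2, ‖c μ‖ ≤ M := by
  obtain ⟨p, r, hp⟩ := hf
  obtain ⟨δ, hδ0, hδr⟩ := ENNReal.lt_iff_exists_nnreal_btwn.1 hp.r_pos
  have hδ : (0 : ℝ) < δ := by exact_mod_cast hδ0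
  have hsum : Summable fun m => ‖p m‖ * (δ : ℝ) ^ m :=
    p.summable_norm_mul_pow (hδr.trans_le hp.r_le)
  refine ⟨δ / 3, ∑' m, ‖p m‖ * (δ : ℝ) ^ m, by positivity, fun v w hv hw => ?_⟩
  have hline : ∀ μ : ℂ, ‖μ‖ < 2 → ‖μ‖ * ‖w‖ + ‖v‖ ≤ δ := fun μ hμ => by
    linarith [mul_le_mul hμ.le hw (norm_nonneg w) two_pos.le]
  have hbound : ∀ m, ∀ μ ∈ ball (0 : ℂ) 2, ‖complexLine (p m) v w μ‖ ≤ ‖p m‖ * (δ : ℝ) ^ m :=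
    fun m μ hμ => (norm_complexLine_le (p m) v w μ).trans (mul_le_mul_of_nonneg_left
      (pow_le_pow_left₀ (by positivity) (hline μ (mem_ball_zero_iff.1 hμ)) m) (norm_nonneg _))
  refine ⟨fun μ => ∑' m, complexLine (p m) v w μ, ?_, fun μ hμ => ?_, fun μ hμ =>
    tsum_of_norm_bounded hsum.hasSum fun m => hbound m μ hμ⟩
  · refine Complex.differentiableOn_tsum_of_summable_norm hsum (fun m => ?_) isOpen_ball hbound
    unfold complexLine
    fun_prop
  · have hball : v + μ • w ∈ eball (0 : E) r := by
      have hnorm : ‖v + μ • w‖ ≤ δ := by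
        have h := hline μ (by simpa using hμ)
        rw [Complex.norm_real, ← norm_smul] at h
        exact (norm_add_le v _).trans (by linarith)
      rw [mem_eball_zero_iff]
      refine lt_of_le_of_lt ?_ hδr
      rw [← ofReal_norm, ← ENNReal.ofReal_coe_nnreal]
      exact ENNReal.ofReal_le_ofReal hnorm
    simp only [complexLine_ofReal]
    simpa only [zero_add] using (hp.hasSum hball).tsum_eq

end Complexification

/-- The inclusion `ℝⁿ → ℂⁿ` of real points, as a continuous real-linear map. -/
noncomputable def toComplexCLM : RSpace n →L[ℝ] CSpace n where
  toFun := toComplex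
  map_add' := toComplex_add
  map_smul' := toComplex_smul
  cont := continuous_toComplex

theorem differentiable_integral_mul_schrodingerFunC (φ : LTwo n) (α : Fin n → ℕ) :
    Differentiable ℂ fun p : CSpace n × CSpace n =>
      ∫ x, (φ : RSpace n → ℂ) x * schrodingerFunC p.1 p.2 (hermiteMultiC α) x := by
  have hherm := differentiable_hermiteMultiC α
  rw [← differentiableOn_univ]
  refine (analyticOnNhd_integral_of_dominated isOpen_univ (fun p _ => ?_) (fun x => ?_)
    fun p _ => ?_).differentiableOn
  · refine (Lp.aestronglyMeasurable φ).mul (Continuous.aestronglyMeasurable ?_)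
    unfold schrodingerFunC
    exact Continuous.mul (by fun_prop)
      (hherm.continuous.comp (continuous_toComplex.add continuous_const))
  · unfold schrodingerFunC
    exact (Differentiable.const_mul (Differentiable.mul (by fun_prop)
      (hherm.comp (by fun_prop))) _).differentiableOn
  · obtain ⟨K, -, hK⟩ := exists_norm_schrodingerFunC_hermiteMultiC_le α
      (R := ‖p‖ + 1) (by positivity)
    refine ⟨fun x => ‖(φ : RSpace n → ℂ) x‖ * (K * Real.exp (-(1 * ‖x‖))),
      (Lp.memLp φ).norm.integrable_mul ((memLp_exp_neg_mul_norm volume one_pos).const_mul K), ?_⟩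
    filter_upwards [ball_mem_nhds p one_pos] with q hq x
    have hqp : ‖q‖ ≤ ‖p‖ + 1 := by linarith [norm_sub_norm_le q p, mem_ball_iff_norm.1 hq]
    rw [norm_mul]
    exact mul_le_mul_of_nonneg_left
      (hK _ _ ((norm_fst_le q).trans hqp) ((norm_snd_le q).trans hqp) x) (norm_nonneg _)

theorem inner_hermiteVec_I_eq_integral_mul_creationFun (φ : LTwo n) (α : Fin n → ℕ) (ζ : CSpace n)
    {c : ℂ → LTwo n} (hc : DifferentiableOn ℂ c (ball 0 2))
    (hreal : ∀ μ : ℝ, |μ| < 2 →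
      c μ = schrodinger (imPart ζ + μ • -rePart ζ) (rePart ζ + μ • imPart ζ) 0 φ) :
    inner ℂ (hermiteVec α) (c Complex.I) = ∫ x, (φ : RSpace n → ℂ) x * creationFun ζ α x := by
  let X : ℂ → CSpace n := fun μ => toComplexCLM (imPart ζ) + μ • toComplexCLM (-rePart ζ)
  let U : ℂ → CSpace n := fun μ => -(toComplexCLM (rePart ζ) + μ • toComplexCLM (imPart ζ))
  let f : ℂ → ℂ := fun μ => inner ℂ (hermiteVec α) (c μ)
  let g : ℂ → ℂ := fun μ =>
    ∫ x, (φ : RSpace n → ℂ) x * schrodingerFunC (X μ) (U μ) (hermiteMultiC α) x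
  have hf : DifferentiableOn ℂ f (ball 0 2) :=
    (innerSL ℂ (hermiteVec α)).differentiable.comp_differentiableOn hc
  have hXU : Differentiable ℂ fun μ => (X μ, U μ) := by unfold X U; fun_prop
  have hg : Differentiable ℂ g := by
    have hcomp := (differentiable_integral_mul_schrodingerFunC φ α).comp hXU
    exact hcomp
  have hagree : ∀ μ : ℝ, ‖(μ : ℂ)‖ < 2 → f μ = g μ := fun μ hμ => by
    simp only [f, g, X, U]
    rw [hreal μ (by simpa using hμ), inner_hermiteVec_schrodinger, toComplex_add, toComplex_add,
      toComplex_smul, toComplex_smul]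
    rfl
  have hfreq : ∃ᶠ μ in 𝓝[≠] (0 : ℂ), f μ = g μ :=
    ((frequently_ofReal_nhdsNE (p := fun μ => ‖μ‖ < 2 → f μ = g μ) hagree).and_eventually
      (mem_nhdsWithin_of_mem_nhds (ball_mem_nhds 0 two_pos))).mono
      fun μ h => h.1 (mem_ball_zero_iff.1 h.2)
  have hfg : f Complex.I = g Complex.I :=
    (hf.analyticOnNhd isOpen_ball).eqOn_of_preconnected_of_frequently_eq
      (hg.differentiableOn.analyticOnNhd isOpen_ball) (convex_ball _ _).isPreconnected
      (mem_ball_self two_pos) hfreq (by simp)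
  have hIU : U Complex.I = -ζ := congrArg Neg.neg (toComplex_rePart_add_I_smul ζ)
  have hIX : X Complex.I = -Complex.I • ζ := by
    conv_rhs => rw [← toComplex_rePart_add_I_smul ζ]
    simp only [X, map_neg, smul_add, smul_smul, smul_neg, neg_smul, neg_mul, Complex.I_mul_I,
      neg_neg, one_smul]
    exact add_comm _ _
  rw [creationFun_eq_schrodingerFunC, ← hIX, ← hIU]
  exact hfg

theorem exists_hasAnnihilationBound_of_isAnalyticVector {φ : LTwo n} (hφ : IsAnalyticVector φ) :
    ∃ t M, 0 < t ∧ HasAnnihilationBound φ t M := by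
  obtain ⟨ρ, M, hρ, hline⟩ := exists_differentiableOn_eq_of_analyticAt (hφ 0 (mem_univ 0))
  refine ⟨ρ, M, hρ, fun ζ hζ S d => ?_⟩
  have hζρ := le_of_sq_le_sq hζ hρ.le
  have hre : ‖rePart ζ‖ ≤ ρ := (norm_rePart_le ζ).trans hζρ
  have him : ‖imPart ζ‖ ≤ ρ := (norm_imPart_le ζ).trans hζρ
  obtain ⟨c, hcd, hcr, hcb⟩ := hline (imPart ζ, rePart ζ, 0) (-rePart ζ, imPart ζ, 0)
    (by simp [Prod.norm_def, hre, him]) (by simp [Prod.norm_def, hre, him])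
  simp only [← inner_hermiteVec_I_eq_integral_mul_creationFun φ _ ζ hcd fun μ hμ => by
    simpa using hcr μ hμ]
  exact (norm_sum_mul_inner_hermiteVec_le _ S d).trans
    (mul_le_mul_of_nonneg_right (hcb _ (by simp)) (Real.sqrt_nonneg _))

theorem exists_hasTubeBound_of_isAnalyticVector (hn : 0 < n) {φ : LTwo n}
    (hφ : IsAnalyticVector φ) :
    ∃ t : ℝ, 0 < t ∧ ∃ F : CSpace n → ℂ, IsHolomorphicExtension φ t F ∧ HasTubeBound t F := by
  obtain ⟨t, M, ht, hM⟩ := exists_hasAnnihilationBound_of_isAnalyticVector hφ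
  obtain ⟨F, hF, hb⟩ := exists_holomorphicExtension_of_mem_VOmega hn (half_pos ht)
    (hM.mem_VOmega hn (half_pos ht) (half_lt_self ht))
  exact ⟨t / 4, by positivity, F, ⟨hF.1.mono (tube_mono (by linarith)), hF.2⟩,
    hb (t / 4) (by positivity) (by linarith)⟩

theorem norm_schrodingerFunC_le_exp {t C : ℝ} (hC0 : 0 ≤ C) {F : CSpace n → ℂ}
    (hC : ∀ z ∈ tube n t,
      ‖F z‖ ≤ C * Real.exp (-(‖rePart z‖ * √(t ^ 2 - ‖imPart z‖ ^ 2))))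
    {X U : CSpace n} (hX : X ∈ tube n (t / 4)) (hU : U ∈ tube n (t / 4)) {R : ℝ} (hXR : ‖X‖ ≤ R)
    (hUR : ‖U‖ ≤ R) (ξ : RSpace n) :
    ‖schrodingerFunC X U F ξ‖ ≤
      C * Real.exp (R * (R + t / 4)) * Real.exp (-(t / 4 * ‖ξ‖)) := by
  have hXt : ‖imPart X‖ < t / 4 := hX
  have hUt : ‖imPart U‖ < t / 4 := hU
  have ht : 0 < t := by linarith [norm_nonneg (imPart X)]
  have hR : 0 ≤ R := (norm_nonneg X).trans hXR
  have him : inner ℝ (imPart X) (rePart U) ≤ R * R := (real_inner_le_norm _ _).trans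
    (mul_le_mul ((norm_imPart_le X).trans hXR) ((norm_rePart_le U).trans hUR) (norm_nonneg _) hR)
  have hre : -inner ℝ (rePart X) (imPart U) ≤ R * R :=
    (neg_le_abs _).trans <| (abs_real_inner_le_norm _ _).trans
      (mul_le_mul ((norm_rePart_le X).trans hXR) ((norm_imPart_le U).trans hUR) (norm_nonneg _) hR)
  have hsqrt : t / 2 ≤ √(t ^ 2 - ‖imPart U‖ ^ 2) :=
    Real.le_sqrt_of_sq_le (by nlinarith [norm_nonneg (imPart U)])
  have hdecay : t / 4 * (‖ξ‖ - R) ≤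
      (√(t ^ 2 - ‖imPart U‖ ^ 2) - ‖imPart X‖) * ‖ξ + rePart U‖ :=
    (mul_le_mul_of_nonneg_left (by linarith [norm_sub_norm_le_norm_add_rePart ξ U])
      (by positivity)).trans (mul_le_mul_of_nonneg_right (by linarith) (norm_nonneg _))
  refine (norm_schrodingerFunC_le hC0 hC X (tube_mono (by linarith) hU) ξ).trans ?_
  rw [mul_assoc, ← Real.exp_add]
  exact mul_le_mul_of_nonneg_left (Real.exp_le_exp.2 (by linarith)) hC0

theorem exists_analyticOnNhd_ae_eq_schrodingerFunC {t : ℝ} (ht : 0 < t) {F : CSpace n → ℂ}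
    (hF : DifferentiableOn ℂ F (tube n t)) (hb : HasTubeBound t F) :
    ∃ G : CSpace n × CSpace n → LTwo n,
      AnalyticOnNhd ℂ G (tube n (t / 4) ×ˢ tube n (t / 4)) ∧
        ∀ X ∈ tube n (t / 4), ∀ U ∈ tube n (t / 4),
          G (X, U) =ᵐ[volume] schrodingerFunC X U F := by
  obtain ⟨C, hC0, hC⟩ := hb.exists_nonneg
  set V : Set (CSpace n × CSpace n) := tube n (t / 4) ×ˢ tube n (t / 4)
  have hV : IsOpen V := (isOpen_tube _).prod (isOpen_tube _)
  have hVt : ∀ p ∈ V, p.2 ∈ tube n t := fun p hp => tube_mono (by linarith) hp.2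
  have hdom : ∀ R, MemLp (fun ξ : RSpace n =>
      C * Real.exp (R * (R + t / 4)) * Real.exp (-(t / 4 * ‖ξ‖))) 2 volume := fun R =>
    (memLp_exp_neg_mul_norm volume (by positivity)).const_mul _
  have hle : ∀ p ∈ V, ∀ R, ‖p‖ ≤ R → ∀ ξ, ‖schrodingerFunC p.1 p.2 F ξ‖ ≤
      C * Real.exp (R * (R + t / 4)) * Real.exp (-(t / 4 * ‖ξ‖)) := fun p hp R hR ξ =>
    norm_schrodingerFunC_le_exp hC0 hC hp.1 hp.2 ((norm_fst_le p).trans hR)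
      ((norm_snd_le p).trans hR) ξ
  have hmem : ∀ p ∈ V, MemLp (schrodingerFunC p.1 p.2 F) 2 volume := fun p hp =>
    (hdom ‖p‖).mono' (continuous_schrodingerFunC hF.continuousOn p.1
      (hVt p hp)).aestronglyMeasurable (Eventually.of_forall (hle p hp _ le_rfl))
  choose! G hG using fun p (hp : p ∈ V) =>
    (⟨(hmem p hp).toLp _, (hmem p hp).coeFn_toLp⟩ :
      ∃ G : LTwo n, G =ᵐ[volume] schrodingerFunC p.1 p.2 F)
  refine ⟨G, analyticOnNhd_Lp_of_dominated hV hG (fun ξ => ?_) fun p hp => ?_,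
    fun X hX U hU => hG (X, U) ⟨hX, hU⟩⟩
  · unfold schrodingerFunC
    exact DifferentiableOn.mul (Differentiable.differentiableOn (by fun_prop))
      (hF.comp (by fun_prop) fun p hp => toComplex_add_mem_tube_iff.2 (hVt p hp))
  · refine ⟨_, hdom (‖p‖ + 1), ?_⟩
    filter_upwards [hV.mem_nhds hp, ball_mem_nhds p one_pos] with q hq hqp
    exact hle q hq _ (by linarith [norm_sub_norm_le q p, mem_ball_iff_norm.1 hqp])

theorem schrodinger_eq_exp_smul {F : CSpace n → ℂ} {φ ψ : LTwo n} {x u : RSpace n}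
    (hF : ∀ᵐ ξ : RSpace n, (φ : RSpace n → ℂ) ξ = F (toComplex ξ))
    (hψ : ψ =ᵐ[volume] schrodingerFunC (toComplex x) (toComplex u) F) (τ : ℝ) :
    schrodinger x u τ φ = Complex.exp (Complex.I * τ) • ψ := by
  refine Lp.ext ?_
  have hshift := (measurePreserving_add_right (volume : Measure (RSpace n)) u)
    |>.quasiMeasurePreserving.ae hF
  filter_upwards [(memLp_schrodingerFun x u τ φ).coeFn_toLp, hshift, hψ,
    Lp.coeFn_smul (Complex.exp (Complex.I * τ)) ψ] with ξ hπ hφξ hψξ hsmul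
  rw [hsmul, Pi.smul_apply, hψξ, schrodinger, hπ, schrodingerFunC_toComplex]
  simp only [schrodingerFun, Function.comp_apply, hφξ, smul_eq_mul, Complex.ofReal_zero, mul_zero,
    Complex.exp_zero, one_mul, mul_assoc]

theorem isAnalyticVector_of_hasTubeBound {t : ℝ} (ht : 0 < t) {φ : LTwo n} {F : CSpace n → ℂ}
    (hF : IsHolomorphicExtension φ t F) (hb : HasTubeBound t F) : IsAnalyticVector φ := by
  obtain ⟨G, hGan, hG⟩ := exists_analyticOnNhd_ae_eq_schrodingerFunC ht hF.1 hb
  have hreal : ∀ x : RSpace n, toComplex x ∈ tube n (t / 4) := toComplex_mem_tube (by positivity)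
  have horbit : ∀ (x u : RSpace n) (τ : ℝ), schrodinger x u τ φ =
      Complex.exp (Complex.I * τ) • G (toComplex x, toComplex u) := fun x u =>
    schrodinger_eq_exp_smul hF.2 (hG _ (hreal x) _ (hreal u))
  intro g _
  simp only [horbit]
  let J : RSpace n × RSpace n × ℝ →L[ℝ] CSpace n × CSpace n :=
    toComplexCLM.prodMap (toComplexCLM ∘L .fst ℝ (RSpace n) ℝ)
  let T : RSpace n × RSpace n × ℝ →L[ℝ] ℂ :=
    Complex.ofRealCLM ∘L .snd ℝ (RSpace n) ℝ ∘L .snd ℝ (RSpace n) (RSpace n × ℝ)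
  have hGJ : AnalyticAt ℝ G (J g) := (hGan (J g) ⟨hreal g.1, hreal g.2.1⟩).restrictScalars
  have hexp : AnalyticAt ℂ (fun z => Complex.exp (Complex.I * z)) (T g) := by fun_prop
  exact (hexp.restrictScalars.comp (T.analyticAt g)).smul (hGJ.comp (J.analyticAt g))

end AnalyticVectors

theorem theorem3p3 (n : ℕ) (hn : 0 < n) (φ : AnalyticVectors.LTwo n) :
    (AnalyticVectors.IsAnalyticVector φ ↔
      ∃ t : ℝ, 0 < t ∧ ∃ F : AnalyticVectors.CSpace n → ℂ,
        AnalyticVectors.IsHolomorphicExtension φ t F ∧ AnalyticVectors.HasTubeBound t F) ∧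
    (∀ t : ℝ, 0 < t → φ ∈ AnalyticVectors.VOmega n t →
      ∃ F : AnalyticVectors.CSpace n → ℂ, AnalyticVectors.IsHolomorphicExtension φ t F ∧
        ∀ s : ℝ, 0 < s → s < t → AnalyticVectors.HasTubeBound s F) ∧
    (∀ t : ℝ, 0 < t →
      (∃ F : AnalyticVectors.CSpace n → ℂ,
        AnalyticVectors.IsHolomorphicExtension φ t F ∧ AnalyticVectors.HasTubeBound t F) →
      ∀ s : ℝ, 0 < s → s < t → φ ∈ AnalyticVectors.VOmega n s) := by
  refine ⟨⟨AnalyticVectors.exists_hasTubeBound_of_isAnalyticVector hn, ?_⟩, ?_, ?_⟩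
  · rintro ⟨t, ht, F, hF, hb⟩
    exact AnalyticVectors.isAnalyticVector_of_hasTubeBound ht hF hb
  · exact fun t ht hφ => AnalyticVectors.exists_holomorphicExtension_of_mem_VOmega hn ht hφ
  · rintro t - ⟨F, hF, hb⟩ s hs hst
    exact AnalyticVectors.mem_VOmega_of_hasTubeBound hn hs hst hF hb
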